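/- **Conventions.** For partially defined expressions write $x\simeq y$ if both are undefined, or both are defined and equal; write $x\preceq y$ if $x$ is undefined, or both are defined and equal. Let $(\mathcal C,\otimes,I,\sigma)$ be a symmetric monoidal category (formulas are written as if $\mathcal C$ were strict; in general the canonical associativity and unit isomorphisms are inserted). A *partial trace* (Haghverdi–Scott) on $\mathcal C$ is a family of partial functions $\mathrm{Tr}^U_{A,B}:\mathcal C(A\otimes U,B\otimes U)\rightharpoonup\mathcal C(A,B)$ such that - (naturality) $h\circ \mathrm{Tr}^U(f)\circ g\preceq \mathrm{Tr}^U((h\otimes 1_U)\circ f\circ(g\otimes 1_U))$; - (dinaturality) $\mathrm{Tr}^U((1_B\otimes g)\circ f)\simeq \mathrm{Tr}^{U'}(f\circ(1_A\otimes g))$ for $f:A\otimes U\to B\otimes U'$, $g:U'\to U$; - (strength) $g\otimes \mathrm{Tr}^U(f)\preceq \mathrm{Tr}^U(g\otimes f)$; - (vanishing I) $\mathrm{Tr}^I(f)\simeq f$; - (vanishing II) if $\mathrm{Tr}^V(f)$ is defined, then $\mathrm{Tr}^U(\mathrm{Tr}^V(f))\simeq \mathrm{Tr}^{U\otimes V}(f)$;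 - (yanking) $\mathrm{Tr}^A(\sigma_{A,A})\simeq 1_A$. A *partially traced category* is a symmetric monoidal category with a partial trace; it is *totally traced* if every $\mathrm{Tr}^U_{A,B}$ is a total function. In a compact closed category, with duals $U^*$, units $\eta_U:I\to U^*\otimes U$ and counits $\varepsilon_U:U\otimes U^*\to I$, the *canonical trace* is $\mathrm{Tr}^U(f)=(1_B\otimes\varepsilon_U)\circ(f\otimes 1_{U^*})\circ(1_A\otimes\sigma_{U^*,U})\circ(1_A\otimes\eta_U)$. **The construction.** Let $\mathcal C$ be a partially traced category. The graph $\mathrm{Int}^p(\mathcal C)$ has as objects the pairs $A=(A^+,A^-)$ of objects of $\mathcal C$, and as arrows $A\to B$ the morphisms $A^+\otimes B^-\to B^+\otimes A^-$ of $\mathcal C$. For a path $\vec p=p_1,\dots,p_n$ with vertices $A_0,\dots,A_n$ put $V_n=A_0^-\otimes\dots\otimes A_{n-1}^-$ and define $[\![\vec p]\!]:A_0^+\otimes V_n\otimes A_n^-\to A_n^+\otimes A_0^-\otimes V_n$ recursively: $[\![\ ]\!]=1$, and $$[\![\vec p,g]\!]=(1\otimes\sigma_{A_n^-,\,A_0^-\otimes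 V_n})\circ(g\otimes 1)\circ(1\otimes\sigma_{A_0^-\otimes V_n,\,A_{n+1}^-})\circ([\![\vec p]\!]\otimes 1_{A_{n+1}^-})$$ for $g:A_n\to A_{n+1}$. The partial composite of $\vec p$ is $[\vec p]\simeq\mathrm{Tr}^{V_n}([\![\vec p]\!]\circ(1_{A_0^+}\otimes\sigma_{A_n^-,V_n}))$. The identity arrow $1_A$ of $A$ is the identity of $A^+\otimes A^-$. The tensor on $\mathrm{Int}^p(\mathcal C)$ is $A\otimes B=(A^+\otimes B^+,B^-\otimes A^-)$ on objects with unit $(I,I)$; for $f:A\to A'$ and $g:B\to B'$ the arrow $f\otimes g$ is the morphism $(1_{A'^+}\otimes\sigma_{A^-,\,B'^+\otimes B^-})\circ(f\otimes g)\circ(1_{A^+}\otimes\sigma_{B^+\otimes B'^-,\,A'^-})$ of $\mathcal C$. The symmetry is $\sigma_{A^+,B^+}\otimes\sigma_{A^-,B^-}$; the dual is $A^*=(A^-,A^+)$, with $\eta_A$ and $\varepsilon_A$ given by the identities of $A^-\otimes A^+$ and of $A^+\otimes A^-$. Let $\mathrm{Path}(\mathrm{Int}^p(\mathcal C))$ be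 the category of paths of this graph under concatenation, and let $\sim$ be the smallest family of equivalence relations on its hom-sets that is compatible with concatenation, satisfies $\vec p\sim[\vec p]$ (as a path of length one) whenever $[\vec p]$ is defined, and satisfies $\vec p\otimes 1_X\sim\vec q\otimes 1_X$ and $1_X\otimes\vec p\sim1_X\otimes\vec q$ whenever $\vec p\sim\vec q$ (tensoring a path arrow by arrow). Let $N(A)=(A,I)$ and $N(f)=f$ for objects $A$ and morphisms $f$ of $\mathcal C$, and let $Q$ be the map from $\mathrm{Int}^p(\mathcal C)$ to $\mathrm{Path}(\mathrm{Int}^p(\mathcal C))/{\sim}$ that is the identity on objects and sends an arrow to the class of the corresponding path of length one. **Theorem.** Every partially traced category $\mathcal C$ can be faithfully embedded in a totally traced category, by an embedding that preserves and reflects the trace. More precisely: 1. the category $\mathcal D=\mathrm{Path}(\mathrm{Int}^p(\mathcal C))/{\sim}$ is a compact closed category, whose tensor, unit, symmetry, structural isomorphisms, duals, units and counits are those induced from $\mathrm{Int}^p(\mathcal C)$ along $Q$; 2. the canonical trace of $\mathcal D$ is a total trace; 3. the composite $F=Q\circ N:\mathcal C\to\mathrm{Int}^p(\mathcal C)\to\mathcal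 D$ is a faithful strong symmetric monoidal functor, whose comparison isomorphisms $m_{A,B}:FA\otimes FB\to F(A\otimes B)$ and $m_I:I\to FI$ are the canonical ones (identities if $\mathcal C$ is strict); 4. for all $f:A\otimes U\to B\otimes U$ and $g:A\to B$ in $\mathcal C$: $\mathrm{Tr}^U(f)$ is defined and equal to $g$ if and only if $\mathrm{Tr}^{FU}(m_{B,U}^{-1}\circ F(f)\circ m_{A,U})=F(g)$ in $\mathcal D$. -/

import Mathlib

open CategoryTheory MonoidalCategory

universe v u

noncomputable section

/-! ### Partial and total traces -/

/-- A partial trace (Haghverdi–Scott) on a symmetric monoidal category. Partial values are elements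
of `Part`: equality in `Part` is Kleene equality, and `x ≤ y` in `Part` (every value of `x` is a
value of `y`) is directed Kleene equality. -/
class PartialTrace (C : Type u) [Category.{v} C] [MonoidalCategory C] [SymmetricCategory C] where
  /-- The partial operation `Tr^U_{A,B}`. -/
  tr {A B : C} (U : C) (f : A ⊗ U ⟶ B ⊗ U) : Part (A ⟶ B)
  naturality {A B A' B' U : C} (f : A ⊗ U ⟶ B ⊗ U) (g : A' ⟶ A) (h : B ⟶ B') :
    (tr U f).map (fun t => g ≫ t ≫ h) ≤ tr U (g ▷ U ≫ f ≫ h ▷ U)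
  dinaturality {A B U U' : C} (f : A ⊗ U ⟶ B ⊗ U') (g : U' ⟶ U) :
    tr U (f ≫ B ◁ g) = tr U' (A ◁ g ≫ f)
  strength {A B U X Y : C} (f : A ⊗ U ⟶ B ⊗ U) (g : X ⟶ Y) :
    (tr U f).map (fun t => g ⊗ₘ t) ≤ tr U ((α_ X A U).hom ≫ (g ⊗ₘ f) ≫ (α_ Y B U).inv)
  vanishing_unit {A B : C} (f : A ⊗ 𝟙_ C ⟶ B ⊗ 𝟙_ C) :
    tr (𝟙_ C) f = Part.some ((ρ_ A).inv ≫ f ≫ (ρ_ B).hom)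
  vanishing_tensor {A B U V : C} (f : (A ⊗ U) ⊗ V ⟶ (B ⊗ U) ⊗ V) :
    (tr V f).Dom →
      (tr V f).bind (tr U) = tr (U ⊗ V) ((α_ A U V).inv ≫ f ≫ (α_ B U V).hom)
  yanking (A : C) : tr A (β_ A A).hom = Part.some (𝟙 A)

/-- A (total) trace on a symmetric monoidal category. -/
structure TotalTrace (D : Type u) [Category.{v} D] [MonoidalCategory D] [SymmetricCategory D] where
  /-- The operation `Tr^U_{A,B}`. -/
  tr {A B : D} (U : D) (f : A ⊗ U ⟶ B ⊗ U) : A ⟶ B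
  naturality {A B A' B' U : D} (f : A ⊗ U ⟶ B ⊗ U) (g : A' ⟶ A) (h : B ⟶ B') :
    g ≫ tr U f ≫ h = tr U (g ▷ U ≫ f ≫ h ▷ U)
  dinaturality {A B U U' : D} (f : A ⊗ U ⟶ B ⊗ U') (g : U' ⟶ U) :
    tr U (f ≫ B ◁ g) = tr U' (A ◁ g ≫ f)
  strength {A B U X Y : D} (f : A ⊗ U ⟶ B ⊗ U) (g : X ⟶ Y) :
    g ⊗ₘ tr U f = tr U ((α_ X A U).hom ≫ (g ⊗ₘ f) ≫ (α_ Y B U).inv)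
  vanishing_unit {A B : D} (f : A ⊗ 𝟙_ D ⟶ B ⊗ 𝟙_ D) :
    tr (𝟙_ D) f = (ρ_ A).inv ≫ f ≫ (ρ_ B).hom
  vanishing_tensor {A B U V : D} (f : (A ⊗ U) ⊗ V ⟶ (B ⊗ U) ⊗ V) :
    tr U (tr V f) = tr (U ⊗ V) ((α_ A U V).inv ≫ f ≫ (α_ B U V).hom)
  yanking (A : D) : tr A (β_ A A).hom = 𝟙 A

/-- The formula of the canonical trace of a compact closed category. A compact closed category is a
symmetric monoidal category in which every object `U` has a chosen dual `U* = ᘁU` with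
`η : 𝟙 ⟶ U* ⊗ U` and `ε : U ⊗ U* ⟶ 𝟙`, i.e. a symmetric category with `LeftRigidCategory`. -/
def canonicalTrace {D : Type u} [Category.{v} D] [MonoidalCategory D] [SymmetricCategory D]
    [LeftRigidCategory D] {A B : D} (U : D) (f : A ⊗ U ⟶ B ⊗ U) : A ⟶ B :=
  (ρ_ A).inv ≫ A ◁ η_ (HasLeftDual.leftDual U) U ≫
    A ◁ (β_ (HasLeftDual.leftDual U) U).hom ≫
    (α_ A U (HasLeftDual.leftDual U)).inv ≫
    f ▷ HasLeftDual.leftDual U ≫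
    (α_ B U (HasLeftDual.leftDual U)).hom ≫
    B ◁ ε_ (HasLeftDual.leftDual U) U ≫ (ρ_ B).hom

/-! ### The graph `Int^p(C)`

`C` is not assumed to be strict; the canonical associativity and unit isomorphisms are inserted
where the strict definition has identities (`⊗≫` is composition with the unique structural
isomorphism inserted between the two factors). -/

/-- Objects of `Int^p(C)`: pairs `(A⁺, A⁻)` of objects of `C`. -/
structure IntP (C : Type u) where
  pos : C
  neg : C

namespace IntP

variable {C : Type u} [Category.{v} C] [MonoidalCategory C]

/-- An arrow `A ⟶ B` of `Int^p(C)` is a morphism `A⁺ ⊗ B⁻ ⟶ B⁺ ⊗ A⁻` of `C`. -/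
structure Hom (A B : IntP C) where
  hom : A.pos ⊗ B.neg ⟶ B.pos ⊗ A.neg

instance : Quiver (IntP C) where
  Hom A B := Hom A B

/-- The identity arrow `1_A`, which is also the composite of the empty path at `A`. -/
def idHom (A : IntP C) : A ⟶ A := Hom.mk (𝟙 (A.pos ⊗ A.neg))

/-- For a path with vertices `A₀, …, Aₙ`, the object `A₀⁻ ⊗ ⋯ ⊗ Aₙ₋₁⁻`. -/
def feedback {A : IntP C} : ∀ {B : IntP C}, Quiver.Path A B → C
  | _, .nil => 𝟙_ C
  | _, @Quiver.Path.cons _ _ _ B _ p _ => feedback p ⊗ B.neg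

variable [SymmetricCategory C]

/-- Precomposition of a path with vertices `A₀, …, Aₙ`: a morphism
`A₀⁺ ⊗ (A₀⁻ ⊗ ⋯ ⊗ Aₙ₋₁⁻) ⊗ Aₙ⁻ ⟶ Aₙ⁺ ⊗ A₀⁻ ⊗ (A₀⁻ ⊗ ⋯ ⊗ Aₙ₋₁⁻)`. A further arrow
`g : B ⟶ D` is applied to the wires `B⁺` and `D⁻`; its output `B⁻` becomes the last wire. -/
def precomp {A : IntP C} : ∀ {B : IntP C} (p : Quiver.Path A B),
    A.pos ⊗ (feedback p ⊗ B.neg) ⟶ B.pos ⊗ (A.neg ⊗ feedback p)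
  | _, .nil => A.pos ◁ ((λ_ A.neg).hom ≫ (ρ_ A.neg).inv)
  | D, @Quiver.Path.cons _ _ _ B _ p g =>
      𝟙 (A.pos ⊗ ((feedback p ⊗ B.neg) ⊗ D.neg)) ⊗≫
        precomp p ▷ D.neg ⊗≫
        B.pos ◁ (β_ (A.neg ⊗ feedback p) D.neg).hom ⊗≫
        g.hom ▷ (A.neg ⊗ feedback p) ⊗≫
        D.pos ◁ (β_ B.neg (A.neg ⊗ feedback p)).hom ⊗≫
        𝟙 (D.pos ⊗ (A.neg ⊗ (feedback p ⊗ B.neg)))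

/-- The partial composition `[p]` of a path in `Int^p(C)`. -/
def comp [PartialTrace C] {A B : IntP C} (p : Quiver.Path A B) : Part (A ⟶ B) :=
  (PartialTrace.tr (feedback p)
    (𝟙 ((A.pos ⊗ B.neg) ⊗ feedback p) ⊗≫
      A.pos ◁ (β_ B.neg (feedback p)).hom ⊗≫
      precomp p ⊗≫
      𝟙 ((B.pos ⊗ A.neg) ⊗ feedback p))).map Hom.mk

/-! ### Tensor, symmetry and duals on `Int^p(C)` -/

/-- `(A⁺, A⁻) ⊗ (B⁺, B⁻) = (A⁺ ⊗ B⁺, B⁻ ⊗ A⁻)`. -/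
def tensorObj (A B : IntP C) : IntP C := ⟨A.pos ⊗ B.pos, B.neg ⊗ A.neg⟩

/-- The tensor unit `(I, I)`. -/
def unit (C : Type u) [Category.{v} C] [MonoidalCategory C] : IntP C := ⟨𝟙_ C, 𝟙_ C⟩

/-- The tensor of arrows: `f` and `g` are placed in parallel, after and before permuting wires. -/
def tensorHom {A A' B B' : IntP C} (f : A ⟶ A') (g : B ⟶ B') :
    tensorObj A B ⟶ tensorObj A' B' :=
  Hom.mk (𝟙 ((A.pos ⊗ B.pos) ⊗ (B'.neg ⊗ A'.neg)) ⊗≫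
    A.pos ◁ (β_ (B.pos ⊗ B'.neg) A'.neg).hom ⊗≫
    (f.hom ⊗ₘ g.hom) ⊗≫
    A'.pos ◁ (β_ A.neg (B'.pos ⊗ B.neg)).hom ⊗≫
    𝟙 ((A'.pos ⊗ B'.pos) ⊗ (B.neg ⊗ A.neg)))

/-- The symmetry `σ_{A⁺,B⁺} ⊗ σ_{A⁻,B⁻}`. -/
def braidHom (A B : IntP C) : tensorObj A B ⟶ tensorObj B A :=
  Hom.mk ((β_ A.pos B.pos).hom ⊗ₘ (β_ A.neg B.neg).hom)

/-- The associativity arrow (an identity when `C` is strict). -/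
def assocHom (A B D : IntP C) :
    tensorObj (tensorObj A B) D ⟶ tensorObj A (tensorObj B D) :=
  Hom.mk ((α_ A.pos B.pos D.pos).hom ⊗ₘ (α_ D.neg B.neg A.neg).hom)

/-- The left unit arrow (an identity when `C` is strict). -/
def leftUnitHom (A : IntP C) : tensorObj (unit C) A ⟶ A :=
  Hom.mk ((λ_ A.pos).hom ⊗ₘ (ρ_ A.neg).inv)

/-- The right unit arrow (an identity when `C` is strict). -/
def rightUnitHom (A : IntP C) : tensorObj A (unit C) ⟶ A :=
  Hom.mk ((ρ_ A.pos).hom ⊗ₘ (λ_ A.neg).inv)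

/-- `(A⁺, A⁻)* = (A⁻, A⁺)`. -/
def dual (A : IntP C) : IntP C := ⟨A.neg, A.pos⟩

/-- The unit `η_A : I ⟶ A* ⊗ A`, given by the identity of `A⁻ ⊗ A⁺`. -/
def etaHom (A : IntP C) : unit C ⟶ tensorObj A.dual A :=
  Hom.mk ((λ_ (A.neg ⊗ A.pos)).hom ≫ (ρ_ (A.neg ⊗ A.pos)).inv)

/-- The counit `ε_A : A ⊗ A* ⟶ I`, given by the identity of `A⁺ ⊗ A⁻`. -/
def epsHom (A : IntP C) : tensorObj A A.dual ⟶ unit C :=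
  Hom.mk ((ρ_ (A.pos ⊗ A.neg)).hom ≫ (λ_ (A.pos ⊗ A.neg)).inv)

/-- The graph homomorphism `1_X ⊗ -`. -/
def tensorLeft (X : IntP C) : IntP C ⥤q IntP C where
  obj A := tensorObj X A
  map f := tensorHom (idHom X) f

/-- The graph homomorphism `- ⊗ 1_X`. -/
def tensorRight (X : IntP C) : IntP C ⥤q IntP C where
  obj A := tensorObj A X
  map f := tensorHom f (idHom X)

/-- The graph homomorphism `N : C → Int^p(C)`, `N A = (A, I)`, `N f = f`. -/
def embed (C : Type u) [Category.{v} C] [MonoidalCategory C] : C ⥤q IntP C where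
  obj A := ⟨A, 𝟙_ C⟩
  map f := Hom.mk (f ▷ 𝟙_ C)

/-- The comparison arrow `N A ⊗ N B ⟶ N (A ⊗ B)` (an identity when `C` is strict). -/
def embedMu (A B : C) :
    tensorObj ((embed C).obj A) ((embed C).obj B) ⟶ (embed C).obj (A ⊗ B) :=
  Hom.mk ((A ⊗ B) ◁ (λ_ (𝟙_ C)).inv)

/-! ### The completion `Path(Int^p(C))/∼` -/

variable [PartialTrace C]

/-- A congruence relation on the path category of `Int^p(C)`. -/
structure IsCongruence (S : ∀ A B : IntP C, Quiver.Path A B → Quiver.Path A B → Prop) : Prop where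
  equivalence (A B : IntP C) : Equivalence (S A B)
  comp {A B D : IntP C} {p p' : Quiver.Path A B} {q q' : Quiver.Path B D} :
    S A B p p' → S B D q q' → S A D (p.comp q) (p'.comp q')
  eval {A B : IntP C} (p : Quiver.Path A B) (f : A ⟶ B) :
    f ∈ IntP.comp p → S A B p f.toPath
  tensorRight {A B : IntP C} {p q : Quiver.Path A B} (X : IntP C) :
    S A B p q → S _ _ ((tensorRight X).mapPath p) ((tensorRight X).mapPath q)
  tensorLeft {A B : IntP C} {p q : Quiver.Path A B} (X : IntP C) :
    S A B p q → S _ _ ((tensorLeft X).mapPath p) ((tensorLeft X).mapPath q)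

/-- The smallest congruence `∼`: the intersection of all congruences. -/
def sim (C : Type u) [Category.{v} C] [MonoidalCategory C] [SymmetricCategory C]
    [PartialTrace C] : HomRel (Paths (IntP C)) :=
  fun A B p q =>
    ∀ S : ∀ A B : IntP C, Quiver.Path A B → Quiver.Path A B → Prop, IsCongruence S → S A B p q

/-- The category `Path(Int^p(C))/∼`. -/
abbrev Completion (C : Type u) [Category.{v} C] [MonoidalCategory C] [SymmetricCategory C]
    [PartialTrace C] : Type u :=
  CategoryTheory.Quotient (sim C)

/-- The graph homomorphism `Int^p(C) → Path(Int^p(C))/∼` sending an arrow to the class of the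
corresponding path of length one. -/
def toCompletion (C : Type u) [Category.{v} C] [MonoidalCategory C] [SymmetricCategory C]
    [PartialTrace C] : IntP C ⥤q Completion C :=
  Paths.of (IntP C) ⋙q (CategoryTheory.Quotient.functor (sim C)).toPrefunctor

/-- The compact closed structure on `Path(Int^p(C))/∼` is the one induced from `Int^p(C)`: the
canonical map `Int^p(C) → Path(Int^p(C))/∼` strictly preserves the tensor of objects and arrows,
the unit, the symmetry, the duals with their units and counits, and the structural isomorphisms. -/
structure IsInducedStructure (C : Type u) [Category.{v} C] [MonoidalCategory C]
    [SymmetricCategory C] [PartialTrace C] [MonoidalCategory (Completion C)]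
    [SymmetricCategory (Completion C)] [LeftRigidCategory (Completion C)] : Prop where
  tensorObj_eq (A B : IntP C) :
    (toCompletion C).obj A ⊗ (toCompletion C).obj B = (toCompletion C).obj (tensorObj A B)
  unit_eq : 𝟙_ (Completion C) = (toCompletion C).obj (unit C)
  tensorHom_eq {A A' B B' : IntP C} (f : A ⟶ A') (g : B ⟶ B') :
    (toCompletion C).map f ⊗ₘ (toCompletion C).map g =
      eqToHom (tensorObj_eq A B) ≫ (toCompletion C).map (tensorHom f g) ≫
        eqToHom (tensorObj_eq A' B').symm
  associator_eq (A B D : IntP C) :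
    (α_ ((toCompletion C).obj A) ((toCompletion C).obj B) ((toCompletion C).obj D)).hom =
      eqToHom (by rw [tensorObj_eq, tensorObj_eq]) ≫ (toCompletion C).map (assocHom A B D) ≫
        eqToHom (by rw [tensorObj_eq, tensorObj_eq])
  leftUnitor_eq (A : IntP C) :
    (λ_ ((toCompletion C).obj A)).hom =
      eqToHom (by rw [unit_eq, tensorObj_eq]) ≫ (toCompletion C).map (leftUnitHom A)
  rightUnitor_eq (A : IntP C) :
    (ρ_ ((toCompletion C).obj A)).hom =
      eqToHom (by rw [unit_eq, tensorObj_eq]) ≫ (toCompletion C).map (rightUnitHom A)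
  braiding_eq (A B : IntP C) :
    (β_ ((toCompletion C).obj A) ((toCompletion C).obj B)).hom =
      eqToHom (tensorObj_eq A B) ≫ (toCompletion C).map (braidHom A B) ≫
        eqToHom (tensorObj_eq B A).symm
  dual_eq (A : IntP C) :
    HasLeftDual.leftDual ((toCompletion C).obj A) = (toCompletion C).obj A.dual
  eta_eq (A : IntP C) :
    η_ (HasLeftDual.leftDual ((toCompletion C).obj A)) ((toCompletion C).obj A) =
      eqToHom unit_eq ≫ (toCompletion C).map (etaHom A) ≫
        eqToHom (by rw [dual_eq, tensorObj_eq])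
  eps_eq (A : IntP C) :
    ε_ (HasLeftDual.leftDual ((toCompletion C).obj A)) ((toCompletion C).obj A) =
      eqToHom (by rw [dual_eq, tensorObj_eq]) ≫ (toCompletion C).map (epsHom A) ≫
        eqToHom unit_eq.symm

/-- A strong symmetric monoidal functor `C ⥤ Path(Int^p(C))/∼` is the composite
`C → Int^p(C) → Path(Int^p(C))/∼`: on objects and morphisms, and with the comparison isomorphisms
coming from `Int^p(C)`. -/
structure IsComposite {C : Type u} [Category.{v} C] [MonoidalCategory C]
    [SymmetricCategory C] [PartialTrace C] [MonoidalCategory (Completion C)]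
    [SymmetricCategory (Completion C)] [LeftRigidCategory (Completion C)]
    (hD : IsInducedStructure C) (F : C ⥤ Completion C) [F.Braided] : Prop where
  obj_eq (A : C) : F.obj A = (toCompletion C).obj ((embed C).obj A)
  map_eq {A B : C} (f : A ⟶ B) :
    F.map f = eqToHom (obj_eq A) ≫ (toCompletion C).map ((embed C).map f) ≫
      eqToHom (obj_eq B).symm
  unit_eq : Functor.LaxMonoidal.ε F = eqToHom (hD.unit_eq.trans (obj_eq (𝟙_ C)).symm)
  mu_eq (A B : C) : Functor.LaxMonoidal.μ F A B =
    eqToHom (by rw [obj_eq, obj_eq, hD.tensorObj_eq]) ≫ (toCompletion C).map (embedMu A B) ≫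
      eqToHom (obj_eq (A ⊗ B)).symm

end IntP

end

/-! Faithfulness and reflection of the trace both require that `∼` identifies nothing by accident:
if a path `p` satisfies `p ∼ f` for an arrow `f`, then `[p]` must already be defined and equal to
`f`. As `∼` is only known as a smallest congruence, it is bounded from above by an explicit one.

A path is regarded as a formal trace (`IntP.pathTrace`): the morphism whose trace would be `[p]`,
whether or not this trace exists. Two formal traces are equivalent (`FormalTrace.Equiv`) if they
have the same partial trace in every context, where a context may contribute further traced wires.
If a formal trace has a value `t`, then strength, naturality and vanishing II allow `t` to replace
it in every context (`FormalTrace.trace_ctx`), so formal traces with a common value are equivalent;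
in particular `p` and `[p]` are. Appending or prepending an arrow and tensoring with an identity
amount to contexts, up to dinaturality and yanking. Hence equivalence of formal traces is a
congruence (`IntP.isCongruence_pathTrace`), and `[p] = f` if and only if `p ∼ f`
(`IntP.mem_comp_iff_sim`).

For the compact closed structure, arrows generate the completion, so naturality is checked on
arrows. The structural isomorphisms act separately on positive and negative wires; composing with
such an arrow is always defined, by yanking (`IntP.isComp_splitHom`, `IntP.splitHom_isComp`), and
coherence is inherited from `C`. Interchange and the triangle identities are also obtained by
yanking.

Finally, the canonical trace of an embedded `f` is a composite of two arrows of `Int^p(C)`, and the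
trace that computes this composite is `Tr^U(f)` up to unitors (`IntP.isComp_trace_iff`).

Equations between string diagrams are proved by reflection. By coherence
(`SymmetricCoherence.Mor.eval_eq`) a diagram with distinctly named wires is determined by its list
of boxes, and disconnected boxes may be exchanged. -/

set_option synthInstance.maxHeartbeats 1000000
set_option synthInstance.maxSize 100000
set_option linter.unusedSectionVars false

noncomputable section

/-! ### Coherence for symmetric monoidal categories -/

namespace SymmetricCoherence

/-- Codes for tensor products of named wires. -/
inductive Ob
  | var (n : ℕ)
  | one
  | tensor (a b : Ob)

/-- The wires of a code, from left to right. -/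
def Ob.wires : Ob → List ℕ
  | .var n => [n]
  | .one => []
  | .tensor a b => a.wires ++ b.wires

/-- Codes for structural isomorphisms. -/
inductive Mor : Ob → Ob → Type
  | id (a : Ob) : Mor a a
  | comp {a b c : Ob} (f : Mor a b) (g : Mor b c) : Mor a c
  | symm {a b : Ob} (f : Mor a b) : Mor b a
  | tensor {a b a' b' : Ob} (f : Mor a b) (g : Mor a' b') : Mor (.tensor a a') (.tensor b b')
  | assoc (a b c : Ob) : Mor (.tensor (.tensor a b) c) (.tensor a (.tensor b c))
  | leftUnit (a : Ob) : Mor (.tensor .one a) a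
  | rightUnit (a : Ob) : Mor (.tensor a .one) a
  | braid (a b : Ob) : Mor (.tensor a b) (.tensor b a)

theorem Mor.wires_perm {a b : Ob} (m : Mor a b) : a.wires.Perm b.wires := by
  induction m with
  | id a => exact .refl _
  | comp _ _ hf hg => exact hf.trans hg
  | symm _ hf => exact hf.symm
  | tensor _ _ hf hg => exact hf.append hg
  | assoc a b c => simp [Ob.wires]
  | leftUnit a => simp [Ob.wires]
  | rightUnit a => simp [Ob.wires]
  | braid a b => exact List.perm_append_comm

variable {C : Type u} [Category.{v} C] [MonoidalCategory C]

/-- The object of `C` denoted by a code. -/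
def Ob.eval (w : ℕ → C) : Ob → C
  | .var n => w n
  | .one => 𝟙_ C
  | .tensor a b => a.eval w ⊗ b.eval w

variable [SymmetricCategory C]

/-- The structural isomorphism of `C` denoted by a code. -/
def Mor.eval (w : ℕ → C) : ∀ {a b : Ob}, Mor a b → (a.eval w ≅ b.eval w)
  | _, _, .id a => Iso.refl _
  | _, _, .comp f g => f.eval w ≪≫ g.eval w
  | _, _, .symm f => (f.eval w).symm
  | _, _, .tensor f g => f.eval w ⊗ᵢ g.eval w
  | _, _, .assoc a b c => α_ _ _ _
  | _, _, .leftUnit a => λ_ _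
  | _, _, .rightUnit a => ρ_ _
  | _, _, .braid a b => β_ _ _

-- Compatibility of the tensor product, as a monoidal functor of two variables, with braidings. It
-- is the one splitting law that needs a symmetry and not just a braiding: a double crossing of `X₁`
-- and `Y₂` has to cancel.
open BraidedCategory in
theorem tensorμ_braiding (X₁ X₂ Y₁ Y₂ : C) :
    (β_ (X₁ ⊗ X₂) (Y₁ ⊗ Y₂)).hom ≫ tensorμ Y₁ Y₂ X₁ X₂ =
      tensorμ X₁ X₂ Y₁ Y₂ ≫ ((β_ X₁ Y₁).hom ⊗ₘ (β_ X₂ Y₂).hom) := by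
  simp [tensorμ, SymmetricCategory.braiding_swap_eq_inv_braiding Y₂ X₁,
    MonoidalCategory.tensorHom_def]

/-- The tensor product of two splittings of objects. -/
def splitTensor {X X₁ X₂ Y Y₁ Y₂ : C} (a : X ≅ X₁ ⊗ X₂) (b : Y ≅ Y₁ ⊗ Y₂) :
    X ⊗ Y ≅ (X₁ ⊗ Y₁) ⊗ (X₂ ⊗ Y₂) where
  hom := (a.hom ⊗ₘ b.hom) ≫ tensorμ _ _ _ _
  inv := tensorδ _ _ _ _ ≫ (a.inv ⊗ₘ b.inv)

section

variable {X X₁ X₂ Y Y₁ Y₂ Z Z₁ Z₂ : C} (a : X ≅ X₁ ⊗ X₂) (b : Y ≅ Y₁ ⊗ Y₂) (c : Z ≅ Z₁ ⊗ Z₂)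

theorem splitTensor_assoc :
    (α_ X Y Z).hom ≫ (splitTensor a (splitTensor b c)).hom =
      (splitTensor (splitTensor a b) c).hom ≫ ((α_ X₁ Y₁ Z₁).hom ⊗ₘ (α_ X₂ Y₂ Z₂).hom) := by
  have h := tensor_associativity X₁ X₂ Y₁ Y₂ Z₁ Z₂
  have h₁ : (a.hom ⊗ₘ b.hom) ≫ tensorμ X₁ X₂ Y₁ Y₂ ⊗ₘ c.hom =
      ((a.hom ⊗ₘ b.hom) ⊗ₘ c.hom) ≫ tensorμ X₁ X₂ Y₁ Y₂ ▷ (Z₁ ⊗ Z₂) := by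
    rw [← tensorHom_id, tensorHom_comp_tensorHom, Category.comp_id]
  have h₂ : a.hom ⊗ₘ (b.hom ⊗ₘ c.hom) ≫ tensorμ Y₁ Y₂ Z₁ Z₂ =
      (a.hom ⊗ₘ (b.hom ⊗ₘ c.hom)) ≫ (X₁ ⊗ X₂) ◁ tensorμ Y₁ Y₂ Z₁ Z₂ := by
    rw [← id_tensorHom, tensorHom_comp_tensorHom, Category.comp_id]
  dsimp only [splitTensor]
  simp only [h₁, h₂, Category.assoc, h, associator_naturality_assoc]

theorem splitTensor_leftUnit :
    (λ_ X).hom ≫ a.hom =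
      (splitTensor (λ_ (𝟙_ C)).symm a).hom ≫ ((λ_ X₁).hom ⊗ₘ (λ_ X₂).hom) := by
  have h := tensor_left_unitality X₁ X₂
  dsimp only [splitTensor, Iso.symm_hom]
  rw [MonoidalCategory.tensorHom_def', Category.assoc, Category.assoc, ← h]
  simp

theorem splitTensor_rightUnit :
    (ρ_ X).hom ≫ a.hom =
      (splitTensor a (λ_ (𝟙_ C)).symm).hom ≫ ((ρ_ X₁).hom ⊗ₘ (ρ_ X₂).hom) := by
  have h := tensor_right_unitality X₁ X₂
  dsimp only [splitTensor, Iso.symm_hom]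
  rw [MonoidalCategory.tensorHom_def, Category.assoc, Category.assoc, ← h]
  simp

theorem splitTensor_braid :
    (β_ X Y).hom ≫ (splitTensor b a).hom =
      (splitTensor a b).hom ≫ ((β_ X₁ Y₁).hom ⊗ₘ (β_ X₂ Y₂).hom) := by
  simp only [splitTensor, Category.assoc, ← tensorμ_braiding,
    BraidedCategory.braiding_naturality_assoc]

theorem splitTensor_tensor {X' X₁' X₂' Y' Y₁' Y₂' : C} (a' : X' ≅ X₁' ⊗ X₂')
    (b' : Y' ≅ Y₁' ⊗ Y₂') (f : X ⟶ X') (g : Y ⟶ Y') (f₁ : X₁ ⟶ X₁') (f₂ : X₂ ⟶ X₂')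
    (g₁ : Y₁ ⟶ Y₁') (g₂ : Y₂ ⟶ Y₂') (hf : f ≫ a'.hom = a.hom ≫ (f₁ ⊗ₘ f₂))
    (hg : g ≫ b'.hom = b.hom ≫ (g₁ ⊗ₘ g₂)) :
    (f ⊗ₘ g) ≫ (splitTensor a' b').hom =
      (splitTensor a b).hom ≫ ((f₁ ⊗ₘ g₁) ⊗ₘ (f₂ ⊗ₘ g₂)) := by
  simp only [splitTensor, Category.assoc, tensorHom_comp_tensorHom_assoc, hf, hg]
  rw [← tensorHom_comp_tensorHom_assoc, tensorμ_natural]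

end

/-- If every wire splits as a tensor product, so does every code. -/
def Ob.split {w x y : ℕ → C} (d : ∀ n, w n ≅ x n ⊗ y n) : ∀ a : Ob, a.eval w ≅ a.eval x ⊗ a.eval y
  | .var n => d n
  | .one => (λ_ (𝟙_ C)).symm
  | .tensor a b => splitTensor (a.split d) (b.split d)

/-- Splitting is a monoidal natural isomorphism; each constructor of `m` corresponds to one of the
`splitTensor` laws. -/
theorem Mor.split_naturality {w x y : ℕ → C} (d : ∀ n, w n ≅ x n ⊗ y n) {a b : Ob} (m : Mor a b) :
    (m.eval w).hom ≫ (b.split d).hom =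
      (a.split d).hom ≫ ((m.eval x).hom ⊗ₘ (m.eval y).hom) := by
  induction m with
  | id a => simp [Mor.eval]
  | comp f g hf hg =>
    simp only [Mor.eval, Iso.trans_hom, Category.assoc, hg, reassoc_of% hf, tensorHom_comp_tensorHom]
  | symm f hf =>
    simp only [Mor.eval, Iso.symm_hom, Iso.inv_comp_eq, ← Category.assoc, hf]
    simp
  | tensor f g hf hg => exact splitTensor_tensor _ _ _ _ _ _ _ _ _ _ hf hg
  | assoc a b c => exact splitTensor_assoc _ _ _
  | leftUnit a => exact splitTensor_leftUnit _
  | rightUnit a => exact splitTensor_rightUnit _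
  | braid a b => exact splitTensor_braid _ _

theorem Mor.eval_eq_of_split {w x y : ℕ → C} (d : ∀ n, w n ≅ x n ⊗ y n) {a b : Ob} (m m' : Mor a b)
    (hx : m.eval x = m'.eval x) (hy : m.eval y = m'.eval y) : m.eval w = m'.eval w := by
  ext
  rw [← cancel_mono (b.split d).hom, m.split_naturality, m'.split_naturality, hx, hy]

/-! ### Codes in which all wires, or all but one, are the unit object. -/

/-- The tensor product with an object isomorphic to the unit on the right. -/
def rightTensor {X Y Z : C} (a : X ≅ Z) (b : Y ≅ 𝟙_ C) : X ⊗ Y ≅ Z := (a ⊗ᵢ b) ≪≫ ρ_ _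

/-- The tensor product with an object isomorphic to the unit on the left. -/
def leftTensor {X Y Z : C} (a : X ≅ 𝟙_ C) (b : Y ≅ Z) : X ⊗ Y ≅ Z := (a ⊗ᵢ b) ≪≫ λ_ _

section

variable {X Y Z W : C}

theorem leftTensor_assoc (a : X ≅ 𝟙_ C) (b : Y ≅ 𝟙_ C) (c : Z ≅ W) :
    (α_ X Y Z).hom ≫ (leftTensor a (leftTensor b c)).hom = (leftTensor (leftTensor a b) c).hom := by
  simp [leftTensor, MonoidalCategory.tensorHom_def]

theorem middleTensor_assoc (a : X ≅ 𝟙_ C) (b : Y ≅ W) (c : Z ≅ 𝟙_ C) :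
    (α_ X Y Z).hom ≫ (leftTensor a (rightTensor b c)).hom =
      (rightTensor (leftTensor a b) c).hom := by
  simp [leftTensor, rightTensor, MonoidalCategory.tensorHom_def]
  monoidal

theorem rightTensor_assoc (a : X ≅ W) (b : Y ≅ 𝟙_ C) (c : Z ≅ 𝟙_ C) :
    (α_ X Y Z).hom ≫ (rightTensor a (leftTensor b c)).hom =
      (rightTensor (rightTensor a b) c).hom := by
  simp [leftTensor, rightTensor, MonoidalCategory.tensorHom_def]

theorem leftTensor_unit (b : Y ≅ Z) :
    (λ_ Y).hom ≫ b.hom = (leftTensor (Iso.refl (𝟙_ C)) b).hom := by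
  simp [leftTensor, MonoidalCategory.tensorHom_def]

theorem rightTensor_unit (b : Y ≅ Z) :
    (ρ_ Y).hom ≫ b.hom = (rightTensor b (Iso.refl (𝟙_ C))).hom := by
  simp [rightTensor, MonoidalCategory.tensorHom_def]

/-- Rests on the agreement of both unitors at the unit. `Ob.unitIso` always uses `leftTensor`, so
the right unitor and the braiding require this change of side. -/
theorem leftTensor_eq_rightTensor (a : X ≅ 𝟙_ C) (b : Y ≅ 𝟙_ C) :
    leftTensor a b = rightTensor a b := by
  ext
  simp [leftTensor, rightTensor, unitors_equal]

theorem braid_leftTensor (a : X ≅ 𝟙_ C) (b : Y ≅ Z) :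
    (β_ Y X).hom ≫ (leftTensor a b).hom = (rightTensor b a).hom := by
  simp only [leftTensor, rightTensor, Iso.trans_hom, tensorIso_hom]
  rw [← BraidedCategory.braiding_naturality_assoc, braiding_leftUnitor]

theorem braid_rightTensor (a : X ≅ 𝟙_ C) (b : Y ≅ Z) :
    (β_ X Y).hom ≫ (rightTensor b a).hom = (leftTensor a b).hom := by
  simp only [leftTensor, rightTensor, Iso.trans_hom, tensorIso_hom]
  rw [← BraidedCategory.braiding_naturality_assoc, braiding_rightUnitor]

theorem leftTensor_tensor {X' Y' : C} (f : X ⟶ X') (g : Y ⟶ Y') (a : X ≅ 𝟙_ C) (b : Y ≅ Z)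
    (a' : X' ≅ 𝟙_ C) (b' : Y' ≅ Z) (hf : f ≫ a'.hom = a.hom) (hg : g ≫ b'.hom = b.hom) :
    (f ⊗ₘ g) ≫ (leftTensor a' b').hom = (leftTensor a b).hom := by
  simp [leftTensor, hf, hg]

theorem rightTensor_tensor {X' Y' : C} (f : X ⟶ X') (g : Y ⟶ Y') (a : X ≅ Z) (b : Y ≅ 𝟙_ C)
    (a' : X' ≅ Z) (b' : Y' ≅ 𝟙_ C) (hf : f ≫ a'.hom = a.hom) (hg : g ≫ b'.hom = b.hom) :
    (f ⊗ₘ g) ≫ (rightTensor a' b').hom = (rightTensor a b).hom := by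
  simp [rightTensor, hf, hg]

end

/-- If all wires are units, so is every code. -/
def Ob.unitIso {w : ℕ → C} : ∀ a : Ob, (∀ n ∈ a.wires, w n = 𝟙_ C) → (a.eval w ≅ 𝟙_ C)
  | .var n, h => eqToIso (h n (by simp [Ob.wires]))
  | .one, _ => Iso.refl (𝟙_ C)
  | .tensor a b, h =>
    leftTensor (a.unitIso (fun n hn => h n (by simp [Ob.wires, hn])))
      (b.unitIso (fun n hn => h n (by simp [Ob.wires, hn])))

theorem Mor.unitIso_naturality {w : ℕ → C} {a b : Ob} (m : Mor a b)
    (ha : ∀ n ∈ a.wires, w n = 𝟙_ C) (hb : ∀ n ∈ b.wires, w n = 𝟙_ C) :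
    (m.eval w).hom ≫ (b.unitIso hb).hom = (a.unitIso ha).hom := by
  induction m with
  | id a => simp [Mor.eval]
  | comp f g hf hg =>
    simp only [Mor.eval, Iso.trans_hom, Category.assoc]
    rw [hg (fun n hn => ha n (f.wires_perm.symm.subset hn)), hf]
  | symm f hf => simp [Mor.eval, Iso.inv_comp_eq, hf hb ha]
  | tensor f g hf hg => exact leftTensor_tensor _ _ _ _ _ _ (hf _ _) (hg _ _)
  | assoc a b c => exact leftTensor_assoc _ _ _
  | leftUnit a => exact leftTensor_unit _
  | rightUnit a => 
    refine (rightTensor_unit _).trans ?_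
    rw [← leftTensor_eq_rightTensor]; rfl
  | braid a b =>
    refine (braid_leftTensor _ _).trans ?_
    rw [← leftTensor_eq_rightTensor]; rfl

/-- If the wire `k` occurs exactly once and all others are units, a code denotes the wire `k`. -/
def Ob.wireIso {w : ℕ → C} (k : ℕ) : ∀ a : Ob, (∀ n ∈ a.wires, n ≠ k → w n = 𝟙_ C) →
    a.wires.count k = 1 → (a.eval w ≅ w k)
  | .var n, h, hk => eqToIso (by
      have : n = k := by simpa [Ob.wires, List.count_singleton] using hk
      rw [this]; rfl)
  | .one, _, hk => by simp [Ob.wires] at hk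
  | .tensor a b, h, hk =>
    if hb : b.wires.count k = 0 then
      rightTensor
        (a.wireIso k (fun n hn => h n (by simp [Ob.wires, hn]))
          (by simpa [Ob.wires, hb] using hk))
        (b.unitIso (fun n hn => h n (by simp [Ob.wires, hn])
          (fun e => List.count_eq_zero.1 hb (e ▸ hn))))
    else
      have ha : a.wires.count k = 0 := by
        have : a.wires.count k + b.wires.count k = 1 := by simpa [Ob.wires] using hk
        omega
      leftTensor
        (a.unitIso (fun n hn => h n (by simp [Ob.wires, hn])
          (fun e => List.count_eq_zero.1 ha (e ▸ hn))))
        (b.wireIso k (fun n hn => h n (by simp [Ob.wires, hn]))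
          (by simpa [Ob.wires, ha] using hk))

theorem Ob.wireIso_tensor_right {w : ℕ → C} {k : ℕ} {a b : Ob}
    (h : ∀ n ∈ (Ob.tensor a b).wires, n ≠ k → w n = 𝟙_ C)
    (hk : (Ob.tensor a b).wires.count k = 1) (h₁ : ∀ n ∈ a.wires, n ≠ k → w n = 𝟙_ C)
    (h₂ : a.wires.count k = 1) (h₃ : ∀ n ∈ b.wires, w n = 𝟙_ C) :
    Ob.wireIso k (.tensor a b) h hk = rightTensor (a.wireIso k h₁ h₂) (b.unitIso h₃) :=
  dif_pos (by
    have : a.wires.count k + b.wires.count k = 1 := by simpa [Ob.wires] using hk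
    omega)

theorem Ob.wireIso_tensor_left {w : ℕ → C} {k : ℕ} {a b : Ob}
    (h : ∀ n ∈ (Ob.tensor a b).wires, n ≠ k → w n = 𝟙_ C)
    (hk : (Ob.tensor a b).wires.count k = 1) (h₁ : ∀ n ∈ a.wires, w n = 𝟙_ C)
    (h₂ : ∀ n ∈ b.wires, n ≠ k → w n = 𝟙_ C) (h₃ : b.wires.count k = 1) :
    Ob.wireIso k (.tensor a b) h hk = leftTensor (a.unitIso h₁) (b.wireIso k h₂ h₃) :=
  dif_neg (by omega)

/-- The position of `k` decides between `leftTensor` and `rightTensor` in `Ob.wireIso`, so the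
constructors that involve several factors are treated once for each factor that may contain `k`. -/
theorem Mor.wireIso_naturality {w : ℕ → C} (k : ℕ) {a b : Ob} (m : Mor a b)
    (ha : ∀ n ∈ a.wires, n ≠ k → w n = 𝟙_ C) (ha' : a.wires.count k = 1)
    (hb : ∀ n ∈ b.wires, n ≠ k → w n = 𝟙_ C) (hb' : b.wires.count k = 1) :
    (m.eval w).hom ≫ (b.wireIso k hb hb').hom = (a.wireIso k ha ha').hom := by
  have key {c : Ob} (hc : ∀ n ∈ c.wires, n ≠ k → w n = 𝟙_ C) (h0 : c.wires.count k = 0) :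
      ∀ n ∈ c.wires, w n = 𝟙_ C :=
    fun n hn => hc n hn (fun e => List.count_eq_zero.1 h0 (e ▸ hn))
  have left {c d : Ob} (h : ∀ n ∈ (Ob.tensor c d).wires, n ≠ k → w n = 𝟙_ C) :
      ∀ n ∈ c.wires, n ≠ k → w n = 𝟙_ C := fun n hn => h n (by simp [Ob.wires, hn])
  have right {c d : Ob} (h : ∀ n ∈ (Ob.tensor c d).wires, n ≠ k → w n = 𝟙_ C) :
      ∀ n ∈ d.wires, n ≠ k → w n = 𝟙_ C := fun n hn => h n (by simp [Ob.wires, hn])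
  have count (c d : Ob) : (Ob.tensor c d).wires.count k = c.wires.count k + d.wires.count k := by
    simp [Ob.wires]
  induction m with
  | id a => simp [Mor.eval]
  | comp f g hf hg =>
    simp only [Mor.eval, Iso.trans_hom, Category.assoc]
    rw [hg (fun n hn => ha n (f.wires_perm.symm.subset hn))
      ((f.wires_perm.count_eq k).symm.trans ha'), hf]
  | symm f hf => simp [Mor.eval, Iso.inv_comp_eq, hf hb hb' ha ha']
  | @tensor a b a' b' f g hf hg =>
    have hf' := f.wires_perm.count_eq k
    have hg' := g.wires_perm.count_eq k
    rw [count] at ha'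
    by_cases h0 : a'.wires.count k = 0
    · rw [Ob.wireIso_tensor_right _ _ (left ha) (by omega) (key (right ha) (by omega)),
        Ob.wireIso_tensor_right _ _ (left hb) (by omega) (key (right hb) (by omega))]
      exact rightTensor_tensor _ _ _ _ _ _ (hf _ _ _ _) (g.unitIso_naturality _ _)
    · rw [Ob.wireIso_tensor_left _ _ (key (left ha) (by omega)) (right ha) (by omega),
        Ob.wireIso_tensor_left _ _ (key (left hb) (by omega)) (right hb) (by omega)]
      exact leftTensor_tensor _ _ _ _ _ _ (f.unitIso_naturality _ _) (hg _ _ _ _)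
  | assoc a b c =>
    have h1 := count b c
    have h2 := count a b
    rw [count] at ha'
    by_cases h0 : c.wires.count k = 0
    · rw [Ob.wireIso_tensor_right _ _ (left ha) (by omega) (key (right ha) (by omega))]
      by_cases h3 : b.wires.count k = 0
      · rw [Ob.wireIso_tensor_right _ _ (left hb) (by omega) (key (right hb) (by omega)),
          Ob.wireIso_tensor_right _ _ (left (left ha)) (by omega) (key (right (left ha)) (by omega))]
        exact rightTensor_assoc _ _ _
      · rw [Ob.wireIso_tensor_left _ _ (key (left hb) (by omega)) (right hb) (by omega),
          Ob.wireIso_tensor_right _ _ (left (right hb)) (by omega)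
            (key (right (right hb)) (by omega)),
          Ob.wireIso_tensor_left _ _ (key (left (left ha)) (by omega)) (right (left ha)) (by omega)]
        exact middleTensor_assoc _ _ _
    · rw [Ob.wireIso_tensor_left _ _ (key (left ha) (by omega)) (right ha) (by omega),
        Ob.wireIso_tensor_left _ _ (key (left hb) (by omega)) (right hb) (by omega),
        Ob.wireIso_tensor_left _ _ (key (left (right hb)) (by omega)) (right (right hb)) (by omega)]
      exact leftTensor_assoc _ _ _
  | leftUnit a =>
    rw [Ob.wireIso_tensor_left _ _ (by simp [Ob.wires]) hb hb']
    exact leftTensor_unit _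
  | rightUnit a =>
    rw [Ob.wireIso_tensor_right _ _ hb hb' (by simp [Ob.wires])]
    exact rightTensor_unit _
  | braid a b =>
    rw [count] at ha'
    by_cases h0 : b.wires.count k = 0
    · rw [Ob.wireIso_tensor_right _ _ (left ha) (by omega) (key (right ha) (by omega)),
        Ob.wireIso_tensor_left _ _ (key (left hb) (by omega)) (right hb) (by omega)]
      exact braid_leftTensor _ _
    · rw [Ob.wireIso_tensor_left _ _ (key (left ha) (by omega)) (right ha) (by omega),
        Ob.wireIso_tensor_right _ _ (left hb) (by omega) (key (right hb) (by omega))]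
      exact braid_rightTensor _ _

theorem Mor.eval_eq_of_units {w : ℕ → C} {a b : Ob} (m m' : Mor a b)
    (h : ∀ n ∈ a.wires, w n = 𝟙_ C) : m.eval w = m'.eval w := by
  have hb : ∀ n ∈ b.wires, w n = 𝟙_ C := fun n hn => h n (m.wires_perm.symm.subset hn)
  ext
  rw [← cancel_mono (b.unitIso hb).hom, m.unitIso_naturality h, m'.unitIso_naturality h]

theorem Mor.eval_eq_of_wire {w : ℕ → C} (k : ℕ) {a b : Ob} (m m' : Mor a b)
    (h : ∀ n ∈ a.wires, n ≠ k → w n = 𝟙_ C) (hk : a.wires.count k = 1) :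
    m.eval w = m'.eval w := by
  have hb : ∀ n ∈ b.wires, n ≠ k → w n = 𝟙_ C := fun n hn => h n (m.wires_perm.symm.subset hn)
  have hk' := (m.wires_perm.count_eq k).symm.trans hk
  ext
  rw [← cancel_mono (b.wireIso k hb hk').hom, m.wireIso_naturality k h hk,
    m'.wireIso_naturality k h hk]

/-- Coherence: if no wire is repeated, all structural isomorphisms between two codes are equal. -/
theorem Mor.eval_eq {a b : Ob} (ha : a.wires.Nodup) (w : ℕ → C) (m m' : Mor a b) :
    m.eval w = m'.eval w := by
  -- `l` lists the wires that may still be nontrivial; the induction removes them one at a time.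
  suffices h : ∀ (l : List ℕ) (w : ℕ → C), (∀ n ∈ a.wires, n ∉ l → w n = 𝟙_ C) →
      m.eval w = m'.eval w from h a.wires w (fun n hn hn' => (hn' hn).elim)
  intro l
  induction l with
  | nil => exact fun w hw => m.eval_eq_of_units m' (fun n hn => hw n hn (by simp))
  | cons k l ih =>
    intro w hw
    -- Here `x` keeps only the wire `k` and `y` keeps all the others. Distinctness of wires enters
    -- because `k` must occur only once: a braiding of `k` with itself need not be an identity.
    refine m.eval_eq_of_split (x := fun n => if n = k then w n else 𝟙_ C)
      (y := fun n => if n = k then 𝟙_ C else w n) (fun n => if h : n = k then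
        (ρ_ (w n)).symm ≪≫ eqToIso (by simp [h]) else
        (λ_ (w n)).symm ≪≫ eqToIso (by simp [h])) m' ?_ ?_
    · by_cases hk : k ∈ a.wires
      · exact m.eval_eq_of_wire k m' (fun n _ hn => if_neg hn) (List.count_eq_one_of_mem ha hk)
      · exact m.eval_eq_of_units m' (fun n hn => if_neg (fun e : n = k => hk (e ▸ hn)))
    · refine ih _ (fun n hn hl => ?_)
      by_cases h : n = k
      · simp [h]
      · simpa [h] using hw n hn (by simp [h, hl])

end SymmetricCoherence

namespace SymmetricCoherence

/-! ### String diagrams with boxes -/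

/-- The code of a list of wires. -/
def Ob.ofList : List ℕ → Ob
  | [] => .one
  | n :: l => .tensor (.var n) (.ofList l)

theorem Ob.wires_ofList (l : List ℕ) : (Ob.ofList l).wires = l := by
  induction l with
  | nil => rfl
  | cons n l ih => exact congrArg (n :: ·) ih

/-- Exchange of two factors. -/
def Mor.exchange (a b c : Ob) : Mor (.tensor a (.tensor b c)) (.tensor b (.tensor a c)) :=
  .comp (.comp (.symm (.assoc _ _ _)) (.tensor (.braid _ _) (.id _))) (.assoc _ _ _)

theorem Mor.nonempty_ofList_append (l l' : List ℕ) :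
    Nonempty (Mor (.tensor (.ofList l) (.ofList l')) (.ofList (l ++ l'))) := by
  induction l with
  | nil => exact ⟨.leftUnit _⟩
  | cons n l ih =>
    obtain ⟨m⟩ := ih
    exact ⟨.comp (.assoc _ _ _) (.tensor (.id _) m)⟩

theorem Mor.nonempty_toList (a : Ob) : Nonempty (Mor a (.ofList a.wires)) := by
  induction a with
  | var n => exact ⟨.symm (.rightUnit _)⟩
  | one => exact ⟨.id _⟩
  | tensor a b ha hb =>
    obtain ⟨m⟩ := ha
    obtain ⟨m'⟩ := hb
    obtain ⟨m''⟩ := Mor.nonempty_ofList_append a.wires b.wires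
    exact ⟨.comp (.tensor m m') m''⟩

/-- Both codes are brought to right-nested form, where permutations are generated by exchanges of
neighbours. -/
theorem Mor.nonempty_of_perm {a b : Ob} (h : a.wires.Perm b.wires) : Nonempty (Mor a b) := by
  have key : ∀ {l l' : List ℕ}, l.Perm l' → Nonempty (Mor (.ofList l) (.ofList l')) := by
    intro l l' h
    induction h with
    | nil => exact ⟨.id _⟩
    | cons n _ ih => exact ih.elim fun m => ⟨.tensor (.id _) m⟩
    | swap m n l => exact ⟨.exchange _ _ _⟩
    | trans _ _ h₁ h₂ => exact h₁.elim fun m => h₂.elim fun m' => ⟨.comp m m'⟩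
  obtain ⟨m⟩ := Mor.nonempty_toList a
  obtain ⟨m'⟩ := Mor.nonempty_toList b
  obtain ⟨m''⟩ := key h
  exact ⟨.comp m (.comp m'' (.symm m'))⟩

variable {C : Type u} [Category.{v} C] [MonoidalCategory C]

/-- A box of a string diagram, with named input and output wires. -/
structure Box (w : ℕ → C) where
  dom : Ob
  cod : Ob
  hom : dom.eval w ⟶ cod.eval w

variable [SymmetricCategory C]

/-- `Run w L a b f` states that `f` is obtained by applying the boxes of `L` one after the other,
up to structural isomorphisms. -/
inductive Run (w : ℕ → C) : List (Box w) → ∀ a b : Ob, (a.eval w ⟶ b.eval w) → Prop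
  | nil {a b : Ob} (m : Mor a b) : Run w [] a b (m.eval w).hom
  | cons {a b r : Ob} {x : Box w} {L : List (Box w)} (m : Mor a (.tensor x.dom r))
      {f : (Ob.tensor x.cod r).eval w ⟶ b.eval w} (h : Run w L (.tensor x.cod r) b f) :
      Run w (x :: L) a b ((m.eval w).hom ≫ (x.hom ▷ r.eval w) ≫ f)

namespace Run

variable {w : ℕ → C} {a b c : Ob} {L L' : List (Box w)}

theorem pre (m : Mor a b) {f : b.eval w ⟶ c.eval w} (h : Run w L b c f) :
    Run w L a c ((m.eval w).hom ≫ f) := by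
  cases h with
  | nil m' => exact .nil (.comp m m')
  | cons m' h =>
    rw [← Category.assoc]
    exact .cons (.comp m m') h

theorem of_eq {f g : a.eval w ⟶ b.eval w} (h : f = g) (hf : Run w L a b f) : Run w L a b g :=
  h ▸ hf

theorem comp {f : a.eval w ⟶ b.eval w} {g : b.eval w ⟶ c.eval w} (hf : Run w L a b f)
    (hg : Run w L' b c g) : Run w (L ++ L') a c (f ≫ g) := by
  induction hf with
  | nil m => exact hg.pre m
  | cons m _ ih =>
    have key {A X Y B D : C} (m : A ⟶ X) (x : X ⟶ Y) (f : Y ⟶ B) (g : B ⟶ D) :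
        m ≫ x ≫ f ≫ g = (m ≫ x ≫ f) ≫ g := by simp
    exact of_eq (key _ _ _ _) (.cons m (ih hg))

theorem whiskerRight {f : a.eval w ⟶ b.eval w} (hf : Run w L a b f) (c : Ob) :
    Run w L (.tensor a c) (.tensor b c) (f ▷ c.eval w) := by
  induction hf with
  | nil m =>
    have key {A B : C} (m : A ≅ B) (D : C) : (m ⊗ᵢ Iso.refl D).hom = m.hom ▷ D := by simp
    exact of_eq (key _ _) (.nil (.tensor m (.id c)))
  | @cons a b r x L m f h ih =>
    have key {A X Y R B : C} (m : A ⟶ X ⊗ R) (x : X ⟶ Y) (f : Y ⊗ R ⟶ B) (D : C) :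
        ((m ⊗ₘ 𝟙 D) ≫ (α_ _ _ _).hom) ≫ x ▷ (R ⊗ D) ≫ (α_ _ _ _).inv ≫ f ▷ D =
          (m ≫ x ▷ R ≫ f) ▷ D := by
      simp
    exact of_eq (key _ _ _ _)
      (.cons (.comp (.tensor m (.id c)) (.assoc _ _ _)) (ih.pre (.symm (.assoc _ _ _))))

theorem braid (f : a.eval w ⟶ b.eval w) (c : Ob) : c.eval w ◁ f =
    ((Mor.braid c a).eval w).hom ≫ (f ▷ c.eval w) ≫ ((Mor.braid b c).eval w).hom := by
  have key {A B D : C} (f : A ⟶ B) : D ◁ f = (β_ D A).hom ≫ f ▷ D ≫ (β_ B D).hom := by simp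
  exact key f

theorem whiskerLeft {f : a.eval w ⟶ b.eval w} (hf : Run w L a b f) (c : Ob) :
    Run w L (.tensor c a) (.tensor c b) (c.eval w ◁ f) := by
  rw [braid]
  have := ((hf.whiskerRight c).comp (.nil (.braid b c))).pre (.braid c a)
  rwa [List.append_nil] at this

theorem box (x : Box w) : Run w [x] x.dom x.cod x.hom := by
  have key {X Y : C} (f : X ⟶ Y) : f = (ρ_ X).inv ≫ f ▷ 𝟙_ C ≫ (ρ_ Y).hom := by simp
  rw [key x.hom]
  exact .cons (.symm (.rightUnit x.dom)) (.nil (.rightUnit x.cod))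

/-- A box replaces its input wires by output wires with new names, so the condition that every name
is introduced only once passes to the rest of the diagram. -/
theorem nodup_tail {x : Box w} {r : Ob} (m : Mor a (.tensor x.dom r))
    (h : (a.wires ++ (x :: L).flatMap (fun x => x.cod.wires)).Nodup) :
    ((Ob.tensor x.cod r).wires ++ L.flatMap (fun x => x.cod.wires)).Nodup := by
  have hp : (a.wires ++ (x :: L).flatMap (fun x => x.cod.wires)).Perm
      (x.dom.wires ++ ((Ob.tensor x.cod r).wires ++ L.flatMap (fun x => x.cod.wires))) := by
    have h1 := m.wires_perm.append_right ((x :: L).flatMap (fun x => x.cod.wires))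
    refine h1.trans ?_
    simp only [Ob.wires, List.flatMap_cons, List.append_assoc]
    refine List.Perm.append_left _ ?_
    simp only [← List.append_assoc]
    exact List.perm_append_comm.append_right _
  exact (List.nodup_append.1 (hp.nodup_iff.1 h)).2.1

/-- A diagram in which no wire is repeated is determined by its list of boxes. -/
theorem unique {f g : a.eval w ⟶ b.eval w} (hf : Run w L a b f) (hg : Run w L a b g)
    (h : (a.wires ++ L.flatMap (fun x => x.cod.wires)).Nodup) : f = g := by
  induction hf with
  | nil m =>
    cases hg with
    | nil m' => rw [m.eval_eq (by simpa using h) w m']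
  | @cons a b r x L m f hf ih =>
    cases hg with
    | @cons _ _ r' _ _ m' g hg =>
      -- Both diagrams leave the same wires untouched by `x`, up to an order corrected by `t`.
      -- Coherence compares the two ways of reaching `x`, and `t` slides past `x` into the rest.
      have hr : (x.dom.wires ++ r.wires).Perm (x.dom.wires ++ r'.wires) :=
        m.wires_perm.symm.trans m'.wires_perm
      obtain ⟨t⟩ := Mor.nonempty_of_perm ((List.perm_append_left_iff _).1 hr)
      have ha : a.wires.Nodup := (List.nodup_append.1 h).1
      have e₁ : (m'.eval w).hom = (m.eval w).hom ≫ ((Mor.tensor (.id _) t).eval w).hom :=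
        congrArg Iso.hom (Mor.eval_eq ha w m' (.comp m (.tensor (.id _) t)))
      have e₂ : f = ((Mor.tensor (.id _) t).eval w).hom ≫ g := by
        exact ih (hg.pre _) (nodup_tail m h)
      rw [e₁, e₂]
      have key {A X Y R R' B : C} (m : A ⟶ X ⊗ R) (x : X ⟶ Y) (t : R ⟶ R') (g : Y ⊗ R' ⟶ B) :
          m ≫ x ▷ R ≫ (𝟙 Y ⊗ₘ t) ≫ g = (m ≫ (𝟙 X ⊗ₘ t)) ≫ x ▷ R' ≫ g := by
        simp [whisker_exchange_assoc]
      exact key _ _ _ _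

/-- Boxes that are not connected may be applied in any order. -/
theorem swap {x y : Box w} {f : a.eval w ⟶ b.eval w} (hf : Run w (x :: y :: L) a b f)
    (h : ∀ n ∈ y.dom.wires, n ∉ x.cod.wires)
    (hn : (a.wires ++ (x :: y :: L).flatMap (fun x => x.cod.wires)).Nodup) :
    Run w (y :: x :: L) a b f := by
  have hnd : x.cod.wires.Nodup := by
    have := (List.nodup_append.1 hn).2.1
    simp only [List.flatMap_cons] at this
    exact (List.nodup_append.1 this).1
  obtain ⟨s, m, g, hg, rfl⟩ : ∃ (s : Ob) (m : Mor a (.tensor x.dom (.tensor y.dom s)))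
      (g : (Ob.tensor y.cod (.tensor x.cod s)).eval w ⟶ b.eval w)
      (_ : Run w L (.tensor y.cod (.tensor x.cod s)) b g),
      f = (m.eval w).hom ≫ (x.hom ▷ (Ob.tensor y.dom s).eval w) ≫
        ((Mor.exchange x.cod y.dom s).eval w).hom ≫ (y.hom ▷ (Ob.tensor x.cod s).eval w) ≫ g := by
    cases hf with
    | @cons _ _ r _ _ m f hf =>
      cases hf with
      | @cons _ _ r' _ _ m' f hf =>
        have h1 : (x.cod.wires ++ r.wires).Perm (y.dom.wires ++ r'.wires) := m'.wires_perm
        -- Since `y` takes no output of `x`, these outputs all lie among the wires that `y` leaves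
        -- alone; the list `l` found below consists of the remaining ones.
        have h2 : x.cod.wires ⊆ r'.wires := fun n hn =>
          (List.mem_append.1 (h1.subset (List.mem_append_left _ hn))).resolve_left
            (fun h' => h n h' hn)
        obtain ⟨l', hl', hl⟩ := List.subperm_of_subset hnd h2
        obtain ⟨l, hl⟩ := hl.exists_perm_append
        replace hl := hl.trans (hl'.append_right l)
        have hs := Ob.wires_ofList l
        have h3 : r.wires.Perm (y.dom.wires ++ l) := by
          refine (List.perm_append_left_iff x.cod.wires).1 (h1.trans ((hl.append_left _).trans ?_))
          simp only [← List.append_assoc]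
          exact List.perm_append_comm.append_right _
        obtain ⟨t⟩ : Nonempty (Mor r (.tensor y.dom (.ofList l))) :=
          Mor.nonempty_of_perm (by rw [Ob.wires, hs]; exact h3)
        obtain ⟨t'⟩ : Nonempty (Mor (.tensor x.cod (.ofList l)) r') :=
          Mor.nonempty_of_perm (by rw [Ob.wires, hs]; exact hl.symm)
        refine ⟨.ofList l, .comp m (.tensor (.id _) t), _, hf.pre (.tensor (.id _) t'), ?_⟩
        -- The diagram in which the inputs of both boxes are exposed at once has the same boxes,
        -- hence equals the given one.
        exact unique (.cons m (.cons m' hf))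
          (.cons _ (.cons (Mor.exchange x.cod y.dom (.ofList l)) (hf.pre (.tensor (.id _) t')))) hn
  have key {A X X' Y Y' S B : C} (m : A ⟶ X ⊗ (Y ⊗ S)) (x : X ⟶ X') (y : Y ⟶ Y')
      (g : Y' ⊗ (X' ⊗ S) ⟶ B) :
      m ≫ x ▷ (Y ⊗ S) ≫ (((α_ X' Y S).symm ≪≫ (β_ X' Y ⊗ᵢ Iso.refl S)) ≪≫ α_ Y X' S).hom ≫
        y ▷ (X' ⊗ S) ≫ g =
      (m ≫ (((α_ X Y S).symm ≪≫ (β_ X Y ⊗ᵢ Iso.refl S)) ≪≫ α_ Y X S).hom) ≫ y ▷ (X ⊗ S) ≫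
        (((α_ Y' X S).symm ≪≫ (β_ Y' X ⊗ᵢ Iso.refl S)) ≪≫ α_ X Y' S).hom ≫ x ▷ (Y' ⊗ S) ≫
        (((α_ X' Y' S).symm ≪≫ (β_ X' Y' ⊗ᵢ Iso.refl S)) ≪≫ α_ Y' X' S).hom ≫ g := by
    -- Both orders of the boxes are reduced to the parallel box `y ⊗ₘ x`.
    have h₁ : x ▷ (Y ⊗ S) ≫ (α_ X' Y S).inv ≫ (β_ X' Y).hom ▷ S ≫ (α_ Y X' S).hom ≫ y ▷ (X' ⊗ S) =
        (α_ X Y S).inv ≫ (β_ X Y).hom ▷ S ≫ (y ⊗ₘ x) ▷ S ≫ (α_ Y' X' S).hom := by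
      have hb : x ▷ Y ≫ (β_ X' Y).hom ≫ y ▷ X' = (β_ X Y).hom ≫ (y ⊗ₘ x) := by
        simp [MonoidalCategory.tensorHom_def']
      have hb' := congrArg (· ▷ S) hb
      simp only [comp_whiskerRight] at hb'
      simp only [whiskerRight_tensor, Category.assoc, Iso.hom_inv_id_assoc]
      rw [reassoc_of% hb']
    have h₂ : y ▷ (X ⊗ S) ≫ (α_ Y' X S).inv ≫ (β_ Y' X).hom ▷ S ≫ (α_ X Y' S).hom ≫
        x ▷ (Y' ⊗ S) ≫ (α_ X' Y' S).inv ≫ (β_ X' Y').hom ▷ S =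
        (α_ Y X S).inv ≫ (y ⊗ₘ x) ▷ S := by
      have hb : y ▷ X ≫ (β_ Y' X).hom ≫ x ▷ Y' ≫ (β_ X' Y').hom = y ⊗ₘ x := by
        simp [MonoidalCategory.tensorHom_def]
      have hb' := congrArg (· ▷ S) hb
      simp only [comp_whiskerRight] at hb'
      simp only [whiskerRight_tensor, Category.assoc, Iso.hom_inv_id_assoc]
      rw [hb']
    simp only [Iso.trans_hom, Iso.symm_hom, tensorIso_hom, Iso.refl_hom, tensorHom_id,
      Category.assoc, reassoc_of% h₁, reassoc_of% h₂, Iso.hom_inv_id_assoc]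
  exact of_eq (key _ _ _ _).symm <| .cons (.comp m (Mor.exchange x.dom y.dom s))
    (.cons (Mor.exchange y.cod x.dom s) (hg.pre (Mor.exchange x.cod y.cod s)))

/-- Exchange the boxes at positions `n` and `n + 1`. -/
def swapAt {α : Type*} : ℕ → List α → List α
  | 0, x :: y :: L => y :: x :: L
  | n + 1, x :: L => x :: swapAt n L
  | _, L => L

/-- The box at position `n + 1` takes no input from the box at position `n`. -/
def swappable : ℕ → List (Box w) → Bool
  | 0, x :: y :: _ => decide (∀ n ∈ y.dom.wires, n ∉ x.cod.wires)
  | n + 1, _ :: L => swappable n L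
  | _, _ => true

theorem swapAt_perm (n : ℕ) (L : List (Box w)) : (swapAt n L).Perm L := by
  induction n, L using swapAt.induct with
  | case1 x y L => exact .swap x y L
  | case2 n x L ih => exact ih.cons x
  | case3 n L h₁ h₂ => rw [swapAt] <;> tauto

theorem swap_at (n : ℕ) {f : a.eval w ⟶ b.eval w} (hf : Run w L a b f) (h : swappable n L = true)
    (hn : (a.wires ++ L.flatMap (fun x => x.cod.wires)).Nodup) : Run w (swapAt n L) a b f := by
  induction n generalizing a L with
  | zero =>
    match L, hf with
    | [], hf => exact hf
    | [x], hf => exact hf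
    | x :: y :: L, hf => exact hf.swap (of_decide_eq_true h) hn
  | succ n ih =>
    cases hf with
    | nil m => exact .nil m
    | cons m hf => exact .cons m (ih hf h (nodup_tail m hn))

/-- Perform a list of exchanges. -/
def swapList {α : Type*} : List ℕ → List α → List α
  | [], L => L
  | n :: ns, L => swapList ns (swapAt n L)

/-- All exchanges in a list are between disconnected boxes. -/
def swappableList : List ℕ → List (Box w) → Bool
  | [], _ => true
  | n :: ns, L => swappable n L && swappableList ns (swapAt n L)

theorem swapList_perm (ns : List ℕ) (L : List (Box w)) : (swapList ns L).Perm L := by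
  induction ns generalizing L with
  | nil => exact .refl _
  | cons n ns ih => exact (ih _).trans (swapAt_perm n L)

theorem swap_list (ns : List ℕ) {f : a.eval w ⟶ b.eval w} (hf : Run w L a b f)
    (h : swappableList ns L = true)
    (hn : (a.wires ++ L.flatMap (fun x => x.cod.wires)).Nodup) : Run w (swapList ns L) a b f := by
  induction ns generalizing L with
  | nil => exact hf
  | cons n ns ih =>
    obtain ⟨h₁, h₂⟩ := Bool.and_eq_true_iff.1 h
    exact ih (hf.swap_at n h₁ hn) h₂
      ((((swapAt_perm n L).flatMap_right _).append_left _).nodup_iff.2 hn)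

end Run

/-! ### Reification of string diagrams -/

/-- The assignment of objects to wires given by a list. -/
def wireOf (l : List C) (n : ℕ) : C := l.getD n (𝟙_ C)

/-- The code `a` denotes the object `X`. -/
class Denotes (l : List C) (a : Ob) (X : C) : Prop where
  eq : X = a.eval (wireOf l)

namespace Denotes

variable {l : List C}

instance one : Denotes l .one (𝟙_ C) := ⟨rfl⟩

instance tensor {a b : Ob} {X Y : C} [hX : Denotes l a X] [hY : Denotes l b Y] :
    Denotes l (.tensor a b) (X ⊗ Y) := ⟨congrArg₂ _ hX.eq hY.eq⟩

instance zero {X : C} : Denotes (X :: l) (.var 0) X := ⟨rfl⟩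

instance succ {X Y : C} {n : ℕ} [h : Denotes l (.var n) X] : Denotes (Y :: l) (.var (n + 1)) X :=
  ⟨h.eq⟩

end Denotes

/-- `f` is the string diagram with input wires `a`, boxes `L` and output wires `b`. -/
class Diagram (l : List C) (a : Ob) (L : outParam (List (Box (wireOf l)))) (b : outParam Ob)
    {X Y : C} (f : X ⟶ Y) : Prop where
  dom_eq : X = a.eval (wireOf l)
  cod_eq : Y = b.eval (wireOf l)
  run : Run (wireOf l) L a b (eqToHom dom_eq.symm ≫ f ≫ eqToHom cod_eq)

namespace Diagram

variable {l : List C} {L L' : List (Box (wireOf l))} {a b c a' b' : Ob} {X Y Z W : C}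

instance id [h : Denotes l a X] : Diagram l a [] a (𝟙 X) where
  dom_eq := h.eq
  cod_eq := h.eq
  run := .of_eq (by simp [Mor.eval]) (.nil (.id a))

/-- The output code of `f` is an output parameter and serves as input code of `g`, so instance
search reads a composite from left to right and collects its boxes. -/
instance comp {f : X ⟶ Y} {g : Y ⟶ Z} [hf : Diagram l a L b f] [hg : Diagram l b L' c g] :
    Diagram l a (L ++ L') c (f ≫ g) where
  dom_eq := hf.dom_eq
  cod_eq := hg.cod_eq
  run := .of_eq (by simp) (hf.run.comp hg.run)

theorem of_eval {f : a.eval (wireOf l) ⟶ b.eval (wireOf l)} (h : Run _ L a b f) :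
    Diagram l a L b f := ⟨rfl, rfl, .of_eq (by simp) h⟩

/-- Replacing `X` and `Y` by evaluated codes turns the transports along object equalities into
identities. -/
theorem exists_eval {f : X ⟶ Y} (h : Diagram l a L b f)
    {P : ∀ {X Y : C}, (X ⟶ Y) → Prop}
    (hP : ∀ f : a.eval (wireOf l) ⟶ b.eval (wireOf l), Run _ L a b f → P f) : P f := by
  obtain ⟨rfl, rfl, h⟩ := h
  exact hP f (.of_eq (by simp) h)

instance whiskerRight {f : X ⟶ Y} [hf : Diagram l a L b f] [hZ : Denotes l c Z] :
    Diagram l (.tensor a c) L (.tensor b c) (f ▷ Z) := by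
  obtain ⟨rfl⟩ := hZ
  exact hf.exists_eval (P := fun f => Diagram l (.tensor a c) L (.tensor b c) (f ▷ _))
    fun f h => of_eval (h.whiskerRight c)

instance whiskerLeft {f : X ⟶ Y} [hf : Diagram l a L b f] [hZ : Denotes l c Z] :
    Diagram l (.tensor c a) L (.tensor c b) (Z ◁ f) := by
  obtain ⟨rfl⟩ := hZ
  exact hf.exists_eval (P := fun f => Diagram l (.tensor c a) L (.tensor c b) (_ ◁ f))
    fun f h => of_eval (h.whiskerLeft c)

instance tensor {f : X ⟶ Y} {g : Z ⟶ W} [hf : Diagram l a L b f] [hg : Diagram l a' L' b' g] :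
    Diagram l (.tensor a a') (L ++ L') (.tensor b b') (f ⊗ₘ g) := by
  have := Denotes.mk hf.cod_eq
  have := Denotes.mk hg.dom_eq
  rw [MonoidalCategory.tensorHom_def]
  infer_instance

theorem structural (m : Mor a b) : Diagram l a [] b (m.eval (wireOf l)).hom := of_eval (.nil m)

section

variable [hX : Denotes l a X] [hY : Denotes l b Y] [hZ : Denotes l c Z]

instance assoc_hom :
    Diagram l (.tensor (.tensor a b) c) [] (.tensor a (.tensor b c)) (α_ X Y Z).hom := by
  obtain ⟨rfl⟩ := hX; obtain ⟨rfl⟩ := hY; obtain ⟨rfl⟩ := hZ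
  exact structural (.assoc a b c)

instance assoc_inv :
    Diagram l (.tensor a (.tensor b c)) [] (.tensor (.tensor a b) c) (α_ X Y Z).inv := by
  obtain ⟨rfl⟩ := hX; obtain ⟨rfl⟩ := hY; obtain ⟨rfl⟩ := hZ
  exact structural (.symm (.assoc a b c))

instance leftUnit_hom : Diagram l (.tensor .one a) [] a (λ_ X).hom := by
  obtain ⟨rfl⟩ := hX
  exact structural (.leftUnit a)

instance leftUnit_inv : Diagram l a [] (.tensor .one a) (λ_ X).inv := by
  obtain ⟨rfl⟩ := hX
  exact structural (.symm (.leftUnit a))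

instance rightUnit_hom : Diagram l (.tensor a .one) [] a (ρ_ X).hom := by
  obtain ⟨rfl⟩ := hX
  exact structural (.rightUnit a)

instance rightUnit_inv : Diagram l a [] (.tensor a .one) (ρ_ X).inv := by
  obtain ⟨rfl⟩ := hX
  exact structural (.symm (.rightUnit a))

instance braid_hom : Diagram l (.tensor a b) [] (.tensor b a) (β_ X Y).hom := by
  obtain ⟨rfl⟩ := hX; obtain ⟨rfl⟩ := hY
  exact structural (.braid a b)

instance braid_inv : Diagram l (.tensor b a) [] (.tensor a b) (β_ X Y).inv := by
  obtain ⟨rfl⟩ := hX; obtain ⟨rfl⟩ := hY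
  exact structural (.symm (.braid a b))

end

section

variable [MonoidalCoherence X Y]

/-- The structural isomorphism inside `⊗≫` is itself found by instance search; this instance and the
following ones read it off along the instances of `MonoidalCoherence`. -/
instance monoidalComp {f : W ⟶ X} {g : Y ⟶ Z} {d : Ob} {L'' : List (Box (wireOf l))}
    [Diagram l a L b f] [Diagram l b L' c (⊗𝟙 : X ≅ Y).hom] [Diagram l c L'' d g] :
    Diagram l a (L ++ (L' ++ L'')) d (f ⊗≫ g) :=
  inferInstanceAs (Diagram l a _ d (f ≫ (⊗𝟙 : X ≅ Y).hom ≫ g))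

instance coherence_refl [Denotes l a X] :
    Diagram l a [] a (MonoidalCoherence.iso (self := .refl X)).hom :=
  inferInstanceAs (Diagram l a [] a (𝟙 X))

instance coherence_whiskerLeft [Denotes l c Z] [Diagram l a L b (⊗𝟙 : X ≅ Y).hom] :
    Diagram l (.tensor c a) L (.tensor c b)
      (MonoidalCoherence.iso (self := .whiskerLeft Z X Y)).hom :=
  inferInstanceAs (Diagram l _ L _ (Z ◁ (⊗𝟙 : X ≅ Y).hom))

instance coherence_whiskerRight [Denotes l c Z] [Diagram l a L b (⊗𝟙 : X ≅ Y).hom] :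
    Diagram l (.tensor a c) L (.tensor b c)
      (MonoidalCoherence.iso (self := .whiskerRight X Y Z)).hom :=
  inferInstanceAs (Diagram l _ L _ ((⊗𝟙 : X ≅ Y).hom ▷ Z))

end

instance coherence_assoc [MonoidalCoherence (X ⊗ (Y ⊗ Z)) W] {d : Ob} [Denotes l a X]
    [Denotes l b Y] [Denotes l c Z]
    [Diagram l (.tensor a (.tensor b c)) L d (⊗𝟙 : X ⊗ (Y ⊗ Z) ≅ W).hom] :
    Diagram l (.tensor (.tensor a b) c) ([] ++ L) d
      (MonoidalCoherence.iso (self := .assoc X Y Z W)).hom :=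
  inferInstanceAs (Diagram l _ _ _ ((α_ X Y Z).hom ≫ (⊗𝟙 : X ⊗ (Y ⊗ Z) ≅ W).hom))

instance coherence_assoc' [MonoidalCoherence W (X ⊗ (Y ⊗ Z))] {d : Ob} [Denotes l a X]
    [Denotes l b Y] [Denotes l c Z]
    [Diagram l d L (.tensor a (.tensor b c)) (⊗𝟙 : W ≅ X ⊗ (Y ⊗ Z)).hom] :
    Diagram l d (L ++ []) (.tensor (.tensor a b) c)
      (MonoidalCoherence.iso (self := .assoc' W X Y Z)).hom :=
  inferInstanceAs (Diagram l _ _ _ ((⊗𝟙 : W ≅ X ⊗ (Y ⊗ Z)).hom ≫ (α_ X Y Z).inv))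

/-- The diagram consisting of a single box. -/
theorem box (l : List C) (a b : Ob) {X Y : C} (f : X ⟶ Y) [hX : Denotes l a X]
    [hY : Denotes l b Y] :
    Diagram l a [⟨a, b, eqToHom hX.eq.symm ≫ f ≫ eqToHom hY.eq⟩] b f :=
  ⟨hX.eq, hY.eq, Run.box ⟨a, b, eqToHom hX.eq.symm ≫ f ≫ eqToHom hY.eq⟩⟩

/-- Two string diagrams with the same boxes are equal. -/
theorem eq (l : List C) (a : Ob) {L L' : List (Box (wireOf l))} {b b' : Ob} {X Y : C} {f g : X ⟶ Y}
    [hf : Diagram l a L b f] [hg : Diagram l a L' b' g] (hL : L' = L := by rfl) (hb : b' = b := by rfl)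
    (h : decide (a.wires ++ L.flatMap (fun x => x.cod.wires)).Nodup = true := by rfl) : f = g := by
  subst hL hb
  have e := hf.run.unique hg.run (of_decide_eq_true h)
  exact (cancel_mono _).1 ((cancel_epi _).1 e)

/-- Two string diagrams that differ by the order of disconnected boxes are equal. -/
theorem eq_swap (l : List C) (a : Ob) (ns : List ℕ) {L L' : List (Box (wireOf l))}
    {b b' : Ob} {X Y : C} {f g : X ⟶ Y}
    [hf : Diagram l a L b f] [hg : Diagram l a L' b' g] (hL : L' = Run.swapList ns L := by rfl)
    (hb : b' = b := by rfl) (hs : Run.swappableList ns L = true := by rfl)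
    (h : decide (a.wires ++ L.flatMap (fun x => x.cod.wires)).Nodup = true := by rfl) : f = g := by
  subst hL hb
  replace h := of_decide_eq_true h
  have e := (hf.run.swap_list ns hs h).unique hg.run
    ((((Run.swapList_perm ns L).flatMap_right _).append_left _).nodup_iff.2 h)
  exact (cancel_mono _).1 ((cancel_epi _).1 e)

end Diagram

end SymmetricCoherence

infixr:70 "⊠" => SymmetricCoherence.Ob.tensor
prefix:max "♯" => SymmetricCoherence.Ob.var

open SymmetricCoherence

section

/-! ### Formal traces -/

variable {C : Type u} [Category.{v} C] [MonoidalCategory C]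

/-- A morphism `A ⊗ U ⟶ B ⊗ U`, regarded as a formal trace `A ⟶ B`. -/
structure FormalTrace (A B : C) where
  obj : C
  hom : A ⊗ obj ⟶ B ⊗ obj

namespace FormalTrace

/-- The composite of a formal trace with a context. -/
def ctx {A B A' B' Z X : C} (k : A' ⊗ Z ⟶ X ⊗ A) (l : X ⊗ B ⟶ B' ⊗ Z) (F : FormalTrace A B) :
    FormalTrace A' B' :=
  ⟨Z ⊗ F.obj, (α_ _ _ _).inv ≫ (k ▷ F.obj ≫ (α_ _ _ _).hom ≫ X ◁ F.hom ≫ (α_ _ _ _).inv ≫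
    l ▷ F.obj) ≫ (α_ _ _ _).hom⟩

variable [SymmetricCategory C] [PartialTrace C]

open PartialTrace

/-- The partial value of a formal trace. -/
def trace {A B : C} (F : FormalTrace A B) : Part (A ⟶ B) := tr F.obj F.hom

/-- Two formal traces are equivalent if they have the same value in every context. -/
def Equiv {A B : C} (F G : FormalTrace A B) : Prop :=
  ∀ ⦃A' B' Z X : C⦄ (k : A' ⊗ Z ⟶ X ⊗ A) (l : X ⊗ B ⟶ B' ⊗ Z),
    (F.ctx k l).trace = (G.ctx k l).trace

variable {A B : C}

theorem Equiv.refl (F : FormalTrace A B) : F.Equiv F := fun _ _ _ _ _ _ => rfl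

theorem Equiv.symm {F G : FormalTrace A B} (h : F.Equiv G) : G.Equiv F :=
  fun _ _ _ _ k l => (h k l).symm

theorem Equiv.trans {F G H : FormalTrace A B} (h : F.Equiv G) (h' : G.Equiv H) : F.Equiv H :=
  fun _ _ _ _ k l => (h k l).trans (h' k l)

/-- Dinaturality along an isomorphism: order and bracketing of the traced wires do not affect the
partial value. -/
theorem trace_conj {F G : FormalTrace A B} (φ : F.obj ≅ G.obj)
    (h : F.hom ≫ B ◁ φ.hom = A ◁ φ.hom ≫ G.hom) : F.trace = G.trace := by
  have h' : G.hom = (A ◁ φ.inv ≫ F.hom) ≫ B ◁ φ.hom := by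
    rw [Category.assoc, h, whiskerLeft_inv_hom_assoc]
  rw [trace, trace, h', dinaturality, whiskerLeft_hom_inv_assoc]

theorem Equiv.of_conj {F G : FormalTrace A B} (φ : F.obj ≅ G.obj)
    (h : F.hom ≫ B ◁ φ.hom = A ◁ φ.hom ≫ G.hom) : F.Equiv G := by
  intro A' B' Z X k l
  refine trace_conj (whiskerLeftIso Z φ) ?_
  change _ ≫ B' ◁ Z ◁ φ.hom = A' ◁ Z ◁ φ.hom ≫ _
  dsimp only [ctx]
  trans (α_ _ _ _).inv ≫ k ▷ F.obj ≫ (α_ _ _ _).hom ≫ X ◁ (F.hom ≫ B ◁ φ.hom) ≫ (α_ _ _ _).inv ≫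
    l ▷ G.obj ≫ (α_ _ _ _).hom
  -- Every stretch of wire between boxes gets its own number, so `F.obj` and `Z` occur twice, at the
  -- start and at the end of the diagram's traced wires.
  · let w : List C := [A', Z, F.obj, X, A, B, F.obj, B', Z, G.obj]
    have := Diagram.box w (♯0 ⊠ ♯1) (♯3 ⊠ ♯4) k
    have := Diagram.box w (♯4 ⊠ ♯2) (♯5 ⊠ ♯6) F.hom
    have := Diagram.box w (♯3 ⊠ ♯5) (♯7 ⊠ ♯8) l
    have := Diagram.box w (♯6) (♯9) φ.hom
    -- The list gives the positions, counted from 0, at which adjacent boxes are exchanged: here `l`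
    -- and `φ.hom`.
    exact Diagram.eq_swap w (♯0 ⊠ ♯1 ⊠ ♯2) [2]
  · rw [h]
    let w : List C := [A', Z, F.obj, X, A, B, G.obj, B', Z, G.obj]
    have := Diagram.box w (♯0 ⊠ ♯1) (♯3 ⊠ ♯4) k
    have := Diagram.box w (♯4 ⊠ ♯9) (♯5 ⊠ ♯6) G.hom
    have := Diagram.box w (♯3 ⊠ ♯5) (♯7 ⊠ ♯8) l
    have := Diagram.box w (♯2) (♯9) φ.hom
    exact Diagram.eq_swap w (♯0 ⊠ ♯1 ⊠ ♯2) [0]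

theorem mem_tr_comp {A' B' U : C} {f : A ⊗ U ⟶ B ⊗ U} {t : A ⟶ B} (h : t ∈ tr U f) (g : A' ⟶ A)
    (k : B ⟶ B') : g ≫ t ≫ k ∈ tr U (g ▷ U ≫ f ≫ k ▷ U) :=
  PartialTrace.naturality f g k _ (Part.mem_map _ h)

theorem mem_tr_whiskerLeft {U : C} {f : A ⊗ U ⟶ B ⊗ U} {t : A ⟶ B} (h : t ∈ tr U f) (X : C) :
    X ◁ t ∈ tr U ((α_ X A U).hom ≫ X ◁ f ≫ (α_ X B U).inv) := by
  have := strength f (𝟙 X) _ (Part.mem_map _ h)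
  simpa only [id_tensorHom] using this

/-- Strength and naturality are only directed, but their left sides are defined because `t` exists.
So the inner trace is defined, which is exactly the hypothesis of vanishing II. -/
theorem trace_ctx {F : FormalTrace A B} {t : A ⟶ B} (h : t ∈ F.trace) {A' B' Z X : C}
    (k : A' ⊗ Z ⟶ X ⊗ A) (l : X ⊗ B ⟶ B' ⊗ Z) :
    (F.ctx k l).trace = tr Z (k ≫ X ◁ t ≫ l) := by
  have h₁ := mem_tr_comp (mem_tr_whiskerLeft h X) k l
  simp only [Category.assoc] at h₁
  rw [trace, ctx, ← vanishing_tensor _ (Part.dom_iff_mem.2 ⟨_, h₁⟩), Part.eq_some_iff.2 h₁,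
    Part.bind_some]

/-- This is what identifies a path with its composite: a defined value determines the behaviour in
all contexts. -/
theorem Equiv.of_mem {F G : FormalTrace A B} {t : A ⟶ B} (hF : t ∈ F.trace) (hG : t ∈ G.trace) :
    F.Equiv G := fun _ _ _ _ k l => by rw [trace_ctx hF, trace_ctx hG]

/-- Nested contexts merge into one; only the bracketing of the traced wires changes. -/
theorem ctx_ctx {A' B' Z X A'' B'' Z' X' : C} (k : A' ⊗ Z ⟶ X ⊗ A) (l : X ⊗ B ⟶ B' ⊗ Z)
    (k' : A'' ⊗ Z' ⟶ X' ⊗ A') (l' : X' ⊗ B' ⟶ B'' ⊗ Z') (F : FormalTrace A B) :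
    ((F.ctx k l).ctx k' l').Equiv
      (F.ctx (Z := Z' ⊗ Z) (X := X' ⊗ X)
        ((α_ _ _ _).inv ≫ k' ▷ Z ≫ (α_ _ _ _).hom ≫ X' ◁ k ≫ (α_ _ _ _).inv)
        ((α_ _ _ _).hom ≫ X' ◁ l ≫ (α_ _ _ _).inv ≫ l' ▷ Z ≫ (α_ _ _ _).hom)) := by
  refine .of_conj (α_ Z' Z F.obj).symm ?_
  dsimp only [ctx, Iso.symm_hom]
  let w : List C := [A'', Z', Z, F.obj, X', A', X, A, B, F.obj, B', Z, B'', Z']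
  have := Diagram.box w (♯0 ⊠ ♯1) (♯4 ⊠ ♯5) k'
  have := Diagram.box w (♯5 ⊠ ♯2) (♯6 ⊠ ♯7) k
  have := Diagram.box w (♯7 ⊠ ♯3) (♯8 ⊠ ♯9) F.hom
  have := Diagram.box w (♯6 ⊠ ♯8) (♯10 ⊠ ♯11) l
  have := Diagram.box w (♯4 ⊠ ♯10) (♯12 ⊠ ♯13) l'
  exact Diagram.eq w (♯0 ⊠ ♯1 ⊠ ♯2 ⊠ ♯3)

theorem trace_ctx_unit (F : FormalTrace A B) :
    (F.ctx ((ρ_ A).hom ≫ (λ_ A).inv) ((λ_ B).hom ≫ (ρ_ B).inv)).trace = F.trace := by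
  refine trace_conj (λ_ F.obj) ?_
  dsimp only [ctx]
  let w : List C := [A, F.obj, B, F.obj]
  have := Diagram.box w (♯0 ⊠ ♯1) (♯2 ⊠ ♯3) F.hom
  exact Diagram.eq w (♯0 ⊠ .one ⊠ ♯1)

/-- The trace itself is recovered from the empty context, where `X` and `Z` are the unit. -/
theorem Equiv.trace_eq {F G : FormalTrace A B} (h : F.Equiv G) : F.trace = G.trace := by
  rw [← trace_ctx_unit F, ← trace_ctx_unit G, h]

theorem Equiv.ctx {F G : FormalTrace A B} (h : F.Equiv G) {A' B' Z X : C}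
    (k : A' ⊗ Z ⟶ X ⊗ A) (l : X ⊗ B ⟶ B' ⊗ Z) : (F.ctx k l).Equiv (G.ctx k l) :=
  fun _ _ _ _ k' l' => by rw [(ctx_ctx k l k' l' F).trace_eq, (ctx_ctx k l k' l' G).trace_eq, h]

/-- The wires of a context matter only up to isomorphism: `φ` changes the traced wire and `ξ` the
wire that bypasses `F`. -/
theorem ctx_equiv_ctx {A' B' Z X Z' X' : C} {k : A' ⊗ Z ⟶ X ⊗ A} {l : X ⊗ B ⟶ B' ⊗ Z}
    {k' : A' ⊗ Z' ⟶ X' ⊗ A} {l' : X' ⊗ B ⟶ B' ⊗ Z'} (φ : Z ≅ Z') (ξ : X ≅ X')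
    (hk : k ≫ ξ.hom ▷ A = A' ◁ φ.hom ≫ k') (hl : l ≫ B' ◁ φ.hom = ξ.hom ▷ B ≫ l')
    (F : FormalTrace A B) : (F.ctx k l).Equiv (F.ctx k' l') := by
  refine .of_conj (whiskerRightIso φ F.obj) ?_
  dsimp only [FormalTrace.ctx, whiskerRightIso_hom]
  trans (α_ _ _ _).inv ≫ (k ▷ F.obj ≫ (α_ _ _ _).hom ≫ X ◁ F.hom ≫ (α_ _ _ _).inv ≫
    (l ≫ B' ◁ φ.hom) ▷ F.obj) ≫ (α_ _ _ _).hom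
  · simp
  trans (α_ _ _ _).inv ≫ ((k ≫ ξ.hom ▷ A) ▷ F.obj ≫ (α_ _ _ _).hom ≫ X' ◁ F.hom ≫
    (α_ _ _ _).inv ≫ l' ▷ F.obj) ≫ (α_ _ _ _).hom
  · rw [hl]
    let w : List C := [A', Z, F.obj, X, A, B, F.obj, X', B', Z']
    have := Diagram.box w (♯0 ⊠ ♯1) (♯3 ⊠ ♯4) k
    have := Diagram.box w (♯4 ⊠ ♯2) (♯5 ⊠ ♯6) F.hom
    have := Diagram.box w (♯3) (♯7) ξ.hom
    have := Diagram.box w (♯7 ⊠ ♯5) (♯8 ⊠ ♯9) l'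
    exact Diagram.eq_swap w (♯0 ⊠ ♯1 ⊠ ♯2) [1]
  · rw [hk]
    simp

/-- The composite of a formal trace with a context that does not share the traced wire. -/
def wrap {A B A' B' X : C} (k : A' ⟶ X ⊗ A) (l : X ⊗ B ⟶ B') (F : FormalTrace A B) :
    FormalTrace A' B' :=
  ⟨F.obj, k ▷ F.obj ≫ (α_ _ _ _).hom ≫ X ◁ F.hom ≫ (α_ _ _ _).inv ≫ l ▷ F.obj⟩

theorem wrap_equiv_ctx {A' B' X : C} (k : A' ⟶ X ⊗ A) (l : X ⊗ B ⟶ B') (F : FormalTrace A B) :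
    (F.wrap k l).Equiv (F.ctx ((ρ_ A').hom ≫ k) (l ≫ (ρ_ B').inv)) := by
  refine .symm (.of_conj (λ_ F.obj) ?_)
  dsimp only [FormalTrace.ctx, wrap]
  let w : List C := [A', F.obj, X, A, B, F.obj, B']
  have := Diagram.box w (♯0) (♯2 ⊠ ♯3) k
  have := Diagram.box w (♯3 ⊠ ♯1) (♯4 ⊠ ♯5) F.hom
  have := Diagram.box w (♯2 ⊠ ♯4) (♯6) l
  exact Diagram.eq w (♯0 ⊠ .one ⊠ ♯1)

theorem Equiv.wrap {F G : FormalTrace A B} (h : F.Equiv G) {A' B' X : C} (k : A' ⟶ X ⊗ A)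
    (l : X ⊗ B ⟶ B') : (F.wrap k l).Equiv (G.wrap k l) :=
  (wrap_equiv_ctx k l F).trans ((h.ctx _ _).trans (wrap_equiv_ctx k l G).symm)

theorem mem_trace_wrap {F : FormalTrace A B} {t : A ⟶ B} (h : t ∈ F.trace) {A' B' X : C}
    (k : A' ⟶ X ⊗ A) (l : X ⊗ B ⟶ B') {s : A' ⟶ B'} (hs : s = k ≫ X ◁ t ≫ l) :
    s ∈ (F.wrap k l).trace := by
  rw [hs]
  have := mem_tr_comp (mem_tr_whiskerLeft h X) k l
  simp only [Category.assoc] at this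
  exact this

/-- Tracing out one of two traced wires. -/
theorem Equiv.of_mem_tr {U V : C} {f : (A ⊗ U) ⊗ V ⟶ (B ⊗ U) ⊗ V} {t : A ⊗ U ⟶ B ⊗ U}
    (h : t ∈ tr V f) :
    Equiv ⟨U ⊗ V, (α_ A U V).inv ≫ f ≫ (α_ B U V).hom⟩ ⟨U, t⟩ := by
  intro A' B' Z X k l
  -- The value `t` replaces the trace over `V` in a context whose shared wires are `Z ⊗ U`.
  have h₁ := trace_ctx (F := ⟨V, f⟩) h ((α_ A' Z U).inv ≫ k ▷ U ≫ (α_ _ _ _).hom)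
    ((α_ _ _ _).inv ≫ l ▷ U ≫ (α_ B' Z U).hom)
  have h₂ : (FormalTrace.ctx k l ⟨U, t⟩).trace = tr (Z ⊗ U)
      (((α_ A' Z U).inv ≫ k ▷ U ≫ (α_ _ _ _).hom) ≫ X ◁ t ≫
        (α_ _ _ _).inv ≫ l ▷ U ≫ (α_ B' Z U).hom) := by
    simp only [trace, FormalTrace.ctx, Category.assoc]
  rw [h₂, ← h₁]
  refine trace_conj (α_ Z U V).symm ?_
  dsimp only [FormalTrace.ctx, Iso.symm_hom]
  let w : List C := [A', Z, U, V, X, A, B, U, V, B', Z]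
  have := Diagram.box w (♯0 ⊠ ♯1) (♯4 ⊠ ♯5) k
  have := Diagram.box w ((♯5 ⊠ ♯2) ⊠ ♯3) ((♯6 ⊠ ♯7) ⊠ ♯8) f
  have := Diagram.box w (♯4 ⊠ ♯6) (♯9 ⊠ ♯10) l
  exact Diagram.eq w (♯0 ⊠ ♯1 ⊠ ♯2 ⊠ ♯3)

/-- Generalized yanking. -/
theorem mem_tr_yank {X U : C} (g : A ⟶ X ⊗ U) (h : X ⊗ U ⟶ B) :
    g ≫ h ∈ tr U (g ▷ U ≫ ((α_ X U U).hom ≫ X ◁ (β_ U U).hom ≫ (α_ X U U).inv) ≫ h ▷ U) := by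
  have h₁ : 𝟙 U ∈ tr U (β_ U U).hom := by rw [yanking]; exact Part.mem_some _
  have h₂ := mem_tr_comp (mem_tr_whiskerLeft h₁ X) g h
  simpa using h₂

theorem mem_tr_of_yank {X U : C} {f : A ⊗ U ⟶ B ⊗ U} {t : A ⟶ B} (g : A ⟶ X ⊗ U) (h : X ⊗ U ⟶ B)
    (ht : t = g ≫ h)
    (hf : f = g ▷ U ≫ ((α_ X U U).hom ≫ X ◁ (β_ U U).hom ≫ (α_ X U U).inv) ≫ h ▷ U) :
    t ∈ tr U f := by
  rw [ht, hf]
  exact mem_tr_yank g h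

theorem mem_tr_of_equiv {U : C} {f : A ⊗ U ⟶ B ⊗ U} {G : FormalTrace A B}
    (h : (FormalTrace.mk U f).Equiv G) {t : A ⟶ B} (ht : t ∈ G.trace) : t ∈ tr U f :=
  h.trace_eq.ge _ ht

/-- Straightening a wire of a formal trace. -/
theorem Equiv.of_yank {F G : FormalTrace A B} {V Y : C} (φ : F.obj ≅ G.obj ⊗ V)
    (e : A ⊗ G.obj ≅ Y ⊗ V)
    (h : F.hom ≫ B ◁ φ.hom = A ◁ φ.hom ≫ (α_ _ _ _).inv ≫ (e.hom ▷ V ≫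
      ((α_ Y V V).hom ≫ Y ◁ (β_ V V).hom ≫ (α_ Y V V).inv) ≫ (e.inv ≫ G.hom) ▷ V) ≫
      (α_ _ _ _).hom) : F.Equiv G :=
  -- `φ` moves the loop `V` behind the other traced wires and `e` exposes the wire to which it is
  -- attached; yanking leaves `e.hom ≫ e.inv ≫ G.hom`.
  (Equiv.of_conj (G := ⟨G.obj ⊗ V, _⟩) φ h).trans
    (.of_mem_tr (mem_tr_of_yank _ _ (e.hom_inv_id_assoc _).symm rfl))

end FormalTrace

end

/-! ### The formal trace of a path -/

namespace IntP

open PartialTrace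

variable {C : Type u} [Category.{v} C] [MonoidalCategory C] [SymmetricCategory C]

/-- The formal trace whose value is the partial composite of a path. -/
def pathTrace {A B : IntP C} (p : Quiver.Path A B) :
    FormalTrace (A.pos ⊗ B.neg) (B.pos ⊗ A.neg) where
  obj := feedback p
  hom := 𝟙 ((A.pos ⊗ B.neg) ⊗ feedback p) ⊗≫ A.pos ◁ (β_ B.neg (feedback p)).hom ⊗≫
    precomp p ⊗≫ 𝟙 ((B.pos ⊗ A.neg) ⊗ feedback p)

/-- The permutation of the input wires for the composition with an arrow on the right. -/
def rightIn (A B D : IntP C) : (A.pos ⊗ D.neg) ⊗ B.neg ⟶ D.neg ⊗ (A.pos ⊗ B.neg) :=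
  (α_ _ _ _).hom ≫ A.pos ◁ (β_ D.neg B.neg).hom ≫ (α_ _ _ _).inv ≫
    (β_ (A.pos ⊗ B.neg) D.neg).hom

/-- The application of an arrow on the right to the output wires. -/
def rightOut (A : IntP C) {B D : IntP C} (g : B ⟶ D) :
    D.neg ⊗ (B.pos ⊗ A.neg) ⟶ (D.pos ⊗ A.neg) ⊗ B.neg :=
  (α_ _ _ _).inv ≫ (β_ D.neg B.pos).hom ▷ A.neg ≫ g.hom ▷ A.neg ≫ (α_ _ _ _).hom ≫
    D.pos ◁ (β_ B.neg A.neg).hom ≫ (α_ _ _ _).inv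

/-- The application of an arrow on the left to the input wires. -/
def leftIn {A B : IntP C} (g : A ⟶ B) (D : IntP C) :
    (A.pos ⊗ D.neg) ⊗ B.neg ⟶ A.neg ⊗ (B.pos ⊗ D.neg) :=
  (α_ _ _ _).hom ≫ A.pos ◁ (β_ D.neg B.neg).hom ≫ (α_ _ _ _).inv ≫ g.hom ▷ D.neg ≫
    (β_ B.pos A.neg).hom ▷ D.neg ≫ (α_ _ _ _).hom

/-- The permutation of the output wires for the composition with an arrow on the left. -/
def leftOut (A B D : IntP C) : A.neg ⊗ (D.pos ⊗ B.neg) ⟶ (D.pos ⊗ A.neg) ⊗ B.neg :=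
  (α_ _ _ _).inv ≫ (β_ A.neg D.pos).hom ▷ B.neg

/-- Composition of a formal trace with an arrow on the right. -/
def actRight {A B D : IntP C} (F : FormalTrace (A.pos ⊗ B.neg) (B.pos ⊗ A.neg)) (g : B ⟶ D) :
    FormalTrace (A.pos ⊗ D.neg) (D.pos ⊗ A.neg) :=
  F.ctx (rightIn A B D) (rightOut A g)

/-- Composition of a formal trace with an arrow on the left. -/
def actLeft {A B D : IntP C} (g : A ⟶ B) (F : FormalTrace (B.pos ⊗ D.neg) (D.pos ⊗ B.neg)) :
    FormalTrace (A.pos ⊗ D.neg) (D.pos ⊗ A.neg) :=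
  F.ctx (leftIn g D) (leftOut A B D)

/-- The arrow that acts separately on the positive and on the negative wires. -/
def splitHom {A B : IntP C} (a : A.pos ⟶ B.pos) (b : B.neg ⟶ A.neg) : A ⟶ B := Hom.mk (a ⊗ₘ b)

/-- The diagram behind `pathTrace_cons`, with the precomposite of the path generalized to an
arbitrary `k` that counts as a single box. -/
theorem feedback_braid {A B D : IntP C} {V : C}
    (k : A.pos ⊗ (V ⊗ B.neg) ⟶ B.pos ⊗ (A.neg ⊗ V)) (g : B ⟶ D) :
    ((α_ A.pos D.neg (V ⊗ B.neg)).hom ≫ A.pos ◁ (β_ D.neg (V ⊗ B.neg)).hom ≫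
      (𝟙 (A.pos ⊗ ((V ⊗ B.neg) ⊗ D.neg)) ⊗≫ k ▷ D.neg ⊗≫
        B.pos ◁ (β_ (A.neg ⊗ V) D.neg).hom ⊗≫
        g.hom ▷ (A.neg ⊗ V) ⊗≫
        D.pos ◁ (β_ B.neg (A.neg ⊗ V)).hom ⊗≫
        𝟙 (D.pos ⊗ (A.neg ⊗ (V ⊗ B.neg)))) ≫
      (α_ D.pos A.neg (V ⊗ B.neg)).inv) ≫ (D.pos ⊗ A.neg) ◁ (β_ V B.neg).hom =
    (A.pos ⊗ D.neg) ◁ (β_ V B.neg).hom ≫ (α_ _ _ _).inv ≫ (rightIn A B D ▷ V ≫ (α_ _ _ _).hom ≫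
      D.neg ◁ ((α_ _ _ _).hom ≫ A.pos ◁ (β_ B.neg V).hom ≫ k ≫ (α_ _ _ _).inv) ≫ (α_ _ _ _).inv ≫
      rightOut A g ▷ V) ≫ (α_ _ _ _).hom := by
  dsimp only [rightIn, rightOut]
  let w : List C := [A.pos, D.neg, V, B.neg, B.pos, A.neg, V, D.pos, B.neg]
  have := Diagram.box w (♯0 ⊠ ♯2 ⊠ ♯3) (♯4 ⊠ ♯5 ⊠ ♯6) k
  have := Diagram.box w (♯4 ⊠ ♯1) (♯7 ⊠ ♯8) g.hom
  exact Diagram.eq w ((♯0 ⊠ ♯1) ⊠ (♯2 ⊠ ♯3))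

variable [PartialTrace C]

theorem comp_eq_trace {A B : IntP C} (p : Quiver.Path A B) :
    comp p = (pathTrace p).trace.map Hom.mk := rfl

theorem mem_comp_iff {A B : IntP C} {p : Quiver.Path A B} {f : A ⟶ B} :
    f ∈ comp p ↔ f.hom ∈ (pathTrace p).trace := by
  rw [comp_eq_trace, Part.mem_map_iff]
  constructor
  · rintro ⟨t, ht, rfl⟩
    exact ht
  · exact fun h => ⟨_, h, rfl⟩

theorem pathTrace_hom {A B : IntP C} (p : Quiver.Path A B) :
    (pathTrace p).hom = (α_ _ _ _).hom ≫ A.pos ◁ (β_ B.neg (feedback p)).hom ≫ precomp p ≫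
      (α_ _ _ _).inv := by
  simp [pathTrace, monoidalComp]

/-- Appending an arrow is a context, except that `precomp` puts the new traced wire last and a
context puts it first. Further inductions on paths use this instead of the recursion of `precomp`.
-/
theorem pathTrace_cons {A B D : IntP C} (p : Quiver.Path A B) (g : B ⟶ D) :
    (pathTrace (p.cons g)).Equiv (actRight (pathTrace p) g) := by
  refine .of_conj (β_ (feedback p) B.neg) ?_
  rw [pathTrace_hom]
  dsimp only [actRight, FormalTrace.ctx]
  rw [pathTrace_hom]
  exact feedback_braid (precomp p) g

theorem id_mem_pathTrace_nil (A : IntP C) :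
    𝟙 (A.pos ⊗ A.neg) ∈ (pathTrace (Quiver.Path.nil : Quiver.Path A A)).trace := by
  refine Part.eq_some_iff.1 ((vanishing_unit _).trans (congrArg Part.some ?_))
  change (ρ_ (A.pos ⊗ A.neg)).inv ≫ (𝟙 ((A.pos ⊗ A.neg) ⊗ 𝟙_ C) ⊗≫ 
    A.pos ◁ (β_ A.neg (𝟙_ C)).hom ⊗≫ A.pos ◁ ((λ_ A.neg).hom ≫ (ρ_ A.neg).inv) ⊗≫
    𝟙 ((A.pos ⊗ A.neg) ⊗ 𝟙_ C)) ≫ (ρ_ _).hom = _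
  exact Diagram.eq [A.pos, A.neg] (♯0 ⊠ ♯1)

/-- Associativity of composition: both sides are a single context around `F`, with the shared wires
`B⁻` and `D⁻`, and the bypassing wires, in different orders. -/
theorem actRight_actLeft {A B D E : IntP C} (g : A ⟶ B)
    (F : FormalTrace (B.pos ⊗ D.neg) (D.pos ⊗ B.neg)) (h : D ⟶ E) :
    (actRight (actLeft g F) h).Equiv (actLeft g (actRight F h)) := by
  refine (FormalTrace.ctx_ctx _ _ _ _ F).trans (.trans ?_ (FormalTrace.ctx_ctx _ _ _ _ F).symm)
  refine FormalTrace.ctx_equiv_ctx (β_ D.neg B.neg) (β_ E.neg A.neg) ?_ ?_ F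
  · dsimp only [rightIn, leftIn]
    let w : List C := [A.pos, E.neg, D.neg, B.neg, B.pos, A.neg]
    have := Diagram.box w (♯0 ⊠ ♯3) (♯4 ⊠ ♯5) g.hom
    exact Diagram.eq w ((♯0 ⊠ ♯1) ⊠ (♯2 ⊠ ♯3))
  · dsimp only [rightOut, leftOut]
    let w : List C := [E.neg, A.neg, D.pos, B.neg, E.pos, D.neg]
    have := Diagram.box w (♯2 ⊠ ♯0) (♯4 ⊠ ♯5) h.hom
    exact Diagram.eq w ((♯0 ⊠ ♯1) ⊠ (♯2 ⊠ ♯3))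

/-- `h` is the composite of `f` and `g`. -/
def IsComp {A B D : IntP C} (f : A ⟶ B) (g : B ⟶ D) (h : A ⟶ D) : Prop :=
  h.hom ∈ tr B.neg (rightIn A B D ≫ D.neg ◁ f.hom ≫ rightOut A g)

/-- The loop through `B⁻` meets the split arrow only in `b`, so it is a bent wire and yanking
applies. Hence this composite is always defined. -/
theorem isComp_splitHom {A B D : IntP C} (f : A ⟶ B) (a : B.pos ⟶ D.pos) (b : D.neg ⟶ B.neg) :
    IsComp f (splitHom a b) (Hom.mk (A.pos ◁ b ≫ f.hom ≫ a ▷ A.neg)) := by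
  refine FormalTrace.mem_tr_of_yank (A.pos ◁ b) (f.hom ≫ a ▷ A.neg) rfl ?_
  dsimp only [splitHom, rightIn, rightOut]
  let w : List C := [A.pos, D.neg, B.neg, B.neg, B.pos, A.neg, D.pos]
  have := Diagram.box w (♯1) (♯3) b
  have := Diagram.box w (♯0 ⊠ ♯2) (♯4 ⊠ ♯5) f.hom
  have := Diagram.box w (♯4) (♯6) a
  exact Diagram.eq_swap w ((♯0 ⊠ ♯1) ⊠ ♯2) [1, 0]

theorem splitHom_isComp {A B D : IntP C} (a : A.pos ⟶ B.pos) (b : B.neg ⟶ A.neg) (g : B ⟶ D) :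
    IsComp (splitHom a b) g (Hom.mk (a ▷ D.neg ≫ g.hom ≫ D.pos ◁ b)) := by
  refine FormalTrace.mem_tr_of_yank (a ▷ D.neg ≫ g.hom) (D.pos ◁ b) (Category.assoc _ _ _).symm ?_
  dsimp only [splitHom, rightIn, rightOut]
  let w : List C := [A.pos, D.neg, B.neg, B.pos, A.neg, D.pos, B.neg]
  have := Diagram.box w (♯0) (♯3) a
  have := Diagram.box w (♯2) (♯4) b
  have := Diagram.box w (♯3 ⊠ ♯1) (♯5 ⊠ ♯6) g.hom
  exact Diagram.eq_swap w ((♯0 ⊠ ♯1) ⊠ ♯2) [1]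

theorem id_isComp {A B : IntP C} (f : A ⟶ B) : IsComp (idHom A) f f := by
  have h := splitHom_isComp (𝟙 A.pos) (𝟙 A.neg) f
  simp only [splitHom, id_tensorHom_id, whiskerLeft_id, id_whiskerRight, Category.id_comp,
    Category.comp_id] at h
  exact h

theorem trace_actRight {A B D : IntP C} {F : FormalTrace (A.pos ⊗ B.neg) (B.pos ⊗ A.neg)}
    {f : A ⟶ B} (hf : f.hom ∈ F.trace) (g : B ⟶ D) {h : A ⟶ D} :
    h.hom ∈ (actRight F g).trace ↔ IsComp f g h := by
  rw [actRight, FormalTrace.trace_ctx hf, IsComp]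

/-- A path of length one is the empty path, which has the identity as value by vanishing I, followed
by `f`. -/
theorem mem_pathTrace_toPath {A B : IntP C} (f : A ⟶ B) : f.hom ∈ (pathTrace f.toPath).trace := by
  have h := (trace_actRight (f := idHom A) (id_mem_pathTrace_nil A) f).2 (id_isComp f)
  rwa [← (pathTrace_cons _ f).trace_eq] at h

theorem mem_comp_pair_iff {A B D : IntP C} {f : A ⟶ B} {g : B ⟶ D} {h : A ⟶ D} :
    h ∈ comp (f.toPath.cons g) ↔ IsComp f g h := by
  rw [mem_comp_iff, (pathTrace_cons _ g).trace_eq, trace_actRight (mem_pathTrace_toPath f)]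

theorem mem_trace_actLeft_nil {A B : IntP C} (f : A ⟶ B) :
    f.hom ∈ (actLeft f (pathTrace (Quiver.Path.nil : Quiver.Path B B))).trace := by
  rw [actLeft, FormalTrace.trace_ctx (id_mem_pathTrace_nil B)]
  refine FormalTrace.mem_tr_of_yank (𝟙 (A.pos ⊗ B.neg)) f.hom (Category.id_comp _).symm ?_
  dsimp only [leftIn, leftOut]
  let w : List C := [A.pos, B.neg, B.neg, B.pos, A.neg]
  have := Diagram.box w (♯0 ⊠ ♯2) (♯3 ⊠ ♯4) f.hom
  exact Diagram.eq w ((♯0 ⊠ ♯1) ⊠ ♯2)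

/-- Paths grow at the right end, but compatibility with concatenation also requires extending them
at the left end. -/
theorem pathTrace_toPath_comp {A B D : IntP C} (f : A ⟶ B) (p : Quiver.Path B D) :
    (pathTrace (f.toPath.comp p)).Equiv (actLeft f (pathTrace p)) := by
  induction p with
  | nil => exact .of_mem (mem_pathTrace_toPath f) (mem_trace_actLeft_nil f)
  | cons p g ih =>
    exact (pathTrace_cons _ g).trans (((ih.ctx _ _).trans (actRight_actLeft f (pathTrace p) g)).trans
      ((pathTrace_cons p g).symm.ctx _ _))

theorem pathTrace_comp_right {A B D : IntP C} {p p' : Quiver.Path A B}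
    (h : (pathTrace p).Equiv (pathTrace p')) (q : Quiver.Path B D) :
    (pathTrace (p.comp q)).Equiv (pathTrace (p'.comp q)) := by
  induction q with
  | nil => exact h
  | cons q g ih => exact (pathTrace_cons _ g).trans ((ih.ctx _ _).trans (pathTrace_cons _ g).symm)

/-- The last arrow of `p` is moved to the front of `q` and `q'`, which shortens `p`. -/
theorem pathTrace_comp_left {A B D : IntP C} (p : Quiver.Path A B) {q q' : Quiver.Path B D}
    (h : (pathTrace q).Equiv (pathTrace q')) :
    (pathTrace (p.comp q)).Equiv (pathTrace (p.comp q')) := by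
  induction p with
  | nil => simpa using h
  | cons p g ih =>
    have := ih ((pathTrace_toPath_comp g q).trans
      ((h.ctx _ _).trans (pathTrace_toPath_comp g q').symm))
    rw [← Quiver.Path.comp_assoc, ← Quiver.Path.comp_assoc] at this
    exact this

/-! ### Tensor products of paths with identities -/

/-- Input wires of `1_X ⊗ F`. -/
def tensorLeftIn (X A B : IntP C) :
    (X.pos ⊗ A.pos) ⊗ (B.neg ⊗ X.neg) ⟶ (X.pos ⊗ X.neg) ⊗ (A.pos ⊗ B.neg) :=
  (α_ _ _ _).hom ≫ X.pos ◁ (α_ _ _ _).inv ≫ X.pos ◁ (β_ _ _).hom ≫ (α_ _ _ _).inv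

/-- Output wires of `1_X ⊗ F`. -/
def tensorLeftOut (X A B : IntP C) :
    (X.pos ⊗ X.neg) ⊗ (B.pos ⊗ A.neg) ⟶ (X.pos ⊗ B.pos) ⊗ (A.neg ⊗ X.neg) :=
  (α_ _ _ _).hom ≫ X.pos ◁ (β_ _ _).hom ≫ X.pos ◁ (α_ _ _ _).hom ≫ (α_ _ _ _).inv

/-- Input wires of `F ⊗ 1_X`. -/
def tensorRightIn (X A B : IntP C) :
    (A.pos ⊗ X.pos) ⊗ (X.neg ⊗ B.neg) ⟶ (X.pos ⊗ X.neg) ⊗ (A.pos ⊗ B.neg) :=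
  (α_ _ _ _).hom ≫ A.pos ◁ (α_ _ _ _).inv ≫ (α_ _ _ _).inv ≫ (β_ _ _).hom ▷ B.neg ≫
    (α_ _ _ _).hom

/-- Output wires of `F ⊗ 1_X`. -/
def tensorRightOut (X A B : IntP C) :
    (X.pos ⊗ X.neg) ⊗ (B.pos ⊗ A.neg) ⟶ (B.pos ⊗ X.pos) ⊗ (X.neg ⊗ A.neg) :=
  (α_ _ _ _).inv ≫ (β_ _ _).hom ▷ A.neg ≫ (α_ _ _ _).hom ≫ B.pos ◁ (α_ _ _ _).hom ≫ (α_ _ _ _).inv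

theorem tensorHom_id_left (X : IntP C) {A B : IntP C} (f : A ⟶ B) :
    (tensorHom (idHom X) f).hom =
      tensorLeftIn X A B ≫ (X.pos ⊗ X.neg) ◁ f.hom ≫ tensorLeftOut X A B := by
  dsimp only [tensorHom, idHom, tensorLeftIn, tensorLeftOut, tensorObj]
  let w : List C := [X.pos, A.pos, B.neg, X.neg, B.pos, A.neg]
  have := Diagram.box w (♯1 ⊠ ♯2) (♯4 ⊠ ♯5) f.hom
  exact Diagram.eq w ((♯0 ⊠ ♯1) ⊠ (♯2 ⊠ ♯3))

theorem tensorHom_id_right (X : IntP C) {A B : IntP C} (f : A ⟶ B) :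
    (tensorHom f (idHom X)).hom =
      tensorRightIn X A B ≫ (X.pos ⊗ X.neg) ◁ f.hom ≫ tensorRightOut X A B := by
  dsimp only [tensorHom, idHom, tensorRightIn, tensorRightOut, tensorObj]
  let w : List C := [A.pos, X.pos, X.neg, B.neg, B.pos, A.neg]
  have := Diagram.box w (♯0 ⊠ ♯3) (♯4 ⊠ ♯5) f.hom
  exact Diagram.eq w ((♯0 ⊠ ♯1) ⊠ (♯2 ⊠ ♯3))

/-- The left side has an additional loop through `X⁻`. Only identities are attached to it, so it can
be yanked away. -/
theorem actRight_tensorLeft (X : IntP C) {A B D : IntP C}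
    (F : FormalTrace (A.pos ⊗ B.neg) (B.pos ⊗ A.neg)) (g : B ⟶ D) :
    (actRight (A := tensorObj X A) (B := tensorObj X B) (D := tensorObj X D)
        (F.wrap (tensorLeftIn X A B) (tensorLeftOut X A B)) (tensorHom (idHom X) g)).Equiv
      ((actRight F g).wrap (tensorLeftIn X A D) (tensorLeftOut X A D)) := by
  -- The first isomorphism moves the loop `X⁻` behind `B⁻` and the traced wires of `F`; the second
  -- moves the input wire `X⁻`, to which it is attached, to the end.
  refine .of_yank (V := X.neg) (Y := ((X.pos ⊗ A.pos) ⊗ D.neg) ⊗ (B.neg ⊗ F.obj))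
    (α_ B.neg X.neg F.obj ≪≫ whiskerLeftIso B.neg (β_ X.neg F.obj) ≪≫ (α_ B.neg F.obj X.neg).symm)
    (whiskerRightIso (α_ (X.pos ⊗ A.pos) D.neg X.neg).symm (B.neg ⊗ F.obj) ≪≫ α_ _ _ _ ≪≫
      whiskerLeftIso _ (β_ X.neg (B.neg ⊗ F.obj)) ≪≫ (α_ _ _ _).symm) ?_
  dsimp only [actRight, FormalTrace.ctx, FormalTrace.wrap, rightOut]
  rw [tensorHom_id_left]
  dsimp only [rightIn, tensorLeftIn, tensorLeftOut, tensorObj, Iso.trans_hom,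
    Iso.trans_inv, Iso.symm_hom, Iso.symm_inv, whiskerLeftIso, whiskerRightIso]
  let w : List C := [X.pos, A.pos, D.neg, X.neg, B.neg, X.neg, F.obj, B.pos, A.neg, F.obj, D.pos, B.neg]
  have := Diagram.box w ((♯1 ⊠ ♯4) ⊠ ♯6) ((♯7 ⊠ ♯8) ⊠ ♯9) F.hom
  have := Diagram.box w (♯7 ⊠ ♯2) (♯10 ⊠ ♯11) g.hom
  exact Diagram.eq w (((♯0 ⊠ ♯1) ⊠ ♯2 ⊠ ♯3) ⊠ ((♯4 ⊠ ♯5) ⊠ ♯6))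

theorem actRight_tensorRight (X : IntP C) {A B D : IntP C}
    (F : FormalTrace (A.pos ⊗ B.neg) (B.pos ⊗ A.neg)) (g : B ⟶ D) :
    (actRight (A := tensorObj A X) (B := tensorObj B X) (D := tensorObj D X)
        (F.wrap (tensorRightIn X A B) (tensorRightOut X A B)) (tensorHom g (idHom X))).Equiv
      ((actRight F g).wrap (tensorRightIn X A D) (tensorRightOut X A D)) := by
  refine .of_yank (V := X.neg) (Y := ((A.pos ⊗ X.pos) ⊗ D.neg) ⊗ (B.neg ⊗ F.obj))
    (α_ X.neg B.neg F.obj ≪≫ β_ X.neg (B.neg ⊗ F.obj))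
    (whiskerRightIso (whiskerLeftIso _ (β_ _ _) ≪≫ (α_ (A.pos ⊗ X.pos) D.neg X.neg).symm)
      (B.neg ⊗ F.obj) ≪≫ α_ _ _ _ ≪≫
      whiskerLeftIso _ (β_ X.neg (B.neg ⊗ F.obj)) ≪≫ (α_ _ _ _).symm) ?_
  dsimp only [actRight, FormalTrace.ctx, FormalTrace.wrap, rightOut]
  rw [tensorHom_id_right]
  dsimp only [rightIn, tensorRightIn, tensorRightOut, tensorObj, Iso.trans_hom,
    Iso.trans_inv, Iso.symm_hom, Iso.symm_inv, whiskerLeftIso, whiskerRightIso]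
  let w : List C := [A.pos, X.pos, X.neg, D.neg, X.neg, B.neg, F.obj, B.pos, A.neg, F.obj, D.pos, B.neg]
  have := Diagram.box w ((♯0 ⊠ ♯5) ⊠ ♯6) ((♯7 ⊠ ♯8) ⊠ ♯9) F.hom
  have := Diagram.box w (♯7 ⊠ ♯3) (♯10 ⊠ ♯11) g.hom
  exact Diagram.eq w (((♯0 ⊠ ♯1) ⊠ ♯2 ⊠ ♯3) ⊠ ((♯4 ⊠ ♯5) ⊠ ♯6))

theorem tensorHom_id_id (X A : IntP C) : tensorHom (idHom X) (idHom A) = idHom (tensorObj X A) := by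
  refine congrArg Hom.mk ?_
  dsimp only [idHom, tensorObj]
  exact Diagram.eq [X.pos, A.pos, A.neg, X.neg] ((♯0 ⊠ ♯1) ⊠ ♯2 ⊠ ♯3)

theorem pathTrace_tensorLeft (X : IntP C) {A B : IntP C} (p : Quiver.Path A B) :
    (pathTrace ((tensorLeft X).mapPath p)).Equiv
      ((pathTrace p).wrap (tensorLeftIn X A B) (tensorLeftOut X A B)) := by
  induction p with
  | nil =>
    refine .of_mem (id_mem_pathTrace_nil (tensorObj X A)) ?_
    exact FormalTrace.mem_trace_wrap (id_mem_pathTrace_nil A) _ _ ((congrArg Hom.hom (tensorHom_id_id X A)).symm.trans (tensorHom_id_left X (idHom A)))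
  | cons p g ih =>
    exact (pathTrace_cons _ _).trans ((ih.ctx _ _).trans
      ((actRight_tensorLeft X _ g).trans ((pathTrace_cons p g).symm.wrap _ _)))

theorem pathTrace_tensorRight (X : IntP C) {A B : IntP C} (p : Quiver.Path A B) :
    (pathTrace ((tensorRight X).mapPath p)).Equiv
      ((pathTrace p).wrap (tensorRightIn X A B) (tensorRightOut X A B)) := by
  induction p with
  | nil =>
    refine .of_mem (id_mem_pathTrace_nil (tensorObj A X)) ?_
    exact FormalTrace.mem_trace_wrap (id_mem_pathTrace_nil A) _ _ ((congrArg Hom.hom (tensorHom_id_id A X)).symm.trans (tensorHom_id_right X (idHom A)))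
  | cons p g ih =>
    exact (pathTrace_cons _ _).trans ((ih.ctx _ _).trans
      ((actRight_tensorRight X _ g).trans ((pathTrace_cons p g).symm.wrap _ _)))

/-! ### The congruence of paths -/

/-- The central point: being the smallest congruence, `∼` is contained in the equivalence of formal
traces. -/
theorem isCongruence_pathTrace :
    IsCongruence fun (_ _ : IntP C) p q => (pathTrace p).Equiv (pathTrace q) where
  equivalence _ _ := ⟨fun _ => .refl _, .symm, .trans⟩
  comp h h' := (pathTrace_comp_right h _).trans (pathTrace_comp_left _ h')
  eval _ f h := .of_mem (mem_comp_iff.1 h) (mem_pathTrace_toPath f)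
  tensorRight X h := (pathTrace_tensorRight X _).trans
    ((h.wrap _ _).trans (pathTrace_tensorRight X _).symm)
  tensorLeft X h := (pathTrace_tensorLeft X _).trans
    ((h.wrap _ _).trans (pathTrace_tensorLeft X _).symm)

theorem comp_eq_of_sim {A B : IntP C} {p q : Quiver.Path A B} (h : sim C p q) :
    comp p = comp q := by
  rw [comp_eq_trace, comp_eq_trace, (h _ isCongruence_pathTrace).trace_eq]

theorem isCongruence_sim : IsCongruence fun (A B : IntP C) p q => sim C (X := A) (Y := B) p q where
  equivalence A B :=
    ⟨fun p _ hS => (hS.equivalence A B).refl p, fun h _ hS => (hS.equivalence A B).symm (h _ hS),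
      fun h h' _ hS => (hS.equivalence A B).trans (h _ hS) (h' _ hS)⟩
  comp h h' _ hS := hS.comp (h _ hS) (h' _ hS)
  eval p f h _ hS := hS.eval p f h
  tensorRight X h _ hS := hS.tensorRight X (h _ hS)
  tensorLeft X h _ hS := hS.tensorLeft X (h _ hS)

/-- One direction is a generating relation. For the other, related paths have the same partial
composite, and the path of length one at `f` has composite `f`. -/
theorem mem_comp_iff_sim {A B : IntP C} {p : Quiver.Path A B} {f : A ⟶ B} :
    f ∈ comp p ↔ sim C (X := A) (Y := B) p f.toPath :=
  ⟨isCongruence_sim.eval p f, fun h => by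
    rw [comp_eq_of_sim h, mem_comp_iff]
    exact mem_pathTrace_toPath f⟩

end IntP

/-! ### The canonical trace of a compact closed category -/

section CanonicalTrace

variable {D : Type u} [Category.{v} D] [MonoidalCategory D] [SymmetricCategory D]

/-- The formula of the canonical trace, for arbitrary morphisms in place of the unit and counit. -/
def loopTrace {X U : D} (η : 𝟙_ D ⟶ X ⊗ U) (ε : U ⊗ X ⟶ 𝟙_ D) {A B : D} (f : A ⊗ U ⟶ B ⊗ U) :
    A ⟶ B :=
  (ρ_ A).inv ≫ A ◁ η ≫ A ◁ (β_ X U).hom ≫ (α_ A U X).inv ≫ f ▷ X ≫ (α_ B U X).hom ≫ B ◁ ε ≫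
    (ρ_ B).hom

/-- The triangle identity for `U`. -/
def IsZigzag {X U : D} (η : 𝟙_ D ⟶ X ⊗ U) (ε : U ⊗ X ⟶ 𝟙_ D) : Prop :=
  U ◁ η ≫ (α_ U X U).inv ≫ ε ▷ U = (ρ_ U).hom ≫ (λ_ U).inv

/-- `m` is the transpose of `g` between the duals. It carries `g` through the cup in `h₁` and
through the cap in `h₂`, each time by one triangle identity. -/
theorem loopTrace_dinaturality {X U X' U' : D} {η : 𝟙_ D ⟶ X ⊗ U} {ε : U ⊗ X ⟶ 𝟙_ D}
    {η' : 𝟙_ D ⟶ X' ⊗ U'} {ε' : U' ⊗ X' ⟶ 𝟙_ D} (h : IsZigzag η ε) (h' : IsZigzag η' ε')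
    {A B : D} (f : A ⊗ U ⟶ B ⊗ U') (g : U' ⟶ U) :
    loopTrace η ε (f ≫ B ◁ g) = loopTrace η' ε' (A ◁ g ≫ f) := by
  obtain ⟨m, hm⟩ : ∃ m : X ⟶ X', m = (λ_ X).inv ≫ η' ▷ X ≫ (α_ X' U' X).hom ≫
    X' ◁ (g ▷ X ≫ ε) ≫ (ρ_ X').hom := ⟨_, rfl⟩
  have h₁ : η ≫ m ▷ U = η' ≫ X' ◁ g := by
    trans η' ≫ X' ◁ (g ≫ (ρ_ U).inv ≫ (U ◁ η ≫ (α_ U X U).inv ≫ ε ▷ U) ≫ (λ_ U).hom)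
    · rw [hm]
      let w : List D := [X, U, X', U', U]
      have := Diagram.box w .one (♯0 ⊠ ♯1) η
      have := Diagram.box w .one (♯2 ⊠ ♯3) η'
      have := Diagram.box w (♯3) (♯4) g
      have := Diagram.box w (♯4 ⊠ ♯0) .one ε
      exact Diagram.eq_swap w .one [0, 1]
    · rw [h]
      simp
  have h₂ : U' ◁ m ≫ ε' = g ▷ X ≫ ε := by
    trans (((ρ_ U').inv ≫ (U' ◁ η' ≫ (α_ U' X' U').inv ≫ ε' ▷ U') ≫ (λ_ U').hom) ≫ g) ▷ X ≫ ε
    · rw [hm]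
      let w : List D := [U', X, X', U', U]
      have := Diagram.box w .one (♯2 ⊠ ♯3) η'
      have := Diagram.box w (♯3) (♯4) g
      have := Diagram.box w (♯4 ⊠ ♯1) .one ε
      have := Diagram.box w (♯0 ⊠ ♯2) .one ε'
      exact Diagram.eq_swap w (♯0 ⊠ ♯1) [2, 1]
    · rw [h']
      simp
  trans (ρ_ A).inv ≫ A ◁ η ≫ A ◁ (β_ X U).hom ≫ (α_ A U X).inv ≫ f ▷ X ≫ (α_ B U' X).hom ≫
    B ◁ (g ▷ X ≫ ε) ≫ (ρ_ B).hom
  · simp [loopTrace]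
  trans (ρ_ A).inv ≫ A ◁ (η' ≫ X' ◁ g) ≫ A ◁ (β_ X' U).hom ≫ (α_ A U X').inv ≫ f ▷ X' ≫
    (α_ B U' X').hom ≫ B ◁ ε' ≫ (ρ_ B).hom
  · rw [← h₁, ← h₂]
    let w : List D := [A, X, U, B, U', X']
    have := Diagram.box w .one (♯1 ⊠ ♯2) η
    have := Diagram.box w (♯0 ⊠ ♯2) (♯3 ⊠ ♯4) f
    have := Diagram.box w (♯1) (♯5) m
    have := Diagram.box w (♯4 ⊠ ♯5) .one ε'
    exact Diagram.eq_swap w (♯0) [1]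
  · rw [loopTrace]
    let w : List D := [A, X', U', U, B, U']
    have := Diagram.box w .one (♯1 ⊠ ♯2) η'
    have := Diagram.box w (♯2) (♯3) g
    have := Diagram.box w (♯0 ⊠ ♯3) (♯4 ⊠ ♯5) f
    have := Diagram.box w (♯5 ⊠ ♯1) .one ε'
    exact Diagram.eq w (♯0)

/-- Independence of the chosen dual. It is needed because the chosen dual of `U ⊗ V` need not be `V*
⊗ U*`. -/
theorem loopTrace_eq {X X' U : D} {η : 𝟙_ D ⟶ X ⊗ U} {ε : U ⊗ X ⟶ 𝟙_ D}
    {η' : 𝟙_ D ⟶ X' ⊗ U} {ε' : U ⊗ X' ⟶ 𝟙_ D} (h : IsZigzag η ε) (h' : IsZigzag η' ε')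
    {A B : D} (f : A ⊗ U ⟶ B ⊗ U) : loopTrace η ε f = loopTrace η' ε' f := by
  simpa using loopTrace_dinaturality h h' f (𝟙 U)

/-- The unit of a tensor product. -/
def tensorCup {X U Y V : D} (η : 𝟙_ D ⟶ X ⊗ U) (η' : 𝟙_ D ⟶ Y ⊗ V) :
    𝟙_ D ⟶ (Y ⊗ X) ⊗ (U ⊗ V) :=
  η' ≫ Y ◁ ((λ_ V).inv ≫ η ▷ V ≫ (α_ X U V).hom) ≫ (α_ Y X (U ⊗ V)).inv

/-- The counit of a tensor product. -/
def tensorCap {X U Y V : D} (ε : U ⊗ X ⟶ 𝟙_ D) (ε' : V ⊗ Y ⟶ 𝟙_ D) :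
    (U ⊗ V) ⊗ (Y ⊗ X) ⟶ 𝟙_ D :=
  (α_ U V (Y ⊗ X)).hom ≫ U ◁ ((α_ V Y X).inv ≫ ε' ▷ X ≫ (λ_ X).hom) ≫ ε

theorem IsZigzag.tensor {X U Y V : D} {η : 𝟙_ D ⟶ X ⊗ U} {ε : U ⊗ X ⟶ 𝟙_ D}
    {η' : 𝟙_ D ⟶ Y ⊗ V} {ε' : V ⊗ Y ⟶ 𝟙_ D} (h : IsZigzag η ε) (h' : IsZigzag η' ε') :
    IsZigzag (tensorCup η η') (tensorCap ε ε') := by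
  dsimp only [IsZigzag, tensorCup, tensorCap]
  trans (ρ_ (U ⊗ V)).hom ≫ U ◁ ((ρ_ V).inv ≫ (V ◁ η' ≫ (α_ V Y V).inv ≫ ε' ▷ V) ≫ (λ_ V).hom) ≫
    ((ρ_ U).inv ≫ (U ◁ η ≫ (α_ U X U).inv ≫ ε ▷ U) ≫ (λ_ U).hom) ▷ V ≫ (λ_ (U ⊗ V)).inv
  · let w : List D := [U, V, Y, V, X, U]
    have := Diagram.box w .one (♯2 ⊠ ♯3) η'
    have := Diagram.box w .one (♯4 ⊠ ♯5) η
    have := Diagram.box w (♯1 ⊠ ♯2) .one ε'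
    have := Diagram.box w (♯0 ⊠ ♯4) .one ε
    exact Diagram.eq_swap w ((♯0 ⊠ ♯1) ⊠ .one) [1]
  · rw [h, h']
    simp

/-- A loop on the unit object detaches from `f`, and what remains of it is the triangle identity. -/
theorem loopTrace_unit {X : D} {η : 𝟙_ D ⟶ X ⊗ 𝟙_ D} {ε : 𝟙_ D ⊗ X ⟶ 𝟙_ D} (h : IsZigzag η ε)
    {A B : D} (f : A ⊗ 𝟙_ D ⟶ B ⊗ 𝟙_ D) : loopTrace η ε f = (ρ_ A).inv ≫ f ≫ (ρ_ B).hom := by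
  trans (ρ_ A).inv ≫ A ◁ ((ρ_ (𝟙_ D)).inv ≫ (𝟙_ D ◁ η ≫ (α_ _ _ _).inv ≫ ε ▷ 𝟙_ D) ≫
    (λ_ (𝟙_ D)).hom) ≫ f ≫ (ρ_ B).hom
  · dsimp only [loopTrace]
    let w : List D := [A, X, B]
    have := Diagram.box w .one (♯1 ⊠ .one) η
    have := Diagram.box w (.one ⊠ ♯1) .one ε
    have := Diagram.box w (♯0 ⊠ .one) (♯2 ⊠ .one) f
    exact Diagram.eq_swap w (♯0) [1]
  · rw [h]
    simp

theorem isZigzag_leftDual [LeftRigidCategory D] (U : D) :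
    IsZigzag (η_ (HasLeftDual.leftDual U) U) (ε_ (HasLeftDual.leftDual U) U) :=
  ExactPairing.coevaluation_evaluation _ _

variable (D) in
/-- The canonical trace is a total trace. -/
def canonicalTotalTrace [LeftRigidCategory D] : TotalTrace D where
  tr U f := canonicalTrace U f
  naturality {A B A' B' U} f g h := by
    dsimp only [canonicalTrace]
    let w : List D := [A', A, HasLeftDual.leftDual U, U, B, U, B']
    have := Diagram.box w .one (♯2 ⊠ ♯3) (η_ (HasLeftDual.leftDual U) U)
    have := Diagram.box w (♯5 ⊠ ♯2) .one (ε_ (HasLeftDual.leftDual U) U)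
    have := Diagram.box w (♯1 ⊠ ♯3) (♯4 ⊠ ♯5) f
    have := Diagram.box w (♯0) (♯1) g
    have := Diagram.box w (♯4) (♯6) h
    exact Diagram.eq_swap w (♯0) [0, 3]
  dinaturality f g := loopTrace_dinaturality (isZigzag_leftDual _) (isZigzag_leftDual _) f g
  strength {A B U X Y} f g := by
    dsimp only [canonicalTrace]
    let w : List D := [X, A, HasLeftDual.leftDual U, U, B, U, Y]
    have := Diagram.box w .one (♯2 ⊠ ♯3) (η_ (HasLeftDual.leftDual U) U)
    have := Diagram.box w (♯5 ⊠ ♯2) .one (ε_ (HasLeftDual.leftDual U) U)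
    have := Diagram.box w (♯1 ⊠ ♯3) (♯4 ⊠ ♯5) f
    have := Diagram.box w (♯0) (♯6) g
    exact Diagram.eq_swap w (♯0 ⊠ ♯1) [0]
  vanishing_unit f := loopTrace_unit (isZigzag_leftDual _) f
  vanishing_tensor {A B U V} f := by
    -- The two nested loops form one loop for the dual `V* ⊗ U*`, which is then exchanged for the
    -- chosen dual.
    refine Eq.trans ?_ (loopTrace_eq ((isZigzag_leftDual U).tensor (isZigzag_leftDual V))
      (isZigzag_leftDual (U ⊗ V)) _)
    dsimp only [canonicalTrace, loopTrace, tensorCup, tensorCap]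
    let w : List D := [A, HasLeftDual.leftDual U, U, HasLeftDual.leftDual V, V, B, U, V]
    have := Diagram.box w .one (♯1 ⊠ ♯2) (η_ (HasLeftDual.leftDual U) U)
    have := Diagram.box w (♯6 ⊠ ♯1) .one (ε_ (HasLeftDual.leftDual U) U)
    have := Diagram.box w .one (♯3 ⊠ ♯4) (η_ (HasLeftDual.leftDual V) V)
    have := Diagram.box w (♯7 ⊠ ♯3) .one (ε_ (HasLeftDual.leftDual V) V)
    have := Diagram.box w ((♯0 ⊠ ♯2) ⊠ ♯4) ((♯5 ⊠ ♯6) ⊠ ♯7) f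
    exact Diagram.eq_swap w (♯0) [0]
  yanking A := by
    trans (ρ_ A).inv ≫ (A ◁ η_ (HasLeftDual.leftDual A) A ≫ (α_ _ _ _).inv ≫
      ε_ (HasLeftDual.leftDual A) A ▷ A) ≫ (λ_ A).hom
    · dsimp only [canonicalTrace]
      let w : List D := [A, HasLeftDual.leftDual A, A]
      have := Diagram.box w .one (♯1 ⊠ ♯2) (η_ (HasLeftDual.leftDual A) A)
      have := Diagram.box w (♯0 ⊠ ♯1) .one (ε_ (HasLeftDual.leftDual A) A)
      exact Diagram.eq w (♯0)
    · rw [isZigzag_leftDual]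
      simp

end CanonicalTrace

/-! ### Composition in the completion -/

namespace IntP

open PartialTrace

variable {C : Type u} [Category.{v} C] [MonoidalCategory C] [SymmetricCategory C] [PartialTrace C]

instance : Congruence (sim C) where
  equivalence := isCongruence_sim.equivalence _ _
  comp_left _ _ _ h := isCongruence_sim.comp ((isCongruence_sim.equivalence _ _).refl _) h
  comp_right _ h := isCongruence_sim.comp h ((isCongruence_sim.equivalence _ _).refl _)

/-- An object of `Int^p(C)`, as an object of the completion. -/
def of (A : IntP C) : Completion C := (toCompletion C).obj A

/-- The object of `Int^p(C)` underlying an object of the completion. -/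
def base (X : Completion C) : IntP C := X.as

/-- The class of a path in the completion. -/
def cls {A B : IntP C} (p : Quiver.Path A B) : of A ⟶ of B :=
  (CategoryTheory.Quotient.functor (sim C)).map (X := A) (Y := B) p

/-- The class of an arrow in the completion. -/
def ofHom {A B : IntP C} (f : A ⟶ B) : of A ⟶ of B := (toCompletion C).map f

theorem cls_eq_iff {A B : IntP C} {p q : Quiver.Path A B} :
    cls p = cls q ↔ sim C (X := A) (Y := B) p q :=
  CategoryTheory.Quotient.functor_map_eq_iff (sim C) (X := A) (Y := B) p q

theorem mem_comp_iff_cls {A B : IntP C} {p : Quiver.Path A B} {f : A ⟶ B} :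
    f ∈ comp p ↔ cls p = ofHom f :=
  mem_comp_iff_sim.trans cls_eq_iff.symm

/-- Both arrows are values of the same partial composite, and values are unique. -/
theorem ofHom_injective {A B : IntP C} {f g : A ⟶ B} (h : ofHom f = ofHom g) : f = g := by
  have h₁ : f ∈ comp f.toPath := mem_comp_iff_cls.2 rfl
  have h₂ : g ∈ comp f.toPath := mem_comp_iff_cls.2 h
  exact Part.mem_unique h₁ h₂

theorem ofHom_idHom (A : IntP C) : ofHom (idHom A) = 𝟙 (of A) := by
  have h : idHom A ∈ comp (Quiver.Path.nil : Quiver.Path A A) :=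
    mem_comp_iff.2 (id_mem_pathTrace_nil A)
  exact (mem_comp_iff_cls.1 h).symm

/-- Turns an equation in the completion into membership in a single trace of `C`. -/
theorem ofHom_comp_ofHom_eq_iff {A B D : IntP C} {f : A ⟶ B} {g : B ⟶ D} {h : A ⟶ D} :
    ofHom f ≫ ofHom g = ofHom h ↔ IsComp f g h :=
  mem_comp_iff_cls.symm.trans mem_comp_pair_iff

theorem hom_induction {P : ∀ {A B : IntP C}, (of A ⟶ of B) → Prop}
    (id : ∀ A : IntP C, P (𝟙 (of A)))
    (comp : ∀ {A B D : IntP C} (p : of A ⟶ of B) (f : B ⟶ D), P p → P (p ≫ ofHom f))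
    {A B : IntP C} (f : of A ⟶ of B) : P f := by
  obtain ⟨p, rfl⟩ : ∃ p : Quiver.Path A B, cls p = f := ⟨Quot.out f, Quot.out_eq f⟩
  induction p with
  | nil => exact id A
  | cons p g ih => exact comp (cls p) g ih

/-- Arrows generate the completion, so naturality squares need only be checked for them, although
their composites may fail to be arrows. -/
theorem naturality_of_ofHom {L R : Completion C ⥤ Completion C}
    (c : ∀ A : IntP C, L.obj (of A) ⟶ R.obj (of A))
    (h : ∀ {A B : IntP C} (f : A ⟶ B), L.map (ofHom f) ≫ c B = c A ≫ R.map (ofHom f))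
    {A B : IntP C} (f : of A ⟶ of B) : L.map f ≫ c B = c A ≫ R.map f := by
  induction f using hom_induction with
  | id A => simp
  | comp p f ih => rw [L.map_comp, R.map_comp, Category.assoc, h, ← Category.assoc, ih,
      Category.assoc]

/-! ### Arrows that act separately on positive and negative wires -/

theorem ofHom_comp_split {A B D : IntP C} (f : A ⟶ B) (a : B.pos ⟶ D.pos) (b : D.neg ⟶ B.neg) :
    ofHom f ≫ ofHom (splitHom a b) = ofHom (Hom.mk (A.pos ◁ b ≫ f.hom ≫ a ▷ A.neg)) :=
  ofHom_comp_ofHom_eq_iff.2 (isComp_splitHom f a b)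

theorem split_comp_ofHom {A B D : IntP C} (a : A.pos ⟶ B.pos) (b : B.neg ⟶ A.neg) (g : B ⟶ D) :
    ofHom (splitHom a b) ≫ ofHom g = ofHom (Hom.mk (a ▷ D.neg ≫ g.hom ≫ D.pos ◁ b)) :=
  ofHom_comp_ofHom_eq_iff.2 (splitHom_isComp a b g)

/-- Naturality squares of structural isomorphisms have split arrows on two opposite sides, and so
become equations of `C` without a trace. -/
theorem ofHom_comp_split_eq {A B B' D : IntP C} (f : A ⟶ B) (a : B.pos ⟶ D.pos) (b : D.neg ⟶ B.neg)
    (a' : A.pos ⟶ B'.pos) (b' : B'.neg ⟶ A.neg) (g : B' ⟶ D)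
    (h : A.pos ◁ b ≫ f.hom ≫ a ▷ A.neg = a' ▷ D.neg ≫ g.hom ≫ D.pos ◁ b') :
    ofHom f ≫ ofHom (splitHom a b) = ofHom (splitHom a' b') ≫ ofHom g := by
  rw [ofHom_comp_split, split_comp_ofHom, h]

theorem split_comp_split {A B D : IntP C} (a : A.pos ⟶ B.pos) (b : B.neg ⟶ A.neg)
    (a' : B.pos ⟶ D.pos) (b' : D.neg ⟶ B.neg) :
    ofHom (splitHom a b) ≫ ofHom (splitHom a' b') = ofHom (splitHom (a ≫ a') (b' ≫ b)) := by
  rw [ofHom_comp_split]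
  simp [splitHom, ← id_tensorHom, ← tensorHom_id]

theorem idHom_eq_splitHom (A : IntP C) : idHom A = splitHom (𝟙 A.pos) (𝟙 A.neg) :=
  congrArg Hom.mk (id_tensorHom_id _ _).symm

theorem ofHom_split_id (A : IntP C) : ofHom (splitHom (𝟙 A.pos) (𝟙 A.neg)) = 𝟙 (of A) := by
  rw [← idHom_eq_splitHom, ofHom_idHom]

/-- The isomorphism that acts separately on the positive and on the negative wires. -/
def splitIso {A B : IntP C} (a : A.pos ≅ B.pos) (b : B.neg ≅ A.neg) : of A ≅ of B where
  hom := ofHom (splitHom a.hom b.hom)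
  inv := ofHom (splitHom a.inv b.inv)
  hom_inv_id := by rw [split_comp_split, a.hom_inv_id, b.inv_hom_id, ofHom_split_id]
  inv_hom_id := by rw [split_comp_split, a.inv_hom_id, b.hom_inv_id, ofHom_split_id]

theorem tensorHom_splitHom {A A' B B' : IntP C} (a : A.pos ⟶ A'.pos) (b : A'.neg ⟶ A.neg)
    (a' : B.pos ⟶ B'.pos) (b' : B'.neg ⟶ B.neg) :
    tensorHom (splitHom a b) (splitHom a' b') =
      splitHom (A := tensorObj A B) (B := tensorObj A' B') (a ⊗ₘ a') (b' ⊗ₘ b) := by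
  refine congrArg Hom.mk ?_
  dsimp only [splitHom, tensorObj]
  let w : List C := [A.pos, B.pos, B'.neg, A'.neg, A'.pos, A.neg, B'.pos, B.neg]
  have := Diagram.box w (♯0) (♯4) a
  have := Diagram.box w (♯3) (♯5) b
  have := Diagram.box w (♯1) (♯6) a'
  have := Diagram.box w (♯2) (♯7) b'
  exact Diagram.eq_swap w ((♯0 ⊠ ♯1) ⊠ (♯2 ⊠ ♯3)) [1, 2]

theorem tensorHom_id_splitHom (X : IntP C) {A B : IntP C} (a : A.pos ⟶ B.pos)
    (b : B.neg ⟶ A.neg) : tensorHom (idHom X) (splitHom a b) =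
      splitHom (A := tensorObj X A) (B := tensorObj X B) (X.pos ◁ a) (b ▷ X.neg) := by
  rw [idHom_eq_splitHom, tensorHom_splitHom, id_tensorHom, tensorHom_id]

theorem tensorHom_splitHom_id (X : IntP C) {A B : IntP C} (a : A.pos ⟶ B.pos)
    (b : B.neg ⟶ A.neg) : tensorHom (splitHom a b) (idHom X) =
      splitHom (A := tensorObj A X) (B := tensorObj B X) (a ▷ X.pos) (X.neg ◁ b) := by
  rw [idHom_eq_splitHom, tensorHom_splitHom, id_tensorHom, tensorHom_id]

/-! ### The tensor product of the completion -/

/-- The functor `X ⊗ -` on the completion. -/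
def leftFunctor (X : IntP C) : Completion C ⥤ Completion C :=
  CategoryTheory.Quotient.lift (sim C)
    { obj A := of (tensorObj X A)
      map p := cls ((tensorLeft X).mapPath p)
      map_id _ := rfl
      map_comp p q := by
        refine (congrArg cls ((tensorLeft X).mapPath_comp p q)).trans ?_
        exact (CategoryTheory.Quotient.functor (sim C)).map_comp (X := tensorObj X _) (Y := tensorObj X _)
          (Z := tensorObj X _) _ _ }
    fun _ _ _ _ h => cls_eq_iff.2 (isCongruence_sim.tensorLeft X h)

/-- The functor `- ⊗ X` on the completion. -/
def rightFunctor (X : IntP C) : Completion C ⥤ Completion C :=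
  CategoryTheory.Quotient.lift (sim C)
    { obj A := of (tensorObj A X)
      map p := cls ((tensorRight X).mapPath p)
      map_id _ := rfl
      map_comp p q := by
        refine (congrArg cls ((tensorRight X).mapPath_comp p q)).trans ?_
        exact (CategoryTheory.Quotient.functor (sim C)).map_comp (X := tensorObj _ X) (Y := tensorObj _ X)
          (Z := tensorObj _ X) _ _ }
    fun _ _ _ _ h => cls_eq_iff.2 (isCongruence_sim.tensorRight X h)

/-- The tensor product of an object with a morphism. -/
def homLeft (X : IntP C) {A B : IntP C} (f : of A ⟶ of B) :
    of (tensorObj X A) ⟶ of (tensorObj X B) := (leftFunctor X).map f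

/-- The tensor product of a morphism with an object. -/
def homRight {A B : IntP C} (f : of A ⟶ of B) (X : IntP C) :
    of (tensorObj A X) ⟶ of (tensorObj B X) := (rightFunctor X).map f

theorem homLeft_comp (X : IntP C) {A B D : IntP C} (f : of A ⟶ of B) (g : of B ⟶ of D) :
    homLeft X (f ≫ g) = homLeft X f ≫ homLeft X g := (leftFunctor X).map_comp f g

theorem homRight_comp (X : IntP C) {A B D : IntP C} (f : of A ⟶ of B) (g : of B ⟶ of D) :
    homRight (f ≫ g) X = homRight f X ≫ homRight g X := (rightFunctor X).map_comp f g

theorem homLeft_id (X A : IntP C) : homLeft X (𝟙 (of A)) = 𝟙 _ := (leftFunctor X).map_id _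

theorem homRight_id (X A : IntP C) : homRight (𝟙 (of A)) X = 𝟙 _ := (rightFunctor X).map_id _

/-- With `g` placed before the loops through `B⁻` and `A'⁻` and `f` after them, the loops are bent
wires, so the composite is always defined. The other order of the two factors has the same value by
`tensorHom_isComp'`, which gives interchange. -/
theorem tensorHom_isComp {A A' B B' : IntP C} (f : A ⟶ A') (g : B ⟶ B') :
    IsComp (tensorHom f (idHom B)) (tensorHom (idHom A') g) (tensorHom f g) := by
  refine FormalTrace.mem_tr_of_yank (X := A.pos ⊗ B'.pos) (U := B.neg ⊗ A'.neg)
    ((α_ _ _ _).hom ≫ A.pos ◁ ((α_ _ _ _).inv ≫ g.hom ▷ A'.neg ≫ (α_ _ _ _).hom) ≫ (α_ _ _ _).inv)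
    ((α_ _ _ _).hom ≫ A.pos ◁ (B'.pos ◁ (β_ _ _).hom ≫ (α_ _ _ _).inv ≫ (β_ _ _).hom ▷ B.neg ≫
      (α_ _ _ _).hom) ≫ (α_ _ _ _).inv ≫ f.hom ▷ (B'.pos ⊗ B.neg) ≫ (α_ _ _ _).hom ≫
      A'.pos ◁ (β_ _ _).hom ≫ A'.pos ◁ (α_ _ _ _).hom ≫ (α_ _ _ _).inv) ?_ ?_
  · dsimp only [tensorHom, tensorObj]
    let w : List C := [A.pos, B.pos, B'.neg, A'.neg, A'.pos, A.neg, B'.pos, B.neg]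
    have := Diagram.box w (♯0 ⊠ ♯3) (♯4 ⊠ ♯5) f.hom
    have := Diagram.box w (♯1 ⊠ ♯2) (♯6 ⊠ ♯7) g.hom
    exact Diagram.eq_swap w ((♯0 ⊠ ♯1) ⊠ (♯2 ⊠ ♯3)) [0]
  · dsimp only [rightOut]
    rw [tensorHom_id_left, tensorHom_id_right]
    dsimp only [rightIn, tensorLeftIn, tensorLeftOut, tensorRightIn, tensorRightOut, tensorObj]
    let w : List C := [A.pos, B.pos, B'.neg, A'.neg, B.neg, A'.neg, A'.pos, A.neg, B'.pos, B.neg]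
    have := Diagram.box w (♯0 ⊠ ♯5) (♯6 ⊠ ♯7) f.hom
    have := Diagram.box w (♯1 ⊠ ♯2) (♯8 ⊠ ♯9) g.hom
    exact Diagram.eq_swap w (((♯0 ⊠ ♯1) ⊠ (♯2 ⊠ ♯3)) ⊠ (♯4 ⊠ ♯5)) [0]

theorem tensorHom_isComp' {A A' B B' : IntP C} (f : A ⟶ A') (g : B ⟶ B') :
    IsComp (tensorHom (idHom A) g) (tensorHom f (idHom B')) (tensorHom f g) := by
  refine FormalTrace.mem_tr_of_yank (X := A'.pos ⊗ B.pos) (U := B'.neg ⊗ A.neg)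
    ((α_ _ _ _).hom ≫ A.pos ◁ ((α_ _ _ _).inv ≫ (β_ _ _).hom) ≫ (α_ _ _ _).inv ≫
      f.hom ▷ (B.pos ⊗ B'.neg) ≫ (α_ _ _ _).hom ≫ A'.pos ◁ (β_ _ _).hom ≫
      A'.pos ◁ (α_ _ _ _).hom ≫ (α_ _ _ _).inv)
    ((α_ _ _ _).hom ≫ A'.pos ◁ ((α_ _ _ _).inv ≫ g.hom ▷ A.neg ≫ (α_ _ _ _).hom) ≫ (α_ _ _ _).inv)
    ?_ ?_
  · dsimp only [tensorHom, tensorObj]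
    let w : List C := [A.pos, B.pos, B'.neg, A'.neg, A'.pos, A.neg, B'.pos, B.neg]
    have := Diagram.box w (♯0 ⊠ ♯3) (♯4 ⊠ ♯5) f.hom
    have := Diagram.box w (♯1 ⊠ ♯2) (♯6 ⊠ ♯7) g.hom
    exact Diagram.eq w ((♯0 ⊠ ♯1) ⊠ (♯2 ⊠ ♯3))
  · dsimp only [rightOut]
    rw [tensorHom_id_left, tensorHom_id_right]
    dsimp only [rightIn, tensorLeftIn, tensorLeftOut, tensorRightIn, tensorRightOut, tensorObj]
    let w : List C := [A.pos, B.pos, B'.neg, A'.neg, B'.neg, A.neg, A'.pos, A.neg, B'.pos, B.neg]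
    have := Diagram.box w (♯0 ⊠ ♯3) (♯6 ⊠ ♯7) f.hom
    have := Diagram.box w (♯1 ⊠ ♯4) (♯8 ⊠ ♯9) g.hom
    exact Diagram.eq_swap w (((♯0 ⊠ ♯1) ⊠ (♯2 ⊠ ♯3)) ⊠ (♯4 ⊠ ♯5)) [0]

/-- Reduced to arrows in one variable after the other; for arrows both sides are the class of
`tensorHom f g`. -/
theorem hom_exchange {A A' B B' : IntP C} (f : of A ⟶ of A') (g : of B ⟶ of B') :
    homRight f B ≫ homLeft A' g = homLeft A g ≫ homRight f B' :=
  naturality_of_ofHom (L := rightFunctor B) (R := rightFunctor B') (fun A => homLeft A g)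
    (fun {A A'} f => (naturality_of_ofHom (L := leftFunctor A) (R := leftFunctor A')
      (fun B => ofHom (tensorHom f (idHom B)))
      (fun g => (ofHom_comp_ofHom_eq_iff.2 (tensorHom_isComp' f g)).trans
        (ofHom_comp_ofHom_eq_iff.2 (tensorHom_isComp f g)).symm) g).symm) f

/-! ### Structural isomorphisms of the completion -/

theorem assocHom_eq (A B D : IntP C) :
    assocHom A B D = splitHom (A := tensorObj (tensorObj A B) D) (B := tensorObj A (tensorObj B D))
      (α_ A.pos B.pos D.pos).hom (α_ D.neg B.neg A.neg).hom := rfl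

theorem leftUnitHom_eq (A : IntP C) :
    leftUnitHom A = splitHom (A := tensorObj (unit C) A) (B := A)
      (λ_ A.pos).hom (ρ_ A.neg).inv := rfl

theorem rightUnitHom_eq (A : IntP C) :
    rightUnitHom A = splitHom (A := tensorObj A (unit C)) (B := A)
      (ρ_ A.pos).hom (λ_ A.neg).inv := rfl

theorem braidHom_eq (A B : IntP C) :
    braidHom A B = splitHom (A := tensorObj A B) (B := tensorObj B A)
      (β_ A.pos B.pos).hom (β_ A.neg B.neg).hom := rfl

theorem ofHom_assoc_left {A A' : IntP C} (f : A ⟶ A') (B D : IntP C) :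
    ofHom (tensorHom (tensorHom f (idHom B)) (idHom D)) ≫ ofHom (assocHom A' B D) =
      ofHom (assocHom A B D) ≫ ofHom (tensorHom f (idHom (tensorObj B D))) := by
  rw [assocHom_eq, assocHom_eq]
  refine ofHom_comp_split_eq _ _ _ _ _ _ ?_
  rw [tensorHom_id_right, tensorHom_id_right, tensorHom_id_right]
  dsimp only [tensorRightIn, tensorRightOut, tensorObj]
  let w : List C := [A.pos, B.pos, D.pos, D.neg, B.neg, A'.neg, A'.pos, A.neg]
  have := Diagram.box w (♯0 ⊠ ♯5) (♯6 ⊠ ♯7) f.hom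
  exact Diagram.eq w (((♯0 ⊠ ♯1) ⊠ ♯2) ⊠ ((♯3 ⊠ ♯4) ⊠ ♯5))

theorem ofHom_assoc_middle (A : IntP C) {B B' : IntP C} (f : B ⟶ B') (D : IntP C) :
    ofHom (tensorHom (tensorHom (idHom A) f) (idHom D)) ≫ ofHom (assocHom A B' D) =
      ofHom (assocHom A B D) ≫ ofHom (tensorHom (idHom A) (tensorHom f (idHom D))) := by
  rw [assocHom_eq, assocHom_eq]
  refine ofHom_comp_split_eq _ _ _ _ _ _ ?_
  rw [tensorHom_id_right, tensorHom_id_left, tensorHom_id_left, tensorHom_id_right]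
  dsimp only [tensorRightIn, tensorRightOut, tensorLeftIn, tensorLeftOut, tensorObj]
  let w : List C := [A.pos, B.pos, D.pos, D.neg, B'.neg, A.neg, B'.pos, B.neg]
  have := Diagram.box w (♯1 ⊠ ♯4) (♯6 ⊠ ♯7) f.hom
  exact Diagram.eq w (((♯0 ⊠ ♯1) ⊠ ♯2) ⊠ ((♯3 ⊠ ♯4) ⊠ ♯5))

theorem ofHom_assoc_right (A B : IntP C) {D D' : IntP C} (f : D ⟶ D') :
    ofHom (tensorHom (idHom (tensorObj A B)) f) ≫ ofHom (assocHom A B D') =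
      ofHom (assocHom A B D) ≫ ofHom (tensorHom (idHom A) (tensorHom (idHom B) f)) := by
  rw [assocHom_eq, assocHom_eq]
  refine ofHom_comp_split_eq _ _ _ _ _ _ ?_
  rw [tensorHom_id_left, tensorHom_id_left, tensorHom_id_left]
  dsimp only [tensorLeftIn, tensorLeftOut, tensorObj]
  let w : List C := [A.pos, B.pos, D.pos, D'.neg, B.neg, A.neg, D'.pos, D.neg]
  have := Diagram.box w (♯2 ⊠ ♯3) (♯6 ⊠ ♯7) f.hom
  exact Diagram.eq w (((♯0 ⊠ ♯1) ⊠ ♯2) ⊠ ((♯3 ⊠ ♯4) ⊠ ♯5))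

theorem ofHom_leftUnit {A B : IntP C} (f : A ⟶ B) :
    ofHom (tensorHom (idHom (unit C)) f) ≫ ofHom (leftUnitHom B) = ofHom (leftUnitHom A) ≫ ofHom f := by
  rw [leftUnitHom_eq, leftUnitHom_eq]
  refine ofHom_comp_split_eq _ _ _ _ _ _ ?_
  rw [tensorHom_id_left]
  dsimp only [tensorLeftIn, tensorLeftOut, tensorObj, unit]
  let w : List C := [A.pos, B.neg, B.pos, A.neg]
  have := Diagram.box w (♯0 ⊠ ♯1) (♯2 ⊠ ♯3) f.hom
  exact Diagram.eq w ((.one ⊠ ♯0) ⊠ ♯1)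

theorem ofHom_rightUnit {A B : IntP C} (f : A ⟶ B) :
    ofHom (tensorHom f (idHom (unit C))) ≫ ofHom (rightUnitHom B) = ofHom (rightUnitHom A) ≫ ofHom f := by
  rw [rightUnitHom_eq, rightUnitHom_eq]
  refine ofHom_comp_split_eq _ _ _ _ _ _ ?_
  rw [tensorHom_id_right]
  dsimp only [tensorRightIn, tensorRightOut, tensorObj, unit]
  let w : List C := [A.pos, B.neg, B.pos, A.neg]
  have := Diagram.box w (♯0 ⊠ ♯1) (♯2 ⊠ ♯3) f.hom
  exact Diagram.eq w ((♯0 ⊠ .one) ⊠ ♯1)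

theorem ofHom_braid_left {A A' : IntP C} (f : A ⟶ A') (B : IntP C) :
    ofHom (tensorHom f (idHom B)) ≫ ofHom (braidHom A' B) =
      ofHom (braidHom A B) ≫ ofHom (tensorHom (idHom B) f) := by
  rw [braidHom_eq, braidHom_eq]
  refine ofHom_comp_split_eq _ _ _ _ _ _ ?_
  rw [tensorHom_id_left, tensorHom_id_right]
  dsimp only [tensorRightIn, tensorRightOut, tensorLeftIn, tensorLeftOut, tensorObj]
  let w : List C := [A.pos, B.pos, A'.neg, B.neg, A'.pos, A.neg]
  have := Diagram.box w (♯0 ⊠ ♯2) (♯4 ⊠ ♯5) f.hom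
  exact Diagram.eq w ((♯0 ⊠ ♯1) ⊠ (♯2 ⊠ ♯3))

theorem ofHom_braid_right (A : IntP C) {B B' : IntP C} (f : B ⟶ B') :
    ofHom (tensorHom (idHom A) f) ≫ ofHom (braidHom A B') =
      ofHom (braidHom A B) ≫ ofHom (tensorHom f (idHom A)) := by
  rw [braidHom_eq, braidHom_eq]
  refine ofHom_comp_split_eq _ _ _ _ _ _ ?_
  rw [tensorHom_id_left, tensorHom_id_right]
  dsimp only [tensorRightIn, tensorRightOut, tensorLeftIn, tensorLeftOut, tensorObj]
  let w : List C := [A.pos, B.pos, A.neg, B'.neg, B'.pos, B.neg]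
  have := Diagram.box w (♯1 ⊠ ♯3) (♯4 ⊠ ♯5) f.hom
  exact Diagram.eq w ((♯0 ⊠ ♯1) ⊠ (♯2 ⊠ ♯3))

/-! ### Split arrows as pairs of morphisms, and the triangle identities. -/

/-- An arrow that acts separately on the positive and on the negative wires. -/
@[ext]
structure Split (A B : IntP C) where
  pos : A.pos ⟶ B.pos
  neg : B.neg ⟶ A.neg

namespace Split

/-- The identity. -/
def id (A : IntP C) : Split A A := ⟨𝟙 _, 𝟙 _⟩

/-- Composition. -/
def comp {A B D : IntP C} (s : Split A B) (t : Split B D) : Split A D :=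
  ⟨s.pos ≫ t.pos, t.neg ≫ s.neg⟩

/-- Tensor product with an object on the left. -/
def left (X : IntP C) {A B : IntP C} (s : Split A B) : Split (tensorObj X A) (tensorObj X B) :=
  ⟨X.pos ◁ s.pos, s.neg ▷ X.neg⟩

/-- Tensor product with an object on the right. -/
def right {A B : IntP C} (s : Split A B) (X : IntP C) : Split (tensorObj A X) (tensorObj B X) :=
  ⟨s.pos ▷ X.pos, X.neg ◁ s.neg⟩

/-- The associator. -/
def assoc (A B D : IntP C) : Split (tensorObj (tensorObj A B) D) (tensorObj A (tensorObj B D)) :=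
  ⟨(α_ A.pos B.pos D.pos).hom, (α_ D.neg B.neg A.neg).hom⟩

/-- The inverse associator. -/
def assocInv (A B D : IntP C) : Split (tensorObj A (tensorObj B D)) (tensorObj (tensorObj A B) D) :=
  ⟨(α_ A.pos B.pos D.pos).inv, (α_ D.neg B.neg A.neg).inv⟩

/-- The left unitor. -/
def leftUnit (A : IntP C) : Split (tensorObj (unit C) A) A := ⟨(λ_ A.pos).hom, (ρ_ A.neg).inv⟩

/-- The inverse left unitor. -/
def leftUnitInv (A : IntP C) : Split A (tensorObj (unit C) A) := ⟨(λ_ A.pos).inv, (ρ_ A.neg).hom⟩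

/-- The right unitor. -/
def rightUnit (A : IntP C) : Split (tensorObj A (unit C)) A := ⟨(ρ_ A.pos).hom, (λ_ A.neg).inv⟩

/-- The inverse right unitor. -/
def rightUnitInv (A : IntP C) : Split A (tensorObj A (unit C)) := ⟨(ρ_ A.pos).inv, (λ_ A.neg).hom⟩

/-- The symmetry. -/
def braid (A B : IntP C) : Split (tensorObj A B) (tensorObj B A) :=
  ⟨(β_ A.pos B.pos).hom, (β_ A.neg B.neg).hom⟩

end Split

/-- The class of a split arrow in the completion. -/
def ofSplit {A B : IntP C} (s : Split A B) : of A ⟶ of B := ofHom (splitHom s.pos s.neg)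

theorem ofSplit_id (A : IntP C) : ofSplit (.id A) = 𝟙 (of A) := ofHom_split_id A

/-- Split arrows compose like morphisms of `C × Cᵒᵖ`, so a coherence equation falls into a positive
and a negative equation in `C`. -/
theorem ofSplit_comp {A B D : IntP C} (s : Split A B) (t : Split B D) :
    ofSplit s ≫ ofSplit t = ofSplit (s.comp t) := split_comp_split _ _ _ _

theorem ofHom_comp_ofSplit {A B D : IntP C} (f : A ⟶ B) (s : Split B D) :
    ofHom f ≫ ofSplit s = ofHom (Hom.mk (A.pos ◁ s.neg ≫ f.hom ≫ s.pos ▷ A.neg)) :=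
  ofHom_comp_split _ _ _

theorem homLeft_ofSplit (X : IntP C) {A B : IntP C} (s : Split A B) :
    homLeft X (ofSplit s) = ofSplit (s.left X) :=
  congrArg ofHom (tensorHom_id_splitHom X s.pos s.neg)

theorem homRight_ofSplit {A B : IntP C} (s : Split A B) (X : IntP C) :
    homRight (ofSplit s) X = ofSplit (s.right X) :=
  congrArg ofHom (tensorHom_splitHom_id X s.pos s.neg)

theorem ofHom_assocHom (A B D : IntP C) : ofHom (assocHom A B D) = ofSplit (.assoc A B D) := rfl

theorem ofHom_leftUnitHom (A : IntP C) : ofHom (leftUnitHom A) = ofSplit (.leftUnit A) := rfl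

theorem ofHom_rightUnitHom (A : IntP C) : ofHom (rightUnitHom A) = ofSplit (.rightUnit A) := rfl

theorem ofHom_braidHom (A B : IntP C) : ofHom (braidHom A B) = ofSplit (.braid A B) := rfl

/-- The composite is traced over three wires. Yanking `V = A⁺ ⊗ A⁻` leaves `t` with a single loop
`A⁻`, which is yanked in turn. -/
theorem ofHom_zigzag (A : IntP C) :
    ofHom (tensorHom (idHom A) (etaHom A)) ≫ ofSplit (.assocInv A A.dual A) ≫
      ofHom (tensorHom (epsHom A) (idHom A)) =
    ofHom (rightUnitHom A) ≫ ofSplit (.leftUnitInv A) := by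
  rw [ofHom_rightUnitHom, ofSplit_comp, ← Category.assoc, ofHom_comp_ofSplit]
  refine ofHom_comp_ofHom_eq_iff.2 ?_
  let t : ((A.pos ⊗ 𝟙_ C) ⊗ (A.neg ⊗ 𝟙_ C)) ⊗ A.neg ⟶ ((𝟙_ C ⊗ A.pos) ⊗ (𝟙_ C ⊗ A.neg)) ⊗ A.neg :=
    ((ρ_ A.pos).hom ⊗ₘ (ρ_ A.neg).hom) ▷ A.neg ≫
      ((α_ A.pos A.neg A.neg).hom ≫ A.pos ◁ (β_ A.neg A.neg).hom ≫ (α_ A.pos A.neg A.neg).inv) ≫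
      ((λ_ A.pos).inv ⊗ₘ (λ_ A.neg).inv) ▷ A.neg
  refine FormalTrace.mem_tr_of_equiv (G := ⟨A.neg, t⟩) (.of_yank (V := A.pos ⊗ A.neg) (Y := A.neg)
    (β_ A.neg (A.pos ⊗ A.neg) ≪≫ whiskerRightIso (β_ A.pos A.neg) A.neg ≪≫ α_ A.neg A.pos A.neg)
    (whiskerRightIso (ρ_ A.pos ⊗ᵢ ρ_ A.neg) A.neg ≪≫ β_ (A.pos ⊗ A.neg) A.neg) ?_) ?_
  · rw [tensorHom_id_left, rightOut, tensorHom_id_right]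
    dsimp only [t, rightIn, tensorLeftIn, tensorLeftOut, tensorRightIn, tensorRightOut, etaHom,
      epsHom, tensorObj, dual, unit, Split.assocInv, Iso.trans_hom,
      Iso.trans_inv, Iso.symm_hom, Iso.symm_inv, whiskerLeftIso, whiskerRightIso, tensorIso]
    exact Diagram.eq [A.pos, A.neg, A.neg, A.pos, A.neg]
      (((♯0 ⊠ .one) ⊠ (♯1 ⊠ .one)) ⊠ (♯2 ⊠ ♯3 ⊠ ♯4))
  · refine FormalTrace.mem_tr_of_yank _ _ ?_ rfl
    dsimp only [splitHom, Split.comp, Split.rightUnit, Split.leftUnitInv, tensorObj, unit]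
    exact Diagram.eq [A.pos, A.neg] ((♯0 ⊠ .one) ⊠ (♯1 ⊠ .one))

theorem ofHom_zigzag' (A : IntP C) :
    ofHom (tensorHom (etaHom A) (idHom A.dual)) ≫ ofHom (assocHom A.dual A A.dual) ≫
      ofHom (tensorHom (idHom A.dual) (epsHom A)) =
    ofHom (leftUnitHom A.dual) ≫ ofSplit (.rightUnitInv A.dual) := by
  rw [ofHom_leftUnitHom, ofSplit_comp, ofHom_assocHom, ← Category.assoc, ofHom_comp_ofSplit]
  refine ofHom_comp_ofHom_eq_iff.2 ?_
  let t : ((𝟙_ C ⊗ A.neg) ⊗ (𝟙_ C ⊗ A.pos)) ⊗ A.pos ⟶ ((A.neg ⊗ 𝟙_ C) ⊗ (A.pos ⊗ 𝟙_ C)) ⊗ A.pos :=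
    ((λ_ A.neg).hom ⊗ₘ (λ_ A.pos).hom) ▷ A.pos ≫
      ((α_ A.neg A.pos A.pos).hom ≫ A.neg ◁ (β_ A.pos A.pos).hom ≫ (α_ A.neg A.pos A.pos).inv) ≫
      ((ρ_ A.neg).inv ⊗ₘ (ρ_ A.pos).inv) ▷ A.pos
  refine FormalTrace.mem_tr_of_equiv (G := ⟨A.pos, t⟩) (.of_yank (V := A.neg ⊗ A.pos) (Y := A.pos)
    (α_ A.pos A.neg A.pos)
    (whiskerRightIso (λ_ A.neg ⊗ᵢ λ_ A.pos) A.pos ≪≫ β_ (A.neg ⊗ A.pos) A.pos) ?_) ?_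
  · rw [tensorHom_id_right, rightOut, tensorHom_id_left]
    dsimp only [t, rightIn, tensorLeftIn, tensorLeftOut, tensorRightIn, tensorRightOut, etaHom,
      epsHom, tensorObj, dual, unit, Split.assoc, Iso.trans_hom,
      Iso.trans_inv, Iso.symm_hom, Iso.symm_inv, whiskerLeftIso, whiskerRightIso, tensorIso]
    exact Diagram.eq [A.neg, A.pos, A.pos, A.neg, A.pos]
      (((.one ⊠ ♯0) ⊠ (.one ⊠ ♯1)) ⊠ ((♯2 ⊠ ♯3) ⊠ ♯4))
  · refine FormalTrace.mem_tr_of_yank _ _ ?_ rfl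
    dsimp only [splitHom, Split.comp, Split.leftUnit, Split.rightUnitInv, tensorObj, unit, dual]
    exact Diagram.eq [A.neg, A.pos] ((.one ⊠ ♯0) ⊠ (.one ⊠ ♯1))

/-! ### The compact closed structure of the completion -/

/-- The data of the monoidal structure of the completion. -/
scoped instance completionMonoidalStruct : MonoidalCategoryStruct (Completion C) where
  tensorObj X Y := of (tensorObj (base X) (base Y))
  whiskerLeft X {Y Z} f := homLeft (base X) (A := base Y) (B := base Z) f
  whiskerRight {Y Z} f X := homRight (A := base Y) (B := base Z) f (base X)
  tensorUnit := of (unit C)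
  associator X Y Z :=
    splitIso (A := tensorObj (tensorObj (base X) (base Y)) (base Z))
      (B := tensorObj (base X) (tensorObj (base Y) (base Z))) (α_ _ _ _) (α_ _ _ _)
  leftUnitor X :=
    splitIso (A := tensorObj (unit C) (base X)) (B := base X) (λ_ _) (ρ_ _).symm
  rightUnitor X :=
    splitIso (A := tensorObj (base X) (unit C)) (B := base X) (ρ_ _) (λ_ _).symm

theorem homRight_tensorObj {A A' : IntP C} (f : of A ⟶ of A') (B D : IntP C) :
    homRight (homRight f B) D ≫ ofHom (assocHom A' B D) =
      ofHom (assocHom A B D) ≫ homRight f (tensorObj B D) :=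
  naturality_of_ofHom (L := rightFunctor B ⋙ rightFunctor D) (R := rightFunctor (tensorObj B D))
    (fun A => ofHom (assocHom A B D)) (fun f => ofHom_assoc_left f B D) f

theorem homLeft_homRight (A : IntP C) {B B' : IntP C} (f : of B ⟶ of B') (D : IntP C) :
    homRight (homLeft A f) D ≫ ofHom (assocHom A B' D) =
      ofHom (assocHom A B D) ≫ homLeft A (homRight f D) :=
  naturality_of_ofHom (L := leftFunctor A ⋙ rightFunctor D) (R := rightFunctor D ⋙ leftFunctor A)
    (fun B => ofHom (assocHom A B D)) (fun f => ofHom_assoc_middle A f D) f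

theorem homLeft_tensorObj (A B : IntP C) {D D' : IntP C} (f : of D ⟶ of D') :
    homLeft (tensorObj A B) f ≫ ofHom (assocHom A B D') =
      ofHom (assocHom A B D) ≫ homLeft A (homLeft B f) :=
  naturality_of_ofHom (L := leftFunctor (tensorObj A B)) (R := leftFunctor B ⋙ leftFunctor A)
    (fun D => ofHom (assocHom A B D)) (fun f => ofHom_assoc_right A B f) f

theorem homLeft_unit {A B : IntP C} (f : of A ⟶ of B) :
    homLeft (unit C) f ≫ ofHom (leftUnitHom B) = ofHom (leftUnitHom A) ≫ f :=
  naturality_of_ofHom (L := leftFunctor (unit C)) (R := 𝟭 _)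
    (fun A => ofHom (leftUnitHom A)) ofHom_leftUnit f

theorem homRight_unit {A B : IntP C} (f : of A ⟶ of B) :
    homRight f (unit C) ≫ ofHom (rightUnitHom B) = ofHom (rightUnitHom A) ≫ f :=
  naturality_of_ofHom (L := rightFunctor (unit C)) (R := 𝟭 _)
    (fun A => ofHom (rightUnitHom A)) ofHom_rightUnit f

theorem homRight_braid {A A' : IntP C} (f : of A ⟶ of A') (B : IntP C) :
    homRight f B ≫ ofHom (braidHom A' B) = ofHom (braidHom A B) ≫ homLeft B f :=
  naturality_of_ofHom (L := rightFunctor B) (R := leftFunctor B)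
    (fun A => ofHom (braidHom A B)) (fun f => ofHom_braid_left f B) f

theorem homLeft_braid (A : IntP C) {B B' : IntP C} (f : of B ⟶ of B') :
    homLeft A f ≫ ofHom (braidHom A B') = ofHom (braidHom A B) ≫ homRight f A :=
  naturality_of_ofHom (L := leftFunctor A) (R := rightFunctor A)
    (fun B => ofHom (braidHom A B)) (fun f => ofHom_braid_right A f) f

theorem tensorHom_interchange {A B D A' B' D' : IntP C} (f : of A ⟶ of B) (f' : of A' ⟶ of B')
    (g : of B ⟶ of D) (g' : of B' ⟶ of D') :
    (homRight f A' ≫ homLeft B f') ≫ homRight g B' ≫ homLeft D g' =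
      homRight (f ≫ g) A' ≫ homLeft D (f' ≫ g') := by
  rw [homRight_comp, homLeft_comp, Category.assoc, Category.assoc, ← Category.assoc (homLeft B f'),
    ← hom_exchange, Category.assoc]

theorem tensorHom_assoc {A B D A' B' D' : IntP C} (f : of A ⟶ of A') (g : of B ⟶ of B')
    (h : of D ⟶ of D') :
    (homRight (homRight f B ≫ homLeft A' g) D ≫ homLeft (tensorObj A' B') h) ≫
        ofHom (assocHom A' B' D') =
      ofHom (assocHom A B D) ≫ homRight f (tensorObj B D) ≫
        homLeft A' (homRight g D ≫ homLeft B' h) := by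
  rw [homRight_comp, Category.assoc, homLeft_tensorObj, Category.assoc,
    ← Category.assoc (homRight (homLeft A' g) D), homLeft_homRight, ← Category.assoc,
    ← Category.assoc, ← Category.assoc, homRight_tensorObj, homLeft_comp]
  simp only [Category.assoc]

theorem ofHom_pentagon (A B D E : IntP C) :
    homRight (ofHom (assocHom A B D)) E ≫ ofHom (assocHom A (tensorObj B D) E) ≫
        homLeft A (ofHom (assocHom B D E)) =
      ofHom (assocHom (tensorObj A B) D E) ≫ ofHom (assocHom A B (tensorObj D E)) := by
  simp only [ofHom_assocHom, homLeft_ofSplit,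
    homRight_ofSplit, ofSplit_comp]
  refine congrArg ofSplit (Split.ext ?_ ?_)
  · exact pentagon _ _ _ _
  -- Negative parts are tensored in reverse order and point backwards, so this half is not the
  -- pentagon verbatim but follows from coherence.
  · dsimp only [Split.comp, Split.left, Split.right, Split.assoc, Split.assocInv, Split.braid,
      tensorObj]
    exact Diagram.eq [E.neg, D.neg, B.neg, A.neg] (((♯0 ⊠ ♯1) ⊠ ♯2) ⊠ ♯3)

theorem ofHom_triangle (A B : IntP C) :
    ofHom (assocHom A (unit C) B) ≫ homLeft A (ofHom (leftUnitHom B)) =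
      homRight (ofHom (rightUnitHom A)) B := by
  simp only [ofHom_assocHom, ofHom_leftUnitHom, ofHom_rightUnitHom,
    homLeft_ofSplit, homRight_ofSplit, ofSplit_comp]
  refine congrArg ofSplit (Split.ext ?_ ?_)
  · exact triangle _ _
  · dsimp only [Split.comp, Split.left, Split.right, Split.assoc, Split.leftUnit, Split.rightUnit,
      tensorObj, unit]
    exact Diagram.eq [B.neg, A.neg] (♯0 ⊠ ♯1)

/-- The monoidal structure of the completion. -/
scoped instance completionMonoidal : MonoidalCategory (Completion C) where
  tensorHom_def _ _ := rfl
  id_tensorHom_id X Y := by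
    refine (congrArg₂ (· ≫ ·) (homRight_id (base Y) (base X)) (homLeft_id (base X) (base Y))).trans ?_
    exact Category.comp_id _
  tensorHom_comp_tensorHom {X Y Z X' Y' Z'} f f' g g' :=
    tensorHom_interchange (A := base X) (B := base Y) (D := base Z) (A' := base X') (B' := base Y')
      (D' := base Z') f f' g g'
  whiskerLeft_id X Y := homLeft_id (base X) (base Y)
  id_whiskerRight X Y := homRight_id (base Y) (base X)
  associator_naturality {X Y Z X' Y' Z'} f g h :=
    tensorHom_assoc (A := base X) (B := base Y) (D := base Z) (A' := base X') (B' := base Y')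
      (D' := base Z') f g h
  leftUnitor_naturality {X Y} f := homLeft_unit (A := base X) (B := base Y) f
  rightUnitor_naturality {X Y} f := homRight_unit (A := base X) (B := base Y) f
  pentagon W X Y Z := ofHom_pentagon (base W) (base X) (base Y) (base Z)
  triangle X Y := ofHom_triangle (base X) (base Y)

theorem ofHom_hexagon (A B D : IntP C) :
    ofHom (assocHom A B D) ≫ ofHom (braidHom A (tensorObj B D)) ≫ ofHom (assocHom B D A) =
      homRight (ofHom (braidHom A B)) D ≫ ofHom (assocHom B A D) ≫
        homLeft B (ofHom (braidHom A D)) := by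
  simp only [ofHom_assocHom, ofHom_braidHom,
    homLeft_ofSplit, homRight_ofSplit, ofSplit_comp]
  refine congrArg ofSplit (Split.ext ?_ ?_)
  · exact BraidedCategory.hexagon_forward _ _ _
  · dsimp only [Split.comp, Split.left, Split.right, Split.assoc, Split.assocInv, Split.braid,
      tensorObj]
    exact Diagram.eq [A.neg, D.neg, B.neg] ((♯0 ⊠ ♯1) ⊠ ♯2)

theorem ofHom_hexagon' (A B D : IntP C) :
    ofSplit (.assocInv A B D) ≫ ofHom (braidHom (tensorObj A B) D) ≫ ofSplit (.assocInv D A B) =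
      homLeft A (ofHom (braidHom B D)) ≫ ofSplit (.assocInv A D B) ≫
        homRight (ofHom (braidHom A D)) B := by
  simp only [ofHom_braidHom,
    homLeft_ofSplit, homRight_ofSplit, ofSplit_comp]
  refine congrArg ofSplit (Split.ext ?_ ?_)
  · exact BraidedCategory.hexagon_reverse _ _ _
  · dsimp only [Split.comp, Split.left, Split.right, Split.assoc, Split.assocInv, Split.braid,
      tensorObj]
    exact Diagram.eq [B.neg, A.neg, D.neg] (♯0 ⊠ ♯1 ⊠ ♯2)

theorem ofHom_braid_braid (A B : IntP C) :
    ofHom (braidHom A B) ≫ ofHom (braidHom B A) = 𝟙 _ := by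
  simp only [ofHom_braidHom, ofSplit_comp]
  refine (congrArg ofSplit (Split.ext ?_ ?_)).trans (ofSplit_id _)
  · exact SymmetricCategory.symmetry _ _
  · exact SymmetricCategory.symmetry _ _

/-- The symmetry of the completion. -/
def braidIso (A B : IntP C) : of (tensorObj A B) ≅ of (tensorObj B A) where
  hom := ofHom (braidHom A B)
  inv := ofHom (braidHom B A)
  hom_inv_id := ofHom_braid_braid A B
  inv_hom_id := ofHom_braid_braid B A

/-- The symmetric structure of the completion. -/
scoped instance completionSymmetric : SymmetricCategory (Completion C) where
  braiding X Y := braidIso (base X) (base Y)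
  braiding_naturality_right X {Y Z} f := homLeft_braid (base X) (B := base Y) (B' := base Z) f
  braiding_naturality_left {X Y} f Z := homRight_braid (A := base X) (A' := base Y) f (base Z)
  hexagon_forward X Y Z := ofHom_hexagon (base X) (base Y) (base Z)
  hexagon_reverse X Y Z := 
    ofHom_hexagon' (base X) (base Y) (base Z)
  symmetry X Y := ofHom_braid_braid (base X) (base Y)

/-- The compact closed structure of the completion. -/
scoped instance completionLeftRigid : LeftRigidCategory (Completion C) where
  leftDual X :=
    { leftDual := of (base X).dual
      exact :=
        { coevaluation' := ofHom (etaHom (base X))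
          evaluation' := ofHom (epsHom (base X))
          coevaluation_evaluation' := ofHom_zigzag (base X)
          evaluation_coevaluation' := ofHom_zigzag' (base X) } }

theorem eq_eqToHom_comp {D : Type*} [Category D] {X Y : D} (f : X ⟶ Y) : f = eqToHom rfl ≫ f := by
  simp

theorem eq_eqToHom_comp_comp {D : Type*} [Category D] {X Y : D} (f : X ⟶ Y) :
    f = eqToHom rfl ≫ f ≫ eqToHom rfl := by
  simp

theorem isInducedStructure : IsInducedStructure C where
  tensorObj_eq _ _ := rfl
  unit_eq := rfl
  -- In the completion `f ⊗ₘ g` is by default `f ▷ _ ≫ _ ◁ g`.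
  tensorHom_eq f g := (ofHom_comp_ofHom_eq_iff.2 (tensorHom_isComp f g)).trans
    (eq_eqToHom_comp_comp (ofHom (tensorHom f g)))
  associator_eq A B D := eq_eqToHom_comp_comp (ofHom (assocHom A B D))
  leftUnitor_eq A := eq_eqToHom_comp (ofHom (leftUnitHom A))
  rightUnitor_eq A := eq_eqToHom_comp (ofHom (rightUnitHom A))
  braiding_eq A B := eq_eqToHom_comp_comp (ofHom (braidHom A B))
  dual_eq _ := rfl
  eta_eq A := eq_eqToHom_comp_comp (ofHom (etaHom A))
  eps_eq A := eq_eqToHom_comp_comp (ofHom (epsHom A))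

end IntP

/-! ### The embedding into the completion -/

namespace IntP

open PartialTrace

variable {C : Type u} [Category.{v} C] [MonoidalCategory C] [SymmetricCategory C] [PartialTrace C]

namespace Split

/-- The embedding of a morphism. -/
def emb {A B : C} (f : A ⟶ B) : Split ((embed C).obj A) ((embed C).obj B) := ⟨f, 𝟙 (𝟙_ C)⟩

/-- The comparison arrow for the tensor product. -/
def mu (A B : C) :
    Split (tensorObj ((embed C).obj A) ((embed C).obj B)) ((embed C).obj (A ⊗ B)) :=
  ⟨𝟙 (A ⊗ B), (λ_ (𝟙_ C)).inv⟩

/-- The inverse comparison arrow for the tensor product. -/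
def muInv (A B : C) :
    Split ((embed C).obj (A ⊗ B)) (tensorObj ((embed C).obj A) ((embed C).obj B)) :=
  ⟨𝟙 (A ⊗ B), (λ_ (𝟙_ C)).hom⟩

end Split

/-- Embedded morphisms are split arrows with trivial negative part, so the laws of the embedding
also reduce to equations in `C`. -/
theorem ofHom_embed_map {A B : C} (f : A ⟶ B) : ofHom ((embed C).map f) = ofSplit (.emb f) :=
  congrArg (fun k => ofHom (Hom.mk k)) (tensorHom_id f (𝟙_ C)).symm

theorem ofHom_embedMu (A B : C) : ofHom (embedMu A B) = ofSplit (.mu A B) :=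
  congrArg (fun k => ofHom (A := tensorObj ((embed C).obj A) ((embed C).obj B))
    (B := (embed C).obj (A ⊗ B)) (Hom.mk k)) (id_tensorHom (A ⊗ B) (λ_ (𝟙_ C)).inv).symm

variable (C) in
/-- The embedding of `C` into the completion. -/
def embedding : C ⥤ Completion C where
  obj A := of ((embed C).obj A)
  map f := ofHom ((embed C).map f)
  map_id A := by
    refine Eq.trans (congrArg (fun k => ofHom (Hom.mk k)) ?_) (ofHom_idHom ((embed C).obj A))
    exact id_whiskerRight _ _
  map_comp f g := by
    rw [ofHom_embed_map, ofHom_embed_map, ofHom_embed_map, ofSplit_comp]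
    exact congrArg ofSplit (Split.ext rfl (Category.comp_id _).symm)

/-- The comparison isomorphism for the tensor product. -/
def muIso (A B : C) :
    of (tensorObj ((embed C).obj A) ((embed C).obj B)) ≅ of ((embed C).obj (A ⊗ B)) where
  hom := ofHom (embedMu A B)
  inv := ofSplit (.muInv A B)
  hom_inv_id := by
    rw [ofHom_embedMu, ofSplit_comp, ← ofSplit_id]
    exact congrArg ofSplit (Split.ext (Category.comp_id _) (Iso.hom_inv_id _))
  inv_hom_id := by
    rw [ofHom_embedMu, ofSplit_comp, ← ofSplit_id]
    exact congrArg ofSplit (Split.ext (Category.comp_id _) (Iso.inv_hom_id _))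

theorem embedMu_natural_left {A B : C} (f : A ⟶ B) (X : C) :
    homRight (ofHom ((embed C).map f)) ((embed C).obj X) ≫ ofHom (embedMu B X) =
      ofHom (embedMu A X) ≫ ofHom ((embed C).map (f ▷ X)) := by
  simp only [ofHom_embed_map, ofHom_embedMu, homRight_ofSplit, ofSplit_comp]
  refine congrArg ofSplit (Split.ext ?_ ?_) <;>
    dsimp only [Split.comp, Split.right, Split.emb, Split.mu, embed, tensorObj] <;> simp

theorem embedMu_natural_right (X : C) {A B : C} (f : A ⟶ B) :
    homLeft ((embed C).obj X) (ofHom ((embed C).map f)) ≫ ofHom (embedMu X B) =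
      ofHom (embedMu X A) ≫ ofHom ((embed C).map (X ◁ f)) := by
  simp only [ofHom_embed_map, ofHom_embedMu, homLeft_ofSplit, ofSplit_comp]
  refine congrArg ofSplit (Split.ext ?_ ?_) <;>
    dsimp only [Split.comp, Split.left, Split.emb, Split.mu, embed, tensorObj] <;> simp

theorem embedMu_assoc (A B D : C) :
    homRight (ofHom (embedMu A B)) ((embed C).obj D) ≫ ofHom (embedMu (A ⊗ B) D) ≫
        ofHom ((embed C).map (α_ A B D).hom) =
      ofHom (assocHom ((embed C).obj A) ((embed C).obj B) ((embed C).obj D)) ≫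
        homLeft ((embed C).obj A) (ofHom (embedMu B D)) ≫ ofHom (embedMu A (B ⊗ D)) := by
  simp only [ofHom_embed_map, ofHom_embedMu, ofHom_assocHom, homLeft_ofSplit, homRight_ofSplit,
    ofSplit_comp]
  refine congrArg ofSplit (Split.ext ?_ ?_) <;>
    dsimp only [Split.comp, Split.left, Split.right, Split.assoc, Split.emb, Split.mu, embed,
      tensorObj]
  · exact Diagram.eq [A, B, D] ((♯0 ⊠ ♯1) ⊠ ♯2)
  · exact Diagram.eq ([] : List C) .one

theorem embedMu_leftUnit (A : C) :
    ofHom (leftUnitHom ((embed C).obj A)) =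
      ofHom (embedMu (𝟙_ C) A) ≫ ofHom ((embed C).map (λ_ A).hom) := by
  simp only [ofHom_embed_map, ofHom_embedMu, ofHom_leftUnitHom, ofSplit_comp]
  refine congrArg ofSplit (Split.ext ?_ ?_) <;>
    dsimp only [Split.comp, Split.leftUnit, Split.emb, Split.mu, embed, tensorObj]
  · exact Diagram.eq [A] (.one ⊠ ♯0)
  · exact Diagram.eq ([] : List C) .one

theorem embedMu_rightUnit (A : C) :
    ofHom (rightUnitHom ((embed C).obj A)) =
      ofHom (embedMu A (𝟙_ C)) ≫ ofHom ((embed C).map (ρ_ A).hom) := by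
  simp only [ofHom_embed_map, ofHom_embedMu, ofHom_rightUnitHom, ofSplit_comp]
  refine congrArg ofSplit (Split.ext ?_ ?_) <;>
    dsimp only [Split.comp, Split.rightUnit, Split.emb, Split.mu, embed, tensorObj]
  · exact Diagram.eq [A] (♯0 ⊠ .one)
  · exact Diagram.eq ([] : List C) .one

theorem embedMu_braid (A B : C) :
    ofHom (embedMu A B) ≫ ofHom ((embed C).map (β_ A B).hom) =
      ofHom (braidHom ((embed C).obj A) ((embed C).obj B)) ≫ ofHom (embedMu B A) := by
  simp only [ofHom_embed_map, ofHom_embedMu, ofHom_braidHom, ofSplit_comp]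
  refine congrArg ofSplit (Split.ext ?_ ?_) <;>
    dsimp only [Split.comp, Split.braid, Split.emb, Split.mu, embed, tensorObj]
  · exact Diagram.eq [A, B] (♯0 ⊠ ♯1)
  · exact Diagram.eq ([] : List C) .one

variable (C) in
/-- The embedding is strong monoidal. -/
def embeddingCoreMonoidal : (embedding C).CoreMonoidal where
  εIso := Iso.refl (of (unit C))
  μIso A B := muIso A B
  μIso_hom_natural_left f X := embedMu_natural_left f X
  μIso_hom_natural_right X f := embedMu_natural_right X f
  associativity A B D := embedMu_assoc A B D
  left_unitality A := by
    refine (embedMu_leftUnit A).trans ?_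
    refine (Category.id_comp _).symm.trans (congrArg (· ≫ _) ?_)
    exact (homRight_id ((embed C).obj A) (unit C)).symm
  right_unitality A := by
    refine (embedMu_rightUnit A).trans ?_
    refine (Category.id_comp _).symm.trans (congrArg (· ≫ _) ?_)
    exact (homLeft_id ((embed C).obj A) (unit C)).symm

/-- The embedding is a strong symmetric monoidal functor. -/
scoped instance embeddingBraided : (embedding C).Braided where
  toMonoidal := (embeddingCoreMonoidal C).toMonoidal
  braided A B := embedMu_braid A B

theorem embedding_faithful : (embedding C).Faithful where
  map_injective {A B} f g h := by
    have h' : f ▷ 𝟙_ C = g ▷ 𝟙_ C := congrArg Hom.hom (ofHom_injective h)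
    exact (whiskerRight_iff f g).1 h'

theorem isComposite : IsComposite isInducedStructure (embedding C) where
  obj_eq _ := rfl
  map_eq f := eq_eqToHom_comp_comp (ofHom ((embed C).map f))
  unit_eq := rfl
  mu_eq A B := eq_eqToHom_comp_comp (ofHom (embedMu A B))

/-! ### The canonical trace of embedded morphisms -/

variable (C) in
/-- The canonical trace of the completion. -/
def completionTrace : TotalTrace (Completion C) := canonicalTotalTrace (Completion C)

/-- Precomposition with a split arrow. -/
def preSplit {A B D : IntP C} (s : Split A B) (f : B ⟶ D) : A ⟶ D :=
  Hom.mk (s.pos ▷ D.neg ≫ f.hom ≫ D.pos ◁ s.neg)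

/-- Postcomposition with a split arrow. -/
def postSplit {A B D : IntP C} (f : A ⟶ B) (s : Split B D) : A ⟶ D :=
  Hom.mk (A.pos ◁ s.neg ≫ f.hom ≫ s.pos ▷ A.neg)

theorem ofSplit_comp_ofHom {A B D : IntP C} (s : Split A B) (f : B ⟶ D) :
    ofSplit s ≫ ofHom f = ofHom (preSplit s f) := split_comp_ofHom _ _ _

theorem ofHom_comp_ofSplit_eq_postSplit {A B D : IntP C} (f : A ⟶ B) (s : Split B D) :
    ofHom f ≫ ofSplit s = ofHom (postSplit f s) := ofHom_comp_split _ _ _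

/-- The first half of the canonical trace of a split arrow. -/
def traceIn {A B U : IntP C} (s : Split (tensorObj A U) (tensorObj B U)) :
    A ⟶ tensorObj B (tensorObj U U.dual) :=
  preSplit (.rightUnitInv A) (postSplit (tensorHom (idHom A) (etaHom U))
    (((Split.braid U.dual U).left A).comp ((Split.assocInv A U U.dual).comp
      ((s.right U.dual).comp (.assoc B U U.dual)))))

/-- The second half of the canonical trace of a split arrow. -/
def traceOut (B U : IntP C) : tensorObj B (tensorObj U U.dual) ⟶ B :=
  postSplit (tensorHom (idHom B) (epsHom U)) (.rightUnit B)

/-- Of the eight factors of the canonical trace only `1 ⊗ η` and `1 ⊗ ε` are not split. The split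
ones can be absorbed, which leaves a single composition of two arrows. -/
theorem canonicalTrace_ofSplit {A B U : IntP C} (s : Split (tensorObj A U) (tensorObj B U)) :
    canonicalTrace (A := of A) (B := of B) (of U) (ofSplit s) =
      ofHom (traceIn s) ≫ ofHom (traceOut B U) := by
  trans ofSplit (.rightUnitInv A) ≫ ofHom (tensorHom (idHom A) (etaHom U)) ≫
    homLeft A (ofSplit (.braid U.dual U)) ≫ ofSplit (.assocInv A U U.dual) ≫
    homRight (ofSplit s) U.dual ≫ ofSplit (.assoc B U U.dual) ≫
    ofHom (tensorHom (idHom B) (epsHom U)) ≫ ofSplit (.rightUnit B)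
  · rfl
  · rw [traceIn, traceOut, ← ofSplit_comp_ofHom, ← ofHom_comp_ofSplit_eq_postSplit, ← ofHom_comp_ofSplit_eq_postSplit,
      ← ofSplit_comp, ← ofSplit_comp, ← ofSplit_comp, homLeft_ofSplit, homRight_ofSplit]
    simp only [Category.assoc]

/-- Naturality is only directed; for isomorphisms the inverses supply the converse. -/
theorem mem_tr_conj_iff {A A' B B' U : C} (a : A' ≅ A) (b : B ≅ B') {f : A ⊗ U ⟶ B ⊗ U}
    {t : A ⟶ B} :
    a.hom ≫ t ≫ b.hom ∈ tr U (a.hom ▷ U ≫ f ≫ b.hom ▷ U) ↔ t ∈ tr U f := by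
  refine ⟨fun h => ?_, fun h => FormalTrace.mem_tr_comp h _ _⟩
  simpa [← comp_whiskerRight_assoc, ← comp_whiskerRight] using
    FormalTrace.mem_tr_comp h a.inv b.inv

/-- The composition is traced over the negative part of `B ⊗ (U ⊗ U*)`. As `(U*)⁻ = U⁺`, this is `U`
up to units, and the traced morphism is `f` up to unitors. -/
theorem isComp_trace_iff {A B U : C} (f : A ⊗ U ⟶ B ⊗ U) (g : A ⟶ B) :
    IsComp (traceIn ((Split.mu A U).comp ((Split.emb f).comp (.muInv B U))))
      (traceOut ((embed C).obj B) ((embed C).obj U)) ((embed C).map g) ↔ g ∈ tr U f := by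
  have e : tr (((U ⊗ 𝟙_ C) ⊗ 𝟙_ C : C)) (rightIn ((embed C).obj A)
        (tensorObj ((embed C).obj B) (tensorObj ((embed C).obj U) ((embed C).obj U).dual))
        ((embed C).obj B) ≫ 𝟙_ C ◁
        (traceIn ((Split.mu A U).comp ((Split.emb f).comp (.muInv B U)))).hom ≫
      rightOut ((embed C).obj A) (traceOut ((embed C).obj B) ((embed C).obj U))) =
      tr U ((ρ_ A).hom ▷ U ≫ f ≫ (ρ_ B).inv ▷ U) := by
    refine FormalTrace.trace_conj (F := ⟨(U ⊗ 𝟙_ C) ⊗ 𝟙_ C, _⟩) (G := ⟨U, _⟩)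
      (ρ_ (U ⊗ 𝟙_ C) ≪≫ ρ_ U) ?_
    dsimp only [rightOut, traceIn, traceOut, preSplit, postSplit]
    rw [tensorHom_id_left, tensorHom_id_left]
    dsimp only [rightIn, tensorLeftIn, tensorLeftOut, etaHom, epsHom, tensorObj, dual, unit, embed,
      Split.comp, Split.left, Split.right, Split.mu, Split.muInv, Split.emb, Split.braid,
      Split.assoc, Split.assocInv, Split.rightUnit, Split.rightUnitInv, Iso.trans_hom]
    let w : List C := [A, U, B, U]
    have := Diagram.box w (♯0 ⊠ ♯1) (♯2 ⊠ ♯3) f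
    exact Diagram.eq w ((♯0 ⊠ .one) ⊠ ((♯1 ⊠ .one) ⊠ .one))
  have h := mem_tr_conj_iff (ρ_ A) (ρ_ B).symm (f := f) (t := g)
  rw [Iso.symm_hom, ← whiskerRight_id, ← e] at h
  exact h

/-- A composite of two arrows equals the class of an arrow only if their partial composite is
defined with that value; this forces `Tr^U(f)` to be defined. -/
theorem mem_tr_iff_canonicalTrace {A B U : C} (f : A ⊗ U ⟶ B ⊗ U) (g : A ⟶ B) :
    g ∈ tr U f ↔ canonicalTrace ((embedding C).obj U)
      (Functor.LaxMonoidal.μ (embedding C) A U ≫ (embedding C).map f ≫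
        Functor.OplaxMonoidal.δ (embedding C) B U) = (embedding C).map g := by
  rw [← isComp_trace_iff, ← ofHom_comp_ofHom_eq_iff, ← canonicalTrace_ofSplit]
  have e : ofHom (embedMu A U) ≫ ofHom ((embed C).map f) ≫ ofSplit (.muInv B U) =
      ofSplit ((Split.mu A U).comp ((Split.emb f).comp (.muInv B U))) := by
    rw [ofHom_embedMu, ofHom_embed_map, ofSplit_comp, ofSplit_comp]
  exact iff_of_eq (congrArg (· = ofHom ((embed C).map g))
    (congrArg (canonicalTrace (A := of ((embed C).obj A)) (B := of ((embed C).obj B))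
      (of ((embed C).obj U))) e.symm))

end IntP

end

/-! ### The embedding theorem. -/

theorem mainTheorem1 (C : Type u) [Category.{v} C] [MonoidalCategory C] [SymmetricCategory C]
    [PartialTrace C] :
    -- `Path(Int^p(C))/∼` is compact closed, with the structure induced from `Int^p(C)`,
    ∃ (_ : MonoidalCategory (IntP.Completion C)) (_ : SymmetricCategory (IntP.Completion C))
      (_ : LeftRigidCategory (IntP.Completion C)) (hD : IntP.IsInducedStructure C)
      -- its canonical trace is a total trace,
      (T : TotalTrace (IntP.Completion C))
      (_ : ∀ {A B : IntP.Completion C} (U : IntP.Completion C) (f : A ⊗ U ⟶ B ⊗ U),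
        T.tr U f = canonicalTrace U f)
      -- and the composite `C → Int^p(C) → Path(Int^p(C))/∼` is a strong symmetric monoidal functor
      (F : C ⥤ IntP.Completion C) (_ : F.Braided),
      IntP.IsComposite hD F ∧
      -- that is faithful, and preserves and reflects the trace.
      F.Faithful ∧
      ∀ {A B U : C} (f : A ⊗ U ⟶ B ⊗ U) (g : A ⟶ B),
        g ∈ PartialTrace.tr U f ↔
          T.tr (F.obj U) (Functor.LaxMonoidal.μ F A U ≫ F.map f ≫
            Functor.OplaxMonoidal.δ F B U) = F.map g :=
  ⟨IntP.completionMonoidal, IntP.completionSymmetric, IntP.completionLeftRigid,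
    IntP.isInducedStructure, IntP.completionTrace C, fun _ _ => rfl, IntP.embedding C,
    IntP.embeddingBraided, IntP.isComposite, IntP.embedding_faithful,
    IntP.mem_tr_iff_canonicalTrace⟩
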